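/- **Setting.** Let $X$ and $A$ be finite sets, $A\neq\emptyset$, with $X$ partitioned into layers $X_0=\{x_0\},X_1,\dots,X_L=\{x_L\}$, $L\ge 1$; $k(x)$ denotes the layer of $x$. A transition function $P(x'\mid x,a)$ is, for each non-terminal $x$ and each $a$, a probability distribution on $X_{k(x)+1}$ (and is $0$ otherwise). For a policy $\pi(a\mid x)$ let $q^{P,\pi}(x,a)=\Pr[x_k=x,\,a_k=a\mid P,\pi]$ for $x\in X_k$, $k<L$ (and $0$ for $x=x_L$), a vector in $\mathbb R^{X\times A}$. For a set $\mathcal P$ of transition functions, $\Delta(\mathcal P)$ is the set of all $q^{P',\pi}$ with $P'\in\mathcal P$ and $\pi$ a policy. The true, unknown transition function is $P$, and $\Delta(M)=\Delta(\{P\})$. Let $m\ge1$, $T\ge 1$, $\delta\in(0,1)$. In each episode $t=1,\dots,T$ there are a reward vector $r_t\in[0,1]^{X\times A}$ and a constraint matrix $G_t\in[-1,1]^{(X\times A)\times m}$; the learner plays a policy $\pi_t$, and, conditionally on the past and on $r_t,G_t$, a trajectory $(x_0,a_0,\dots,a_{L-1},x_L)$ is generated by $P$ and $\pi_t$; then the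 learner observes the trajectory, $r_t$ and $G_t$. Constraints are stochastic: each $G_t$ has a fixed law $\mathcal G$ and is independent of the past, and $\overline G=\mathbb E_{\mathcal G}[G]$. Rewards are either stochastic (each $r_t$ has a fixed law $\mathcal R$ and is independent of the past; $\overline r=\mathbb E_{\mathcal R}[r]$) or adversarial ($r_t$ is an arbitrary function of the past; $\overline r=\frac1T\sum_{t=1}^T r_t$). Let $\mathrm{OPT}_{r,G}=\max\{r^\top q: q\in\Delta(M),\ G^\top q\le 0\}$, let $q^*$ be an optimal solution for $(\overline r,\overline G)$, and, with $q_t=q^{P,\pi_t}$, $$R_T=T\,\mathrm{OPT}_{\overline r,\overline G}-\sum_{t=1}^T r_t^\top q_t,\qquad V_T=\max_{i\in[m]}\sum_{t=1}^T[G_t^\top q_t]_i,$$ $$\rho=\max_{q\in\Delta(M)}\min_{i\in[m]}-[\overline G^\top q]_i,\qquad \zeta=\frac{20mL^2}{\rho^2}.$$ **Algorithm PDGD-OPS.** Put $C=5|X||A|/L$ and $\eta=\big(100\,m|X||A|\sqrt{T\ln(T^2/\delta)}\big)^{-1}$. Start from $\lambda_1=0$ and $\widehat q_1(x,a)=1/(|X_{k(x)}||A|)$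 for $x\ne x_L$, $\widehat q_1(x_L,a)=0$. In episode $t$ play $\pi_t(a\mid x)=\widehat q_t(x,a)/\sum_b\widehat q_t(x,b)$ (uniform where the denominator is $0$). Let $\ell_t=G_t\lambda_t-r_t$, $\overline\ell_t=\max_{s\le t}\|\ell_s\|_\infty$, $\eta_t=1/(\overline\ell_tC\sqrt T)$ (with $\eta_t=0$ if $\overline\ell_t=0$). Update the numbers of visits $N(x,a)$ and $M(x'\mid x,a)$; if some visited pair now has $N(x,a)\ge\max\{1,2N_0(x,a)\}$, where $N_0$ is the value of $N$ at the start of the current epoch (initially $0$), start a new epoch, i.e. set $N_0\leftarrow N$, $M_0\leftarrow M$. Let $\mathcal P$ be the set of transition functions $\widehat P$ with, for all $(x,a)$, $$\sum_{x'}\Big|\widehat P(x'\mid x,a)-\tfrac{M_0(x'\mid x,a)}{\max\{1,N_0(x,a)\}}\Big|\le\sqrt{\frac{2|X_{k(x)+1}|\ln(T|X||A|/\delta)}{\max\{1,N_0(x,a)\}}} ,$$ and set, with $\Pi$ the Euclidean projection, $$\widehat q_{t+1}=\Pi_{\Delta(\mathcal P)}(\widehat q_t-\eta_t\ell_t),\qquad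 \lambda_{t+1}=\Pi_{[0,T^{1/4}]^m}(\lambda_t+\eta G_t^\top\widehat q_t).$$ **Notation.** $R^{\mathsf P}_T(q)=\sum_t\ell_t^\top(q_t-q)$, $R^{\mathsf D}_T(\lambda)=\sum_t(\lambda-\lambda_t)^\top G_t^\top\widehat q_t$, $\mathcal E^r_\delta=\frac{L}{\sqrt2}\sqrt{T\ln\frac2\delta}$, $\mathcal E^G_\delta=2L\sqrt{2T\ln\frac{T^2}{\delta}}$, and $\mathcal E^q_\delta=4L|X|\sqrt{2T\ln\frac1\delta}+6L|X|\sqrt{2T|A|\ln\frac{T|X||A|}{\delta}}$. **Theorem.** Suppose that the constraints are stochastic and that $\rho\ge T^{-1/8}L\sqrt{20m}$. Then an optimal solution $q^*$ exists, and the following holds for every choice of it (which may depend on the outcome when the rewards are adversarial). If the rewards are adversarial, then with probability at least $1-4\delta$ $$R_T\le\zeta\mathcal E^G_\delta+\zeta\mathcal E^q_\delta+R^{\mathsf D}_T(0)+R^{\mathsf P}_T(q^*),\qquad V_T\le\tfrac1\eta\zeta+\mathcal E^q_\delta .$$ If the rewards are stochastic, then with probability at least $1-5\delta$ $$R_T\le\mathcal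 E^r_\delta+\zeta\mathcal E^G_\delta+\zeta\mathcal E^q_\delta+R^{\mathsf D}_T(0)+R^{\mathsf P}_T(q^*),\qquad V_T\le\tfrac1\eta\zeta+\mathcal E^q_\delta .$$ In both cases, on the same event, $R_T$ and $V_T$ are $\widetilde{\mathcal O}(\zeta\sqrt T)$: there is a constant $c>0$ depending only on the layered state space, the action space and $m$ (not on $T$, $\delta$, $P$ or the rewards and constraints) with $$R_T\le c\,\zeta\sqrt{T\ln(T^2/\delta)},\qquad V_T\le c\,\zeta\sqrt{T\ln(T^2/\delta)} .$$ -/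

import Mathlib

open MeasureTheory ProbabilityTheory
open scoped BigOperators

noncomputable section

namespace CMDP

/-- The state space of an episodic loop-free MDP: `X` is partitioned into the layers
`{x | layer x = k}`, `k = 0, …, L`, and the first and last layers are singletons. -/
structure LoopFree (X : Type*) (L : ℕ) where
  layer : X → ℕ
  init : X
  final : X
  horizon_pos : 0 < L
  layer_le : ∀ x, layer x ≤ L
  layer_eq_zero_iff : ∀ x, layer x = 0 ↔ x = init
  layer_eq_last_iff : ∀ x, layer x = L ↔ x = final

/-- Vectors indexed by state-action pairs, with the Euclidean norm. -/
abbrev Vec (X A : Type*) := EuclideanSpace ℝ (X × A)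

/-- A trajectory `(x_0, …, x_L)`, `(a_0, …, a_{L-1})`. -/
abbrev Traj (X A : Type*) (L : ℕ) := (Fin (L + 1) → X) × (Fin L → A)

/-- A policy `π x a = π(a | x)`. -/
def IsPolicy {X A : Type*} [Fintype A] (π : X → A → ℝ) : Prop :=
  ∀ x, (∀ a, 0 ≤ π x a) ∧ ∑ a, π x a = 1

/-- The Euclidean projection of `u` onto `K` (meaningful when a nearest point exists). -/
def proj {ι : Type*} [Fintype ι] (K : Set (EuclideanSpace ℝ ι)) (u : EuclideanSpace ℝ ι) :
    EuclideanSpace ℝ ι :=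
  Classical.epsilon fun v => v ∈ K ∧ ∀ w ∈ K, ‖u - v‖ ≤ ‖u - w‖

/-- `r^⊤ q`. -/
def dot {X A : Type*} [Fintype X] [Fintype A] (r : X → A → ℝ) (q : Vec X A) : ℝ :=
  ∑ x, ∑ a, r x a * q (x, a)

/-- `[G^⊤ q]_i`. -/
def viol {X A : Type*} [Fintype X] [Fintype A] {m : ℕ} (G : X → A → Fin m → ℝ)
    (q : Vec X A) (i : Fin m) : ℝ :=
  dot (fun x a => G x a i) q

/-- The policy induced by an occupancy vector, `π^q(a | x) = q(x, a) / q(x)`; uniform at the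
states with `q(x) = 0`, where the quotient is undefined. -/
def inducedPolicy {X A : Type*} [Fintype A] (q : Vec X A) (x : X) (a : A) : ℝ :=
  if ∑ b, q (x, b) = 0 then 1 / (Fintype.card A : ℝ) else q (x, a) / ∑ b, q (x, b)

section MDP

variable {X A : Type*} [Fintype X] [DecidableEq X] [Fintype A] [DecidableEq A] {L : ℕ}
  (S : LoopFree X L)

/-- The `k`-th layer. -/
def LoopFree.layerSet (k : ℕ) : Finset X := Finset.univ.filter fun x => S.layer x = k

/-- Transition functions `P x a x' = P(x' | x, a)`: probability distributions at every
non-terminal state, positive only from one layer to the next. -/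
def LoopFree.IsTransition (P : X → A → X → ℝ) : Prop :=
  (∀ x a x', 0 ≤ P x a x') ∧
  (∀ x a x', 0 < P x a x' → S.layer x' = S.layer x + 1) ∧
  (∀ x a, S.layer x < L → ∑ x', P x a x' = 1)

/-- The probability of a trajectory under the transition function `P` and the policy `π`. -/
def LoopFree.pathProb (P : X → A → X → ℝ) (π : X → A → ℝ) (τ : Traj X A L) : ℝ :=
  if τ.1 0 = S.init then
    ∏ k : Fin L, π (τ.1 k.castSucc) (τ.2 k) * P (τ.1 k.castSucc) (τ.2 k) (τ.1 k.succ)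
  else 0

/-- `q^{P,π}(x, a, x') = Pr[x_k = x, a_k = a, x_{k+1} = x' | P, π]`, where `x` is in layer `k`. -/
def LoopFree.occ3 (P : X → A → X → ℝ) (π : X → A → ℝ) (x : X) (a : A) (x' : X) : ℝ :=
  ∑ τ : Traj X A L with
    ∃ k : Fin L, (k : ℕ) = S.layer x ∧ τ.1 k.castSucc = x ∧ τ.2 k = a ∧ τ.1 k.succ = x',
    S.pathProb P π τ

/-- The occupancy vector `q^{P,π}(x, a) = ∑_{x'} q^{P,π}(x, a, x')`. -/
def LoopFree.occ (P : X → A → X → ℝ) (π : X → A → ℝ) : Vec X A :=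
  WithLp.toLp 2 fun p => ∑ x', S.occ3 P π p.1 p.2 x'

/-- `Δ(𝒬)`: the occupancy vectors of all policies under the transition functions in `𝒬`. -/
def LoopFree.Delta (𝒬 : Set (X → A → X → ℝ)) : Set (Vec X A) :=
  {q | ∃ P ∈ 𝒬, ∃ π : X → A → ℝ, IsPolicy π ∧ q = S.occ P π}

variable {m : ℕ}

/-- The feasible set of the linear program with constraint matrix `G`. -/
def LoopFree.feasible (P : X → A → X → ℝ) (G : X → A → Fin m → ℝ) : Set (Vec X A) :=
  {q | q ∈ S.Delta {P} ∧ ∀ i, viol G q i ≤ 0}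

/-- `OPT_{r,G}`: the value of the linear program. -/
def LoopFree.OPT (P : X → A → X → ℝ) (r : X → A → ℝ) (G : X → A → Fin m → ℝ) : ℝ :=
  sSup (dot r '' S.feasible P G)

/-- `q` is an optimal solution of the linear program. -/
def LoopFree.IsOptimal (P : X → A → X → ℝ) (r : X → A → ℝ) (G : X → A → Fin m → ℝ)
    (q : Vec X A) : Prop :=
  q ∈ S.feasible P G ∧ ∀ q' ∈ S.feasible P G, dot r q' ≤ dot r q

/-- The feasibility parameter `ρ = max_{q ∈ Δ(M)} min_i -[G^⊤ q]_i`. -/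
def LoopFree.rho (P : X → A → X → ℝ) (G : X → A → Fin m → ℝ) : ℝ :=
  sSup ((fun q => ⨅ i : Fin m, -viol G q i) '' S.Delta {P})

/-- `ζ = 20 m L² / ρ²`. -/
def LoopFree.zeta (P : X → A → X → ℝ) (G : X → A → Fin m → ℝ) : ℝ :=
  20 * m * L ^ 2 / S.rho P G ^ 2

/-! ### The algorithm PDGD-OPS -/

/-- What the learner observes at the end of an episode: reward vector, constraint matrix and
trajectory. -/
structure Feedback (X A : Type*) (L m : ℕ) where
  r : X → A → ℝ
  G : X → A → Fin m → ℝ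
  τ : Traj X A L

/-- The memory of the learner at the beginning of an episode. -/
structure State (X A : Type*) (m : ℕ) where
  /-- the current occupancy vector `q̂_t` -/
  q : Vec X A
  /-- the current dual vector `λ_t` -/
  lam : EuclideanSpace ℝ (Fin m)
  /-- `max_{τ < t} ‖ℓ_τ‖_∞` -/
  lbar : ℝ
  /-- running visit counter of pairs -/
  N : X → A → ℕ
  /-- running visit counter of triples -/
  M : X → A → X → ℕ
  /-- the counter of pairs at the start of the current epoch -/
  N₀ : X → A → ℕ
  /-- the counter of triples at the start of the current epoch -/
  M₀ : X → A → X → ℕ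

/-- The confidence radius `ε_i(x, a)`. -/
def LoopFree.radius (T : ℕ) (δ : ℝ) (N : X → A → ℕ) (x : X) (a : A) : ℝ :=
  Real.sqrt (2 * (S.layerSet (S.layer x + 1)).card *
    Real.log (T * Fintype.card X * Fintype.card A / δ) / max 1 (N x a : ℝ))

/-- The confidence set `𝒫_i` built from the counters at the start of the epoch. -/
def LoopFree.confSet (T : ℕ) (δ : ℝ) (N : X → A → ℕ) (M : X → A → X → ℕ) :
    Set (X → A → X → ℝ) :=
  {P | S.IsTransition P ∧
    ∀ x a, ∑ x', |P x a x' - (M x a x' : ℝ) / max 1 (N x a : ℝ)| ≤ S.radius T δ N x a}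

/-- The constant `C = 5 |X| |A| / L` in the primal learning rates. -/
def primalC (X A : Type*) [Fintype X] [Fintype A] (L : ℕ) : ℝ :=
  5 * (Fintype.card X * Fintype.card A) / L

/-- The dual learning rate `η = 1 / (100 m |X| |A| √(T ln (T²/δ)))`. -/
def dualRate (X A : Type*) [Fintype X] [Fintype A] (m T : ℕ) (δ : ℝ) : ℝ :=
  1 / (100 * m * Fintype.card X * Fintype.card A * Real.sqrt (T * Real.log (T ^ 2 / δ)))

/-- The dual decision space `[0, T^{1/4}]^m`. -/
def dualBox (m T : ℕ) : Set (EuclideanSpace ℝ (Fin m)) :=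
  {v | ∀ i, 0 ≤ v i ∧ v i ≤ (T : ℝ) ^ ((1 : ℝ) / 4)}

/-- The Lagrangian loss `ℓ = G λ - r`. -/
def loss (r : X → A → ℝ) (G : X → A → Fin m → ℝ) (lam : EuclideanSpace ℝ (Fin m))
    (x : X) (a : A) : ℝ :=
  ∑ i, G x a i * lam i - r x a

/-- Initialization: `q̂_1(x, a, x') = 1 / (|X_k| |A| |X_{k+1}|)` for `x ∈ X_k`, `x' ∈ X_{k+1}`
(summed over `x'`), `λ_1 = 0`, all counters zero. -/
def LoopFree.initState : State X A m where
  q := WithLp.toLp 2 fun p => ∑ _x' ∈ S.layerSet (S.layer p.1 + 1),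
    1 / (((S.layerSet (S.layer p.1)).card : ℝ) * Fintype.card A *
      (S.layerSet (S.layer p.1 + 1)).card)
  lam := 0
  lbar := 0
  N := fun _ _ => 0
  M := fun _ _ _ => 0
  N₀ := fun _ _ => 0
  M₀ := fun _ _ _ => 0

/-- One round of PDGD-OPS: counters and epoch update, projected gradient step on `Δ(𝒫_i)` with
rate `η_t = 1 / (ℓ̄_t C √T)`, projected gradient step of the dual player. -/
def LoopFree.step (T : ℕ) (δ : ℝ) (s : State X A m) (f : Feedback X A L m) : State X A m :=
  let ℓ : X × A → ℝ := fun p => loss f.r f.G s.lam p.1 p.2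
  let lbar := max s.lbar ‖ℓ‖
  let ηt := 1 / (lbar * primalC X A L * Real.sqrt T)
  let N : X → A → ℕ := fun x a => s.N x a +
    (Finset.univ.filter fun k : Fin L => f.τ.1 k.castSucc = x ∧ f.τ.2 k = a).card
  let M : X → A → X → ℕ := fun x a x' => s.M x a x' +
    (Finset.univ.filter fun k : Fin L =>
      f.τ.1 k.castSucc = x ∧ f.τ.2 k = a ∧ f.τ.1 k.succ = x').card
  let newEpoch : Prop := ∃ k : Fin L,
    max 1 (2 * s.N₀ (f.τ.1 k.castSucc) (f.τ.2 k)) ≤ N (f.τ.1 k.castSucc) (f.τ.2 k)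
  let N₀ := if newEpoch then N else s.N₀
  let M₀ := if newEpoch then M else s.M₀
  { q := proj (S.Delta (S.confSet T δ N₀ M₀)) (s.q - ηt • WithLp.toLp 2 ℓ)
    lam := proj (dualBox m T)
      (s.lam + dualRate X A m T δ • WithLp.toLp 2 fun i => viol f.G s.q i)
    lbar := lbar
    N := N
    M := M
    N₀ := N₀
    M₀ := M₀ }

/-- The state of PDGD-OPS at the beginning of episode `t` (episodes are `0, …, T - 1`), given
the feedback of the earlier episodes. -/
def LoopFree.run (T : ℕ) (δ : ℝ) (f : ℕ → Feedback X A L m) : ℕ → State X A m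
  | 0 => S.initState
  | t + 1 => S.step T δ (LoopFree.run T δ f t) (f t)

/-- The occupancy vector `q_t = q^{P,π_t}` of the policy `π_t = π^{q̂_t}` played in episode
`t`. -/
def LoopFree.played (P : X → A → X → ℝ) (T : ℕ) (δ : ℝ) (f : ℕ → Feedback X A L m) (t : ℕ) :
    Vec X A :=
  S.occ P (inducedPolicy (S.run T δ f t).q)

/-- The cumulative regret `T · OPT_{r̄,Ḡ} - ∑_t r_t^⊤ q_t`. -/
def LoopFree.regret (P : X → A → X → ℝ) (rbar : X → A → ℝ) (Gbar : X → A → Fin m → ℝ)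
    (T : ℕ) (δ : ℝ) (f : ℕ → Feedback X A L m) : ℝ :=
  T * S.OPT P rbar Gbar - ∑ t ∈ Finset.range T, dot (f t).r (S.played P T δ f t)

/-- The cumulative constraint violation `max_i ∑_t [G_t^⊤ q_t]_i`. -/
def LoopFree.violation (P : X → A → X → ℝ) (T : ℕ) (δ : ℝ) (f : ℕ → Feedback X A L m) : ℝ :=
  ⨆ i : Fin m, ∑ t ∈ Finset.range T, viol (f t).G (S.played P T δ f t) i

/-- The regret `R^P_T(q) = ∑_t ℓ_t^⊤ (q_t - q)` of the primal player. -/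
def LoopFree.primalRegret (P : X → A → X → ℝ) (T : ℕ) (δ : ℝ) (f : ℕ → Feedback X A L m)
    (q : Vec X A) : ℝ :=
  ∑ t ∈ Finset.range T,
    dot (loss (f t).r (f t).G (S.run T δ f t).lam) (S.played P T δ f t - q)

/-- The regret `R^D_T(λ) = ∑_t (λ - λ_t)^⊤ G_t^⊤ q̂_t` of the dual player. -/
def LoopFree.dualRegret (T : ℕ) (δ : ℝ) (f : ℕ → Feedback X A L m)
    (lam : EuclideanSpace ℝ (Fin m)) : ℝ :=
  ∑ t ∈ Finset.range T,
    ∑ i, (lam i - (S.run T δ f t).lam i) * viol (f t).G (S.run T δ f t).q i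

/-! ### The error terms -/

/-- `ℰ^q_δ = 4 L |X| √(2 T ln (1/δ)) + 6 L |X| √(2 T |A| ln (T |X| |A| / δ))`. -/
def errQ (X A : Type*) [Fintype X] [Fintype A] (L T : ℕ) (δ : ℝ) : ℝ :=
  4 * L * Fintype.card X * Real.sqrt (2 * T * Real.log (1 / δ)) +
  6 * L * Fintype.card X * Real.sqrt (2 * T * Fintype.card A *
    Real.log (T * Fintype.card X * Fintype.card A / δ))

/-- `ℰ^G_δ = 2 L √(2 T ln (T²/δ))`. -/
def errG (L T : ℕ) (δ : ℝ) : ℝ := 2 * L * Real.sqrt (2 * T * Real.log (T ^ 2 / δ))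

/-- `ℰ^r_δ = (L / √2) √(T ln (2/δ))`. -/
def errR (L T : ℕ) (δ : ℝ) : ℝ := L / Real.sqrt 2 * Real.sqrt (T * Real.log (2 / δ))

/-! ### The interaction -/

/-- The feedback sequence of the outcome `ω`. -/
def feedback {Ω : Type*} (r : ℕ → Ω → X → A → ℝ) (G : ℕ → Ω → X → A → Fin m → ℝ)
    (τ : ℕ → Ω → Traj X A L) (ω : Ω) (t : ℕ) : Feedback X A L m :=
  ⟨r t ω, G t ω, τ t ω⟩

/-- The interaction of PDGD-OPS with the environment during the episodes `0, …, T - 1`.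
`ℱ t` is the information available before episode `t`. The rewards lie in `[0, 1]`, the
constraint matrices in `[-1, 1]`, and, conditionally on the past and on the current `r_t, G_t`,
the trajectory of episode `t` is that of the Markov chain with transition function `P` and the
policy `π_t` of PDGD-OPS. -/
structure LoopFree.IsInteraction {Ω : Type*} [mΩ : MeasurableSpace Ω] (μ : Measure Ω)
    (ℱ : Filtration ℕ mΩ) (P : X → A → X → ℝ) (T : ℕ) (δ : ℝ)
    (r : ℕ → Ω → X → A → ℝ) (G : ℕ → Ω → X → A → Fin m → ℝ)
    (τ : ℕ → Ω → Traj X A L) : Prop where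
  r_mem : ∀ t < T, ∀ ω x a, r t ω x a ∈ Set.Icc (0 : ℝ) 1
  G_mem : ∀ t < T, ∀ ω x a i, G t ω x a i ∈ Set.Icc (-1 : ℝ) 1
  r_meas : ∀ t < T, Measurable[ℱ (t + 1)] (r t)
  G_meas : ∀ t < T, Measurable[ℱ (t + 1)] (G t)
  τ_meas : ∀ t < T, ∀ p, MeasurableSet[ℱ (t + 1)] (τ t ⁻¹' {p})
  τ_law : ∀ t < T, ∀ p,
    μ⟦τ t ⁻¹' {p} | ℱ t ⊔ MeasurableSpace.comap (r t) inferInstance ⊔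
        MeasurableSpace.comap (G t) inferInstance⟧
      =ᵐ[μ] fun ω => S.pathProb P (inducedPolicy (S.run T δ (feedback r G τ ω) t).q) p

end MDP

/-- A stochastic sequence: each `Y t`, `t < T`, is drawn from the fixed distribution `𝒟`,
independently of the past. -/
def IsStochastic {Ω E : Type*} [mΩ : MeasurableSpace Ω] [MeasurableSpace E] (μ : Measure Ω)
    (ℱ : Filtration ℕ mΩ) (T : ℕ) (𝒟 : Measure E) (Y : ℕ → Ω → E) : Prop :=
  ∀ t < T, HasLaw (Y t) 𝒟 μ ∧ Indep (MeasurableSpace.comap (Y t) inferInstance) (ℱ t) μ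

/-- An adversarial sequence: each `Y t`, `t < T`, is an arbitrary function of the information
available before episode `t` (in particular, any fixed sequence is allowed). -/
def IsAdversarial {Ω E : Type*} [mΩ : MeasurableSpace Ω] [MeasurableSpace E]
    (ℱ : Filtration ℕ mΩ) (T : ℕ) (Y : ℕ → Ω → E) : Prop :=
  ∀ t < T, Measurable[ℱ t] (Y t)

/-- The mean constraint matrix `E_{G ∼ 𝒢}[G]`. -/
def meanG {X A : Type*} {m : ℕ} (𝒢 : Measure (X → A → Fin m → ℝ)) (x : X) (a : A)
    (i : Fin m) : ℝ :=
  ∫ g, g x a i ∂𝒢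

/-- The mean reward vector `E_{r ∼ ℛ}[r]`. -/
def meanR {X A : Type*} (ℛ : Measure (X → A → ℝ)) (x : X) (a : A) : ℝ :=
  ∫ g, g x a ∂ℛ

/-- The empirical average `(1/T) ∑_t r_t` of the rewards. -/
def avgR {X A Ω : Type*} (T : ℕ) (r : ℕ → Ω → X → A → ℝ) (ω : Ω) (x : X) (a : A) : ℝ :=
  (1 / (T : ℝ)) * ∑ t ∈ Finset.range T, r t ω x a

end CMDP

end

open CMDP

/-! PDGD-OPS plays a Lagrangian game. The primal player runs projected gradient descent over
optimistic occupancy vectors against the losses G_t λ_t - r_t, and the dual player moves λ along the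
violations of q̂_t. Write D = √(T ln(T²/δ)). The proof rests on one fact, `lamSum_lt`: with high
probability ‖λ_t‖₁ < ζ for all t ≤ T.

The reason is a negative drift. By compactness some q₀ in Δ(M) satisfies every mean constraint with
margin ρ. Suppose b is the first time with ‖λ_b‖₁ ≥ ζ, and let a be the last time before b with
‖λ_a‖₁ ≤ L/ρ. On [a, b) the primal player has regret at most 6|X||A|(1+ζ)√T against q₀
(`sum_dot_lossAt_le`, a bound valid on every interval), while λ_tᵀG_tᵀq₀ is at most -ρ‖λ_t‖₁ up to a
martingale. Hence the sum of λ_tᵀG_tᵀq̂_t is at most the sum of L - ρ‖λ_t‖₁ plus an error of order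
|X||A|ζD (`sum_lam_mul_viol_le`). Above the level L/ρ the drift is negative, so the choice of η
gives ζ² ≤ m‖λ_b‖₂² ≤ ζ/20 + (7+9ζ)/50 + 1, which is false for ζ ≥ 20. Azuma's inequality needs a
multiplier that is bounded beforehand. It is therefore applied to `truncLam`, which coincides with λ
up to the first bad time, so there is no circularity.

The hypothesis on ρ says exactly that ζ ≤ T^{1/4}, so the ceiling of the dual box is never reached.
The dual step is then only clipped from below, whence η times the cumulated violation of q̂_t is at
most λ_T ≤ ζ in each coordinate (`sum_viol_run_le`). For the regret, an exact identity
(`sum_dot_sub_played_eq`) splits the reward gap to a vector q into the two players' regrets, the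
term λ_tᵀG_tᵀq, and the term λ_tᵀG_tᵀ(q̂_t - q_t). If q is feasible for the mean constraints, the
first of these terms is only noise. The noise is controlled entry by entry, uniformly in q, because
q* may depend on the outcome.

Replacing q̂_t by q_t costs `errQ`. Both are occupancy vectors of one policy, under a transition
function in the confidence set and under P, so their distance is at most L times the expected sum of
confidence widths along the path (`sum_abs_occ_sub_le`). A martingale replaces expected by actual
visits, and the doubling epochs make the sum of 1/√N₀ of order √N. That P lies in the confidence
sets is an L¹ deviation inequality: the deviation is tested on subsets of the next layer, with an
exponential supermartingale stopped at the n-th visit.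

All probabilistic statements come from one device, `CondExpLeOne`, with Hoeffding's lemma for the
increments. Four events of failure probability δ make up `Good`: confidence sets, visits, the drift
at q₀, and the entries of G_t. A fifth, for the reward noise, is needed only when rewards are
stochastic. -/

set_option linter.unusedSectionVars false

namespace CMDP

/-! ### Euclidean projections -/

section Projection

variable {ι : Type*} [Fintype ι]

/-- No point satisfies the predicate given to `Classical.epsilon`, whatever `u` is, so the default
value is a constant. This keeps `proj K` measurable when `K` is empty. -/
theorem proj_of_empty {u u' : EuclideanSpace ℝ ι} : proj (∅ : Set (EuclideanSpace ℝ ι)) u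
    = proj ∅ u' := by
  simp [proj]

theorem proj_spec {K : Set (EuclideanSpace ℝ ι)} (hne : K.Nonempty) (hK : IsClosed K)
    (hc : Convex ℝ K) (u : EuclideanSpace ℝ ι) :
    proj K u ∈ K ∧ ∀ w ∈ K, inner ℝ (u - proj K u) (w - proj K u) ≤ 0 := by
  have hex : ∃ v, v ∈ K ∧ ∀ w ∈ K, ‖u - v‖ ≤ ‖u - w‖ := by
    obtain ⟨v, hv, h⟩ := exists_norm_eq_iInf_of_complete_convex hne hK.isComplete hc u
    refine ⟨v, hv, fun w hw => ?_⟩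
    rw [h]
    exact ciInf_le ⟨0, by rintro _ ⟨y, rfl⟩; positivity⟩ (⟨w, hw⟩ : K)
  have hs : proj K u ∈ K ∧ ∀ w ∈ K, ‖u - proj K u‖ ≤ ‖u - w‖ := Classical.epsilon_spec hex
  refine ⟨hs.1, (norm_eq_iInf_iff_real_inner_le_zero hc hs.1).1 ?_⟩
  have : Nonempty K := hne.to_subtype
  exact le_antisymm (le_ciInf fun w => hs.2 w w.2)
    (ciInf_le ⟨0, by rintro _ ⟨y, rfl⟩; positivity⟩ (⟨_, hs.1⟩ : K))

/-- Test the variational inequality of each of the two points against the other and add: the squared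
distance between them is at most zero. -/
theorem proj_eq_of_inner_le_zero {K : Set (EuclideanSpace ℝ ι)} (hK : IsClosed K)
    (hc : Convex ℝ K) {u v : EuclideanSpace ℝ ι} (hv : v ∈ K)
    (h : ∀ w ∈ K, inner ℝ (u - v) (w - v) ≤ 0) : proj K u = v := by
  obtain ⟨hp, hi⟩ := proj_spec ⟨v, hv⟩ hK hc u
  have h1 := hi v hv
  have h2 := h _ hp
  have h3 : inner ℝ (proj K u - v) (proj K u - v) ≤ 0 := by
    have e : inner ℝ (proj K u - v) (proj K u - v)
        = inner ℝ (u - proj K u) (v - proj K u) + inner ℝ (u - v) (proj K u - v) := by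
      rw [← neg_sub (proj K u) v, inner_neg_right, ← sub_eq_neg_add, ← inner_sub_left]
      congr 1
      abel
    linarith
  rw [real_inner_self_eq_norm_sq] at h3
  have h4 : ‖proj K u - v‖ = 0 := by
    nlinarith [norm_nonneg (proj K u - v)]
  exact sub_eq_zero.1 (norm_eq_zero.1 h4)

theorem norm_proj_sub_le {K : Set (EuclideanSpace ℝ ι)} (hK : IsClosed K)
    (hc : Convex ℝ K) (u : EuclideanSpace ℝ ι) {w : EuclideanSpace ℝ ι} (hw : w ∈ K) :
    ‖proj K u - w‖ ^ 2 ≤ ‖u - w‖ ^ 2 := by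
  obtain ⟨-, hi⟩ := proj_spec ⟨w, hw⟩ hK hc u
  have h1 := hi w hw
  have e : u - w = (u - proj K u) - (w - proj K u) := by abel
  rw [e, norm_sub_sq_real (u - proj K u), norm_sub_rev w]
  have : 0 ≤ ‖u - proj K u‖ ^ 2 := by positivity
  linarith

/-- The projection is nonexpansive, again by adding the variational inequalities of the two images.
-/
theorem continuous_proj {K : Set (EuclideanSpace ℝ ι)} (hne : K.Nonempty) (hK : IsClosed K)
    (hc : Convex ℝ K) : Continuous (proj K) := by
  have : LipschitzWith 1 (proj K) := by
    refine LipschitzWith.of_dist_le_mul fun u v => ?_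
    simp only [NNReal.coe_one, one_mul, dist_eq_norm]
    obtain ⟨hu, hiu⟩ := proj_spec hne hK hc u
    obtain ⟨hv, hiv⟩ := proj_spec hne hK hc v
    have h1 := hiu _ hv
    have h2 := hiv _ hu
    set p := proj K u
    set q := proj K v
    have e : inner ℝ (u - v) (p - q) = inner ℝ (p - q) (p - q)
        - inner ℝ (u - p) (q - p) - inner ℝ (v - q) (p - q) := by
      rw [← neg_sub p q, inner_neg_right, sub_neg_eq_add, ← inner_add_left, ← inner_sub_left]
      congr 1
      abel
    have h3 := real_inner_le_norm (u - v) (p - q)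
    rw [real_inner_self_eq_norm_sq] at e
    by_contra hlt
    push Not at hlt
    nlinarith [norm_nonneg (u - v), norm_nonneg (p - q)]
  exact this.continuous

theorem measurable_proj {K : Set (EuclideanSpace ℝ ι)} (hK : IsClosed K)
    (hc : Convex ℝ K) : Measurable (proj K) := by
  rcases K.eq_empty_or_nonempty with rfl | hne
  · have : proj (∅ : Set (EuclideanSpace ℝ ι)) = fun _ => proj ∅ 0 := by
      funext u
      exact proj_of_empty
    rw [this]
    exact measurable_const
  · exact (continuous_proj hne hK hc).measurable

theorem convex_dualBox (m T : ℕ) : Convex ℝ (dualBox m T) := by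
  intro u hu v hv a b ha hb hab i
  simp only [PiLp.add_apply, PiLp.smul_apply, smul_eq_mul]
  obtain ⟨h1, h2⟩ := hu i
  obtain ⟨h3, h4⟩ := hv i
  refine ⟨by positivity, ?_⟩
  calc a * u i + b * v i ≤ a * (T : ℝ) ^ ((1 : ℝ) / 4) + b * (T : ℝ) ^ ((1 : ℝ) / 4) := by gcongr
    _ = _ := by rw [← add_mul, hab, one_mul]

theorem isClosed_dualBox (m T : ℕ) : IsClosed (dualBox m T) := by
  have : dualBox m T = ⋂ i, {v : EuclideanSpace ℝ (Fin m) |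
      0 ≤ v i ∧ v i ≤ (T : ℝ) ^ ((1 : ℝ) / 4)} := by
    ext v
    simp [dualBox]
  rw [this]
  refine isClosed_iInter fun i => ?_
  have hc : Continuous fun v : EuclideanSpace ℝ (Fin m) => v i := by fun_prop
  exact (isClosed_le continuous_const hc).inter (isClosed_le hc continuous_const)

/-- The box is a product, so the variational inequality can be checked one coordinate at a time,
where the nearest point is the clipped value. -/
theorem proj_dualBox_apply (m T : ℕ) (u : EuclideanSpace ℝ (Fin m)) (i : Fin m) :
    proj (dualBox m T) u i = max 0 (min (u i) ((T : ℝ) ^ ((1 : ℝ) / 4))) := by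
  have hB : 0 ≤ (T : ℝ) ^ ((1 : ℝ) / 4) := by positivity
  have : proj (dualBox m T) u
      = WithLp.toLp 2 fun i => max 0 (min (u i) ((T : ℝ) ^ ((1 : ℝ) / 4))) := by
    refine proj_eq_of_inner_le_zero (isClosed_dualBox m T) (convex_dualBox m T) ?_ ?_
    · intro i
      exact ⟨le_max_left _ _, max_le hB (min_le_right _ _)⟩
    · intro w hw
      rw [PiLp.inner_apply]
      refine Finset.sum_nonpos fun i _ => ?_
      simp only [PiLp.sub_apply, RCLike.inner_apply, conj_trivial]
      obtain ⟨h1, h2⟩ := hw i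
      rcases le_total (u i) 0 with h | h
      · rw [min_eq_left (h.trans hB), max_eq_left h]
        nlinarith
      · rcases le_total (u i) ((T : ℝ) ^ ((1 : ℝ) / 4)) with h' | h'
        · rw [min_eq_left h', max_eq_right h]
          simp
        · rw [min_eq_right h', max_eq_right hB]
          nlinarith
  rw [this]

end Projection

end CMDP

namespace CMDP

/-! ### Path sums and occupancy vectors -/

section Occupancy

variable {X A : Type*}

/-- The extension of a trajectory by one step. -/
def snocTraj {n : ℕ} (σ : Traj X A n) (a : A) (x : X) : Traj X A (n + 1) :=
  (Fin.snoc (α := fun _ => X) σ.1 x, Fin.snoc (α := fun _ => A) σ.2 a)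

variable [Fintype X] [DecidableEq X] [Fintype A] [DecidableEq A] {L : ℕ} (S : LoopFree X L)

theorem sum_traj_succ {n : ℕ} (F : Traj X A (n + 1) → ℝ) :
    ∑ τ, F τ = ∑ σ : Traj X A n, ∑ a, ∑ x, F (snocTraj σ a x) := by
  rw [Fintype.sum_prod_type, Fintype.sum_prod_type,
    ← (Fin.snocEquiv (fun _ : Fin (n + 2) => X)).sum_comp, Fintype.sum_prod_type, Finset.sum_comm]
  refine Finset.sum_congr rfl fun xs _ => ?_
  rw [Finset.sum_comm' (t' := Finset.univ) (s' := fun _ => Finset.univ) (by simp)]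
  rw [← (Fin.snocEquiv (fun _ : Fin (n + 1) => A)).sum_comp, Fintype.sum_prod_type,
    Finset.sum_comm]
  rfl

/-- The weight of an `n`-step trajectory. -/
def LoopFree.pathWeight (P : X → A → X → ℝ) (π : X → A → ℝ) (n : ℕ) (τ : Traj X A n) : ℝ :=
  if τ.1 0 = S.init then
    ∏ k : Fin n, π (τ.1 k.castSucc) (τ.2 k) * P (τ.1 k.castSucc) (τ.2 k) (τ.1 k.succ)
  else 0

variable {P : X → A → X → ℝ} {π : X → A → ℝ}

theorem LoopFree.pathWeight_snocTraj {n : ℕ} (σ : Traj X A n) (a : A) (x : X) :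
    S.pathWeight P π (n + 1) (snocTraj σ a x)
      = S.pathWeight P π n σ * (π (σ.1 (Fin.last n)) a * P (σ.1 (Fin.last n)) a x) := by
  have h0 : (snocTraj σ a x).1 0 = σ.1 0 := by
    rw [← Fin.castSucc_zero]
    simp only [snocTraj, Fin.snoc_castSucc]
  simp only [LoopFree.pathWeight, h0]
  split_ifs
  · rw [Fin.prod_univ_castSucc]
    congr 1
    · refine Finset.prod_congr rfl fun k _ => ?_
      simp only [snocTraj, Fin.snoc_castSucc, Fin.succ_castSucc]
    · simp only [snocTraj, Fin.snoc_castSucc, Fin.snoc_last, Fin.succ_last]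
  · simp

theorem LoopFree.layer_of_pathWeight_ne_zero (hP : S.IsTransition P) {n : ℕ} {τ : Traj X A n}
    (h : S.pathWeight P π n τ ≠ 0) (k : Fin (n + 1)) : S.layer (τ.1 k) = k := by
  unfold LoopFree.pathWeight at h
  split_ifs at h with h0
  · induction k using Fin.induction with
    | zero => simpa using (S.layer_eq_zero_iff _).2 h0
    | succ k ih =>
      have h1 := Finset.prod_ne_zero_iff.1 h k (Finset.mem_univ _)
      have h2 : P (τ.1 k.castSucc) (τ.2 k) (τ.1 k.succ) ≠ 0 := right_ne_zero_of_mul h1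
      rw [hP.2.1 _ _ _ (lt_of_le_of_ne (hP.1 _ _ _) h2.symm), ih]
      simp
  · exact absurd rfl h

theorem LoopFree.pathWeight_nonneg (hP : S.IsTransition P) (hπ : IsPolicy π) (n : ℕ)
    (τ : Traj X A n) : 0 ≤ S.pathWeight P π n τ := by
  unfold LoopFree.pathWeight
  split_ifs
  · exact Finset.prod_nonneg fun k _ => mul_nonneg ((hπ _).1 _) (hP.1 _ _ _)
  · exact le_rfl

theorem LoopFree.sum_step_eq_one (hP : S.IsTransition P) (hπ : IsPolicy π) {x : X}
    (hx : S.layer x < L) : ∑ a, ∑ x', π x a * P x a x' = 1 := by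
  simp_rw [← Finset.mul_sum, hP.2.2 x _ hx, mul_one]
  exact (hπ x).2

theorem LoopFree.sum_step_le_one (hP : S.IsTransition P) (x : X) (a : A) :
    ∑ x', P x a x' ≤ 1 := by
  rcases (S.layer_le x).lt_or_eq with h | h
  · exact (hP.2.2 x a h).le
  · refine (Finset.sum_nonpos fun x' _ => ?_).trans zero_le_one
    by_contra hc
    push Not at hc
    have := hP.2.1 _ _ _ hc
    have := S.layer_le x'
    omega

theorem LoopFree.transition_eq_zero (hP : S.IsTransition P) {x x' : X} (a : A)
    (h : S.layer x' ≠ S.layer x + 1) : P x a x' = 0 := by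
  by_contra hc
  exact h (hP.2.1 _ _ _ (lt_of_le_of_ne (hP.1 _ _ _) (Ne.symm hc)))

theorem LoopFree.transition_final (hP : S.IsTransition P) (a : A) (x' : X) {x : X}
    (hx : S.layer x = L) : P x a x' = 0 := by
  apply S.transition_eq_zero hP
  have := S.layer_le x'
  omega

/-- The probability that the `k`-th state is `x`. -/
def LoopFree.stateProb (P : X → A → X → ℝ) (π : X → A → ℝ) (k : ℕ) (x : X) : ℝ :=
  ∑ τ : Traj X A k, if τ.1 (Fin.last k) = x then S.pathWeight P π k τ else 0

theorem LoopFree.sum_pathWeight_mul_last (k : ℕ) (F : X → ℝ) :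
    ∑ τ : Traj X A k, S.pathWeight P π k τ * F (τ.1 (Fin.last k))
      = ∑ x, S.stateProb P π k x * F x := by
  simp only [LoopFree.stateProb, Finset.sum_mul]
  rw [Finset.sum_comm]
  refine Finset.sum_congr rfl fun τ _ => ?_
  simp [ite_mul]

/-- The last steps of a path can be summed out one by one, each contributing a factor 1, until step
`k` is the last. The restriction `n ≤ L` is needed because the rows of `P` at the terminal state
have sum 0. -/
theorem LoopFree.sum_pathWeight_mul_step_of_lt (hP : S.IsTransition P) (hπ : IsPolicy π)
    (F : X → A → X → ℝ) (k : ℕ) {n : ℕ} (hkn : k + 1 ≤ n) (hn : n ≤ L) :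
    ∑ τ : Traj X A n, S.pathWeight P π n τ *
        F (τ.1 ⟨k, by omega⟩) (τ.2 ⟨k, by omega⟩) (τ.1 ⟨k + 1, by omega⟩)
      = ∑ x, ∑ a, ∑ x', S.stateProb P π k x * (π x a * P x a x') * F x a x' := by
  induction n, hkn using Nat.le_induction with
  | base =>
    rw [sum_traj_succ]
    have h := S.sum_pathWeight_mul_last (P := P) (π := π) k
      (fun x => ∑ a, ∑ x', (π x a * P x a x') * F x a x')
    simp only [Finset.mul_sum, ← mul_assoc] at h ⊢
    rw [← h]
    refine Finset.sum_congr rfl fun σ _ => Finset.sum_congr rfl fun a _ =>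
      Finset.sum_congr rfl fun x _ => ?_
    have e1 : (⟨k, by omega⟩ : Fin (k + 2)) = (Fin.last k).castSucc := rfl
    have e2 : (⟨k, by omega⟩ : Fin (k + 1)) = Fin.last k := rfl
    have e3 : (⟨k + 1, by omega⟩ : Fin (k + 2)) = Fin.last (k + 1) := rfl
    rw [S.pathWeight_snocTraj, e1, e2, e3]
    simp only [snocTraj, Fin.snoc_castSucc, Fin.snoc_last]
    ring
  | succ n hkn ih =>
    rw [← ih (by omega), sum_traj_succ]
    refine Finset.sum_congr rfl fun σ _ => ?_
    by_cases h0 : S.pathWeight P π n σ = 0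
    · simp [S.pathWeight_snocTraj, h0]
    · have hl := S.layer_of_pathWeight_ne_zero hP h0 (Fin.last n)
      have hs := S.sum_step_eq_one hP hπ (x := σ.1 (Fin.last n)) (by rw [hl]; simp; omega)
      rw [← mul_one (S.pathWeight P π n σ), ← hs]
      simp only [Finset.mul_sum, Finset.sum_mul]
      refine Finset.sum_congr rfl fun a _ => Finset.sum_congr rfl fun x _ => ?_
      have e1 : (⟨k, by omega⟩ : Fin (n + 2)) = (⟨k, by omega⟩ : Fin (n + 1)).castSucc := rfl
      have e2 : (⟨k, by omega⟩ : Fin (n + 1)) = (⟨k, by omega⟩ : Fin n).castSucc := rfl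
      have e3 : (⟨k + 1, by omega⟩ : Fin (n + 2)) = (⟨k + 1, by omega⟩ : Fin (n + 1)).castSucc :=
        rfl
      rw [S.pathWeight_snocTraj, e1, e3]
      simp only [snocTraj, Fin.snoc_castSucc]
      rw [e2, Fin.snoc_castSucc]

theorem LoopFree.sum_pathProb_mul_step (hP : S.IsTransition P) (hπ : IsPolicy π)
    (F : X → A → X → ℝ) (k : Fin L) :
    ∑ τ : Traj X A L, S.pathProb P π τ * F (τ.1 k.castSucc) (τ.2 k) (τ.1 k.succ)
      = ∑ x, ∑ a, ∑ x', S.stateProb P π k x * (π x a * P x a x') * F x a x' :=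
  S.sum_pathWeight_mul_step_of_lt hP hπ F k k.2 le_rfl

theorem LoopFree.stateProb_nonneg (hP : S.IsTransition P) (hπ : IsPolicy π) (k : ℕ) (x : X) :
    0 ≤ S.stateProb P π k x := by
  refine Finset.sum_nonneg fun τ _ => ?_
  split_ifs
  · exact S.pathWeight_nonneg hP hπ k τ
  · exact le_rfl

theorem LoopFree.stateProb_eq_zero (hP : S.IsTransition P) {k : ℕ} {x : X}
    (h : S.layer x ≠ k) : S.stateProb P π k x = 0 := by
  refine Finset.sum_eq_zero fun τ _ => ?_
  split_ifs with hx
  · by_contra hc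
    have := S.layer_of_pathWeight_ne_zero hP hc (Fin.last k)
    rw [hx] at this
    exact h (by simpa using this)
  · rfl

theorem LoopFree.stateProb_zero (x : X) :
    S.stateProb P π 0 x = if x = S.init then 1 else 0 := by
  unfold LoopFree.stateProb LoopFree.pathWeight
  rw [Fintype.sum_prod_type, ← (Equiv.funUnique (Fin 1) X).symm.sum_comp]
  simp only [Finset.univ_unique, Finset.univ_eq_empty, Finset.prod_empty, Finset.sum_singleton]
  simp [Equiv.funUnique, eq_comm]

theorem LoopFree.stateProb_succ (k : ℕ) (x' : X) :
    S.stateProb P π (k + 1) x' = ∑ x, ∑ a, S.stateProb P π k x * (π x a * P x a x') := by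
  have h := S.sum_pathWeight_mul_last (P := P) (π := π) k (fun x => ∑ a, (π x a * P x a x'))
  simp only [Finset.mul_sum] at h
  rw [← h, LoopFree.stateProb, sum_traj_succ]
  refine Finset.sum_congr rfl fun σ _ => Finset.sum_congr rfl fun a _ => ?_
  simp only [S.pathWeight_snocTraj]
  simp [snocTraj, Fin.snoc_last]

theorem LoopFree.sum_stateProb (hP : S.IsTransition P) (hπ : IsPolicy π) {k : ℕ} (hk : k ≤ L) :
    ∑ x, S.stateProb P π k x = 1 := by
  induction k with
  | zero => simp [S.stateProb_zero]
  | succ k ih =>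
    simp only [S.stateProb_succ]
    rw [Finset.sum_comm, ← ih (by omega)]
    refine Finset.sum_congr rfl fun x _ => ?_
    by_cases hx : S.layer x = k
    · rw [Finset.sum_comm]
      simp_rw [← Finset.mul_sum]
      simp_rw [hP.2.2 x _ (by omega : S.layer x < L), mul_one, (hπ x).2, mul_one]
    · simp [S.stateProb_eq_zero hP hx]

theorem LoopFree.pathProb_nonneg (hP : S.IsTransition P) (hπ : IsPolicy π) (τ : Traj X A L) :
    0 ≤ S.pathProb P π τ := S.pathWeight_nonneg hP hπ L τ

theorem LoopFree.sum_pathProb (hP : S.IsTransition P) (hπ : IsPolicy π) :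
    ∑ τ : Traj X A L, S.pathProb P π τ = 1 := by
  have h := S.sum_pathWeight_mul_last (P := P) (π := π) L (fun _ => 1)
  simp only [mul_one] at h
  rw [← S.sum_stateProb hP hπ le_rfl, ← h]
  rfl

/-- The trajectory passes through `x, a, x'` at the layer of `x`. -/
def LoopFree.Visits (τ : Traj X A L) (x : X) (a : A) (x' : X) : Prop :=
  ∃ k : Fin L, (k : ℕ) = S.layer x ∧ τ.1 k.castSucc = x ∧ τ.2 k = a ∧ τ.1 k.succ = x'

/-- The time index in the definition is forced to be the layer of `x`, so the sum over paths is the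
expectation of an indicator at one fixed step. -/
theorem LoopFree.occ3_of_lt (hP : S.IsTransition P) (hπ : IsPolicy π) {x : X}
    (hx : S.layer x < L) (a : A) (x' : X) :
    S.occ3 P π x a x' = S.stateProb P π (S.layer x) x * (π x a * P x a x') := by
  have h := S.sum_pathProb_mul_step hP hπ
    (fun y b y' => if y = x ∧ b = a ∧ y' = x' then 1 else 0) ⟨S.layer x, hx⟩
  have e : ∑ y, ∑ b, ∑ y', S.stateProb P π (S.layer x) y * (π y b * P y b y') *
      (if y = x ∧ b = a ∧ y' = x' then 1 else 0)
      = S.stateProb P π (S.layer x) x * (π x a * P x a x') := by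
    rw [Finset.sum_eq_single x, Finset.sum_eq_single a, Finset.sum_eq_single x']
    · simp
    · intro y _ hy; simp [hy]
    · simp
    · intro y _ hy; simp [hy]
    · simp
    · intro y _ hy; simp [hy]
    · simp
  rw [← e, ← h, LoopFree.occ3, Finset.sum_filter]
  refine Finset.sum_congr rfl fun τ _ => ?_
  rw [mul_ite, mul_one, mul_zero]
  congr 1
  simp only [eq_iff_iff]
  constructor
  · rintro ⟨k, hk, h⟩
    have : k = ⟨S.layer x, hx⟩ := Fin.ext hk
    subst this
    exact h
  · intro h
    exact ⟨⟨S.layer x, hx⟩, rfl, h⟩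

theorem LoopFree.occ3_final {x : X} (hx : S.layer x = L) (a : A) (x' : X) :
    S.occ3 P π x a x' = 0 := by
  rw [LoopFree.occ3, Finset.sum_filter]
  refine Finset.sum_eq_zero fun τ _ => if_neg ?_
  rintro ⟨k, hk, -⟩
  have := k.2
  omega

theorem LoopFree.occ_of_lt (hP : S.IsTransition P) (hπ : IsPolicy π) {x : X}
    (hx : S.layer x < L) (a : A) :
    S.occ P π (x, a) = S.stateProb P π (S.layer x) x * π x a := by
  change ∑ x', S.occ3 P π x a x' = _
  simp_rw [S.occ3_of_lt hP hπ hx, ← mul_assoc, ← Finset.mul_sum, hP.2.2 x a hx, mul_one]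

theorem LoopFree.occ_final {x : X} (hx : S.layer x = L) (a : A) :
    S.occ P π (x, a) = 0 := by
  change ∑ x', S.occ3 P π x a x' = _
  simp [S.occ3_final hx]

theorem LoopFree.occ3_eq (hP : S.IsTransition P) (hπ : IsPolicy π) (x : X) (a : A) (x' : X) :
    S.occ3 P π x a x' = S.occ P π (x, a) * P x a x' := by
  rcases (S.layer_le x).lt_or_eq with hx | hx
  · rw [S.occ3_of_lt hP hπ hx, S.occ_of_lt hP hπ hx, mul_assoc]
  · rw [S.occ3_final hx, S.occ_final hx, zero_mul]

theorem LoopFree.occ_nonneg (hP : S.IsTransition P) (hπ : IsPolicy π) (p : X × A) :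
    0 ≤ S.occ P π p := by
  obtain ⟨x, a⟩ := p
  rcases (S.layer_le x).lt_or_eq with hx | hx
  · rw [S.occ_of_lt hP hπ hx]
    exact mul_nonneg (S.stateProb_nonneg hP hπ _ _) ((hπ x).1 a)
  · rw [S.occ_final hx]

theorem LoopFree.sum_occ (hP : S.IsTransition P) (hπ : IsPolicy π) {x : X} (hx : S.layer x < L) :
    ∑ a, S.occ P π (x, a) = S.stateProb P π (S.layer x) x := by
  simp_rw [S.occ_of_lt hP hπ hx, ← Finset.mul_sum, (hπ x).2, mul_one]

theorem LoopFree.occ_le_one (hP : S.IsTransition P) (hπ : IsPolicy π) (p : X × A) :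
    S.occ P π p ≤ 1 := by
  obtain ⟨x, a⟩ := p
  rcases (S.layer_le x).lt_or_eq with hx | hx
  · calc S.occ P π (x, a) ≤ ∑ a, S.occ P π (x, a) :=
        Finset.single_le_sum (f := fun a => S.occ P π (x, a))
          (fun a _ => S.occ_nonneg hP hπ _) (Finset.mem_univ a)
      _ = S.stateProb P π (S.layer x) x := S.sum_occ hP hπ hx
      _ ≤ ∑ y, S.stateProb P π (S.layer x) y :=
        Finset.single_le_sum (f := fun y => S.stateProb P π (S.layer x) y)
          (fun y _ => S.stateProb_nonneg hP hπ _ _) (Finset.mem_univ x)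
      _ = 1 := S.sum_stateProb hP hπ hx.le
  · rw [S.occ_final hx]
    exact zero_le_one

theorem LoopFree.sum_range_stateProb_mul (hP : S.IsTransition P) (x : X) (c : ℝ) :
    ∑ k ∈ Finset.range L, S.stateProb P π k x * c
      = if S.layer x < L then S.stateProb P π (S.layer x) x * c else 0 := by
  split_ifs with hx
  · rw [Finset.sum_eq_single (S.layer x)]
    · intro k _ hk
      rw [S.stateProb_eq_zero hP hk.symm, zero_mul]
    · intro h
      exact absurd (Finset.mem_range.2 hx) h
  · refine Finset.sum_eq_zero fun k hk => ?_
    rw [S.stateProb_eq_zero hP, zero_mul]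
    have := Finset.mem_range.1 hk
    omega

theorem LoopFree.sum_sum_occ (hP : S.IsTransition P) (hπ : IsPolicy π) :
    ∑ x, ∑ a, S.occ P π (x, a) = L := by
  have h : ∀ x, ∑ a, S.occ P π (x, a) = ∑ k ∈ Finset.range L, S.stateProb P π k x * 1 := by
    intro x
    rw [S.sum_range_stateProb_mul hP]
    split_ifs with hx
    · rw [S.sum_occ hP hπ hx, mul_one]
    · simp [S.occ_final (le_antisymm (S.layer_le x) (not_lt.1 hx))]
  simp_rw [h, mul_one]
  rw [Finset.sum_comm, Finset.sum_congr rfl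
    fun k hk => S.sum_stateProb hP hπ (Finset.mem_range.1 hk).le]
  simp

end Occupancy

end CMDP

namespace CMDP

/-! ### Geometry of the sets of occupancy vectors -/

section DeltaGeometry

variable {X A : Type*} [Fintype X] [DecidableEq X] [Fintype A] [DecidableEq A] {L : ℕ}
  (S : LoopFree X L) {P : X → A → X → ℝ} {π : X → A → ℝ}

/-- The mass that the occupancy vector `q` sends into `x` under `P`. -/
def LoopFree.inflow (P : X → A → X → ℝ) (q : Vec X A) (x : X) : ℝ :=
  if x = S.init then 1 else ∑ y, ∑ b, q (y, b) * P y b x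

/-- The flow equations that characterize `q^{P,π}`. -/
def LoopFree.IsFlow (P : X → A → X → ℝ) (π : X → A → ℝ) (q : Vec X A) : Prop :=
  (∀ x a, S.layer x = L → q (x, a) = 0) ∧
    ∀ x a, S.layer x < L → q (x, a) = S.inflow P q x * π x a

theorem LoopFree.inflow_occ (hP : S.IsTransition P) (hπ : IsPolicy π) (x : X) :
    S.inflow P (S.occ P π) x = S.stateProb P π (S.layer x) x := by
  unfold LoopFree.inflow
  split_ifs with h
  · rw [(S.layer_eq_zero_iff x).2 h, S.stateProb_zero, if_pos h]
  · obtain ⟨j, hj⟩ : ∃ j, S.layer x = j + 1 :=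
      Nat.exists_eq_succ_of_ne_zero fun h0 => h ((S.layer_eq_zero_iff x).1 h0)
    rw [hj, S.stateProb_succ]
    refine Finset.sum_congr rfl fun y _ => Finset.sum_congr rfl fun b _ => ?_
    by_cases hy : S.layer y = j
    · have hL : S.layer y < L := by have := S.layer_le x; omega
      rw [S.occ_of_lt hP hπ hL, hy, mul_assoc]
    · rw [S.stateProb_eq_zero hP hy, S.transition_eq_zero hP (x := y) (x' := x) b (by omega)]
      simp

theorem LoopFree.isFlow_occ (hP : S.IsTransition P) (hπ : IsPolicy π) :
    S.IsFlow P π (S.occ P π) := by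
  refine ⟨fun x a hx => S.occ_final hx a, fun x a hx => ?_⟩
  rw [S.inflow_occ hP hπ, S.occ_of_lt hP hπ hx]

/-- The inflow of a state involves only the preceding layer, so the flow equations determine the
vector layer by layer. To recognize an occupancy vector it then suffices to check these equations.
-/
theorem LoopFree.IsFlow.unique (hP : S.IsTransition P) {q q' : Vec X A} (hq : S.IsFlow P π q)
    (hq' : S.IsFlow P π q') : q = q' := by
  have key : ∀ n x a, S.layer x = n → q (x, a) = q' (x, a) := by
    intro n
    induction n with
    | zero =>
      intro x a hx
      have hL : S.layer x < L := by rw [hx]; exact S.horizon_pos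
      rw [hq.2 x a hL, hq'.2 x a hL]
      simp [LoopFree.inflow, (S.layer_eq_zero_iff x).1 hx]
    | succ n ih =>
      intro x a hx
      rcases (S.layer_le x).lt_or_eq with hL | hL
      · rw [hq.2 x a hL, hq'.2 x a hL]
        congr 1
        unfold LoopFree.inflow
        split_ifs
        · rfl
        · refine Finset.sum_congr rfl fun y _ => Finset.sum_congr rfl fun b _ => ?_
          by_cases hy : S.layer y = n
          · rw [ih y b hy]
          · rw [S.transition_eq_zero hP (x := y) (x' := x) b (by omega)]
            simp
      · rw [hq.1 x a hL, hq'.1 x a hL]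
  ext ⟨x, a⟩
  exact key _ x a rfl

theorem LoopFree.IsFlow.eq_occ (hP : S.IsTransition P) (hπ : IsPolicy π) {q : Vec X A}
    (hq : S.IsFlow P π q) : q = S.occ P π :=
  LoopFree.IsFlow.unique S hP hq (S.isFlow_occ hP hπ)

theorem isPolicy_inducedPolicy [Nonempty A] {q : Vec X A} (hq : ∀ p, 0 ≤ q p) :
    IsPolicy (inducedPolicy q) := by
  intro x
  unfold inducedPolicy
  split_ifs with h
  · refine ⟨fun a => by positivity, ?_⟩
    rw [Finset.sum_const, Finset.card_univ, nsmul_eq_mul]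
    field_simp
  · refine ⟨fun a => div_nonneg (hq _) (Finset.sum_nonneg fun b _ => hq _), ?_⟩
    rw [← Finset.sum_div, div_self h]

theorem sum_mul_inducedPolicy {q : Vec X A} (hq : ∀ p, 0 ≤ q p) (x : X) (a : A) :
    (∑ b, q (x, b)) * inducedPolicy q x a = q (x, a) := by
  unfold inducedPolicy
  split_ifs with h
  · rw [h, zero_mul]
    exact ((Finset.sum_eq_zero_iff_of_nonneg fun b _ => hq (x, b)).1 h a (Finset.mem_univ _)).symm
  · field_simp

/-- At each state, mass times the induced policy gives back the occupancy vector, also when the mass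
is 0; hence the flow equations of the induced policy hold. -/
theorem LoopFree.occ_inducedPolicy [Nonempty A] (hP : S.IsTransition P) (hπ : IsPolicy π) :
    S.occ P (inducedPolicy (S.occ P π)) = S.occ P π := by
  have hq := S.occ_nonneg hP hπ
  refine (LoopFree.IsFlow.eq_occ S hP (isPolicy_inducedPolicy hq) ?_).symm
  refine ⟨fun x a hx => S.occ_final hx a, fun x a hx => ?_⟩
  rw [S.inflow_occ hP hπ, ← S.sum_occ hP hπ hx, sum_mul_inducedPolicy hq]

/-- A mixture q = αq₁ + βq₂ is the occupancy vector of the transition function whose row at (x, a)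
mixes the two given rows in the proportions αq₁(x, a) : βq₂(x, a). The weights vary with the pair,
so convexity of `𝒬` is not enough and stability under rowwise mixtures is required. -/
theorem LoopFree.convex_Delta [Nonempty A] {𝒬 : Set (X → A → X → ℝ)}
    (h𝒬 : ∀ P ∈ 𝒬, S.IsTransition P)
    (hrow : ∀ P₁ ∈ 𝒬, ∀ P₂ ∈ 𝒬, ∀ u v : X → A → ℝ, (∀ x a, 0 ≤ u x a) → (∀ x a, 0 ≤ v x a) →
      (∀ x a, u x a + v x a = 1) →
      (fun x a x' => u x a * P₁ x a x' + v x a * P₂ x a x') ∈ 𝒬) :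
    Convex ℝ (S.Delta 𝒬) := by
  rintro _ ⟨P₁, hP₁, π₁, hπ₁, rfl⟩ _ ⟨P₂, hP₂, π₂, hπ₂, rfl⟩ α β hα hβ hαβ
  have hT₁ := h𝒬 _ hP₁
  have hT₂ := h𝒬 _ hP₂
  set q₁ := S.occ P₁ π₁ with hq₁
  set q₂ := S.occ P₂ π₂ with hq₂
  set q : Vec X A := α • q₁ + β • q₂ with hq
  have hqa : ∀ p, q p = α * q₁ p + β * q₂ p := fun p => by simp [hq]
  have n₁ : ∀ p, 0 ≤ α * q₁ p := fun p => mul_nonneg hα (S.occ_nonneg hT₁ hπ₁ p)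
  have n₂ : ∀ p, 0 ≤ β * q₂ p := fun p => mul_nonneg hβ (S.occ_nonneg hT₂ hπ₂ p)
  have hq0 : ∀ p, 0 ≤ q p := fun p => by rw [hqa]; exact add_nonneg (n₁ p) (n₂ p)
  -- Where q vanishes any weights do; (1, 0) is taken so that they still add up to 1.
  set u : X → A → ℝ := fun x a => if q (x, a) = 0 then 1 else α * q₁ (x, a) / q (x, a) with hu
  set v : X → A → ℝ := fun x a => if q (x, a) = 0 then 0 else β * q₂ (x, a) / q (x, a) with hv
  set P : X → A → X → ℝ := fun x a x' => u x a * P₁ x a x' + v x a * P₂ x a x' with hPdef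
  have hP : P ∈ 𝒬 := by
    refine hrow P₁ hP₁ P₂ hP₂ u v (fun x a => ?_) (fun x a => ?_) (fun x a => ?_)
    · simp only [hu]
      split_ifs
      · exact zero_le_one
      · exact div_nonneg (n₁ _) (hq0 _)
    · simp only [hv]
      split_ifs
      · exact le_rfl
      · exact div_nonneg (n₂ _) (hq0 _)
    · simp only [hu, hv]
      split_ifs with h
      · simp
      · rw [← add_div, ← hqa, div_self h]
  have hqP : ∀ x a x', q (x, a) * P x a x'
      = α * (q₁ (x, a) * P₁ x a x') + β * (q₂ (x, a) * P₂ x a x') := by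
    intro x a x'
    simp only [hPdef, hu, hv]
    split_ifs with h
    · have h' := hqa (x, a)
      have e₁ : α * q₁ (x, a) = 0 := by linarith [n₁ (x, a), n₂ (x, a)]
      have e₂ : β * q₂ (x, a) = 0 := by linarith [n₁ (x, a), n₂ (x, a)]
      rw [h, ← mul_assoc, ← mul_assoc, e₁, e₂]
      simp
    · field_simp
  have hin : ∀ x, S.inflow P q x = α * S.inflow P₁ q₁ x + β * S.inflow P₂ q₂ x := by
    intro x
    unfold LoopFree.inflow
    split_ifs
    · simp [hαβ]
    · simp_rw [hqP, Finset.sum_add_distrib, ← Finset.mul_sum]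
  refine ⟨P, hP, inducedPolicy q, isPolicy_inducedPolicy hq0,
    LoopFree.IsFlow.eq_occ S (h𝒬 _ hP) (isPolicy_inducedPolicy hq0) ⟨fun x a hx => ?_,
      fun x a hx => ?_⟩⟩
  · rw [hqa, hq₁, hq₂, S.occ_final hx, S.occ_final hx]
    simp
  · rw [hin, hq₁, hq₂, S.inflow_occ hT₁ hπ₁, S.inflow_occ hT₂ hπ₂, ← S.sum_occ hT₁ hπ₁ hx,
      ← S.sum_occ hT₂ hπ₂ hx, Finset.mul_sum, Finset.mul_sum, ← Finset.sum_add_distrib,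
      ← sum_mul_inducedPolicy hq0 x a]
    simp_rw [hqa]
    rfl

theorem continuous_occ :
    Continuous fun z : (X → A → X → ℝ) × (X → A → ℝ) => S.occ z.1 z.2 := by
  unfold LoopFree.occ LoopFree.occ3
  refine (PiLp.continuous_toLp 2 _).comp (continuous_pi fun p => ?_)
  refine continuous_finsetSum _ fun x' _ => continuous_finsetSum _ fun τ _ => ?_
  unfold LoopFree.pathProb
  split_ifs
  · fun_prop
  · exact continuous_const

theorem isCompact_setOf_isPolicy : IsCompact {π : X → A → ℝ | IsPolicy π} := by
  refine (isCompact_Icc (a := (0 : X → A → ℝ)) (b := 1)).of_isClosed_subset ?_ ?_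
  · have : {π : X → A → ℝ | IsPolicy π}
        = ⋂ x, ((⋂ a, {π : X → A → ℝ | 0 ≤ π x a}) ∩ {π | ∑ a, π x a = 1}) := by
      ext π
      simp [IsPolicy]
    rw [this]
    refine isClosed_iInter fun x => IsClosed.inter (isClosed_iInter fun a => ?_) ?_
    · exact isClosed_le continuous_const (by fun_prop)
    · exact isClosed_eq (by fun_prop) continuous_const
  · intro π hπ
    refine ⟨fun x a => (hπ x).1 a, fun x a => ?_⟩
    rw [Pi.one_apply, Pi.one_apply, ← (hπ x).2]
    exact Finset.single_le_sum (f := fun a => π x a) (fun b _ => (hπ x).1 b) (Finset.mem_univ a)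

theorem LoopFree.isCompact_Delta {𝒬 : Set (X → A → X → ℝ)} (h𝒬 : IsCompact 𝒬) :
    IsCompact (S.Delta 𝒬) := by
  have : S.Delta 𝒬 = (fun z : (X → A → X → ℝ) × (X → A → ℝ) => S.occ z.1 z.2) ''
      (𝒬 ×ˢ {π | IsPolicy π}) := by
    ext q
    simp only [LoopFree.Delta, Set.mem_ofPred_eq, Set.mem_image, Set.mem_prod, Prod.exists]
    constructor
    · rintro ⟨P, hP, π, hπ, rfl⟩
      exact ⟨P, π, ⟨hP, hπ⟩, rfl⟩
    · rintro ⟨P, π, ⟨hP, hπ⟩, rfl⟩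
      exact ⟨P, hP, π, hπ, rfl⟩
  rw [this]
  exact (h𝒬.prod isCompact_setOf_isPolicy).image (continuous_occ S)

/-- The condition on the layers starts from an open condition; its contrapositive, `P x a x' ≤ 0`
off the next layer, is closed. -/
theorem LoopFree.isClosed_isTransition : IsClosed {P : X → A → X → ℝ | S.IsTransition P} := by
  have : {P : X → A → X → ℝ | S.IsTransition P}
      = (⋂ x, ⋂ a, ⋂ x', {P : X → A → X → ℝ | 0 ≤ P x a x'}) ∩
        ((⋂ x, ⋂ a, ⋂ x', {P : X → A → X → ℝ | S.layer x' ≠ S.layer x + 1 → P x a x' ≤ 0}) ∩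
        ⋂ x, ⋂ a, {P : X → A → X → ℝ | S.layer x < L → ∑ x', P x a x' = 1}) := by
    ext P
    simp only [LoopFree.IsTransition, Set.mem_ofPred_eq, Set.mem_inter_iff, Set.mem_iInter]
    refine and_congr Iff.rfl (and_congr ?_ Iff.rfl)
    refine forall_congr' fun x => forall_congr' fun a => forall_congr' fun x' => ?_
    rw [← not_imp_not, not_lt]
  rw [this]
  refine IsClosed.inter ?_ (IsClosed.inter ?_ ?_)
  · exact isClosed_iInter fun x => isClosed_iInter fun a => isClosed_iInter fun x' =>
      isClosed_le continuous_const (by fun_prop)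
  · refine isClosed_iInter fun x => isClosed_iInter fun a => isClosed_iInter fun x' => ?_
    by_cases h : S.layer x' ≠ S.layer x + 1
    · have e : {P : X → A → X → ℝ | S.layer x' ≠ S.layer x + 1 → P x a x' ≤ 0}
          = {P | P x a x' ≤ 0} := Set.ext fun P => ⟨fun hP => hP h, fun hP _ => hP⟩
      rw [e]
      exact isClosed_le (by fun_prop) continuous_const
    · simp [h]
  · refine isClosed_iInter fun x => isClosed_iInter fun a => ?_
    by_cases h : S.layer x < L
    · simp only [h, forall_const]
      exact isClosed_eq (by fun_prop) continuous_const
    · simp [h]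

theorem LoopFree.transition_le_one (hP : S.IsTransition P) (x : X) (a : A) (x' : X) :
    P x a x' ≤ 1 :=
  (Finset.single_le_sum (f := fun x' => P x a x') (fun y _ => hP.1 x a y)
    (Finset.mem_univ x')).trans (S.sum_step_le_one hP x a)

variable (T : ℕ) (δ : ℝ) (N : X → A → ℕ) (M : X → A → X → ℕ)

theorem LoopFree.isCompact_confSet : IsCompact (S.confSet T δ N M) := by
  refine (isCompact_Icc (a := (0 : X → A → X → ℝ)) (b := 1)).of_isClosed_subset ?_ ?_
  · have : S.confSet T δ N M = {P : X → A → X → ℝ | S.IsTransition P} ∩ ⋂ x, ⋂ a,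
        {P | ∑ x', |P x a x' - (M x a x' : ℝ) / max 1 (N x a : ℝ)| ≤ S.radius T δ N x a} := by
      ext P
      simp [LoopFree.confSet]
    rw [this]
    refine S.isClosed_isTransition.inter (isClosed_iInter fun x => isClosed_iInter fun a => ?_)
    exact isClosed_le (by fun_prop) continuous_const
  · intro P hP
    exact ⟨fun x a x' => hP.1.1 x a x', fun x a x' => S.transition_le_one hP.1 x a x'⟩

/-- The confidence set is a product, over the pairs, of intersections of simplices with ℓ¹-balls, so
it is stable under rowwise mixtures. -/
theorem LoopFree.convex_Delta_confSet [Nonempty A] : Convex ℝ (S.Delta (S.confSet T δ N M)) := by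
  refine S.convex_Delta (fun P hP => hP.1) ?_
  rintro P₁ ⟨h₁, hr₁⟩ P₂ ⟨h₂, hr₂⟩ u v hu hv huv
  refine ⟨⟨fun x a x' => ?_, fun x a x' hpos => ?_, fun x a hx => ?_⟩, fun x a => ?_⟩
  · exact add_nonneg (mul_nonneg (hu _ _) (h₁.1 _ _ _)) (mul_nonneg (hv _ _) (h₂.1 _ _ _))
  · by_contra hc
    simp [S.transition_eq_zero h₁ a hc, S.transition_eq_zero h₂ a hc] at hpos
  · rw [Finset.sum_add_distrib, ← Finset.mul_sum, ← Finset.mul_sum, h₁.2.2 x a hx, h₂.2.2 x a hx,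
      mul_one, mul_one, huv]
  · calc ∑ x', |u x a * P₁ x a x' + v x a * P₂ x a x' - (M x a x' : ℝ) / max 1 (N x a : ℝ)|
        ≤ ∑ x', (u x a * |P₁ x a x' - (M x a x' : ℝ) / max 1 (N x a : ℝ)|
          + v x a * |P₂ x a x' - (M x a x' : ℝ) / max 1 (N x a : ℝ)|) := by
          refine Finset.sum_le_sum fun x' _ => ?_
          set c := (M x a x' : ℝ) / max 1 (N x a : ℝ)
          have e : u x a * P₁ x a x' + v x a * P₂ x a x' - c
              = u x a * (P₁ x a x' - c) + v x a * (P₂ x a x' - c) := by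
            linear_combination c * (huv x a)
          rw [e]
          refine (abs_add_le _ _).trans_eq ?_
          rw [abs_mul, abs_mul, abs_of_nonneg (hu x a), abs_of_nonneg (hv x a)]
      _ = u x a * ∑ x', |P₁ x a x' - (M x a x' : ℝ) / max 1 (N x a : ℝ)|
          + v x a * ∑ x', |P₂ x a x' - (M x a x' : ℝ) / max 1 (N x a : ℝ)| := by
          rw [Finset.sum_add_distrib, Finset.mul_sum, Finset.mul_sum]
      _ ≤ u x a * S.radius T δ N x a + v x a * S.radius T δ N x a :=
          add_le_add (mul_le_mul_of_nonneg_left (hr₁ x a) (hu x a))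
            (mul_le_mul_of_nonneg_left (hr₂ x a) (hv x a))
      _ = S.radius T δ N x a := by rw [← add_mul, huv, one_mul]

theorem LoopFree.isClosed_Delta_confSet : IsClosed (S.Delta (S.confSet T δ N M)) :=
  (S.isCompact_Delta (S.isCompact_confSet T δ N M)).isClosed

end DeltaGeometry

/-! ### Sensitivity of occupancy vectors to the transition function -/

section OccDifference

variable {X A : Type*} [Fintype X] [DecidableEq X] [Fintype A] [DecidableEq A] {L : ℕ}
  (S : LoopFree X L) {P P' : X → A → X → ℝ} {π : X → A → ℝ}

/-- One hybrid step: the old discrepancy is transported by `P'`, which does not increase ℓ¹-norms,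
and the change of kernel is weighted with the state distribution under the true `P`. -/
theorem LoopFree.sum_abs_stateProb_sub_succ_le (hP : S.IsTransition P) (hP' : S.IsTransition P')
    (hπ : IsPolicy π) (k : ℕ) :
    ∑ x, |S.stateProb P' π (k + 1) x - S.stateProb P π (k + 1) x|
      ≤ ∑ x, |S.stateProb P' π k x - S.stateProb P π k x|
        + ∑ x, ∑ a, S.stateProb P π k x * (π x a * ∑ x', |P' x a x' - P x a x'|) := by
  calc ∑ x', |S.stateProb P' π (k + 1) x' - S.stateProb P π (k + 1) x'|
      ≤ ∑ x', ∑ x, ∑ a, (|S.stateProb P' π k x - S.stateProb P π k x| * (π x a * P' x a x')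
        + S.stateProb P π k x * (π x a * |P' x a x' - P x a x'|)) := by
        refine Finset.sum_le_sum fun x' _ => ?_
        rw [S.stateProb_succ, S.stateProb_succ, ← Finset.sum_sub_distrib]
        refine (Finset.abs_sum_le_sum_abs _ _).trans (Finset.sum_le_sum fun x _ => ?_)
        rw [← Finset.sum_sub_distrib]
        refine (Finset.abs_sum_le_sum_abs _ _).trans (Finset.sum_le_sum fun a _ => ?_)
        have e : S.stateProb P' π k x * (π x a * P' x a x')
            - S.stateProb P π k x * (π x a * P x a x')
            = (S.stateProb P' π k x - S.stateProb P π k x) * (π x a * P' x a x')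
            + S.stateProb P π k x * (π x a * (P' x a x' - P x a x')) := by ring
        rw [e]
        refine (abs_add_le _ _).trans_eq ?_
        rw [abs_mul, abs_mul, abs_mul, abs_mul, abs_of_nonneg ((hπ x).1 a),
          abs_of_nonneg (hP'.1 x a x'), abs_of_nonneg (S.stateProb_nonneg hP hπ k x)]
    _ = ∑ x, |S.stateProb P' π k x - S.stateProb P π k x| * ∑ a, (π x a * ∑ x', P' x a x')
        + ∑ x, ∑ a, S.stateProb P π k x * (π x a * ∑ x', |P' x a x' - P x a x'|) := by
        rw [Finset.sum_comm, ← Finset.sum_add_distrib]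
        refine Finset.sum_congr rfl fun x _ => ?_
        rw [Finset.sum_comm, Finset.mul_sum, ← Finset.sum_add_distrib]
        refine Finset.sum_congr rfl fun a _ => ?_
        rw [Finset.sum_add_distrib]
        simp only [Finset.mul_sum]
    _ ≤ _ := by
        gcongr with x
        have : ∑ a, π x a * ∑ x', P' x a x' ≤ ∑ a, π x a * 1 :=
          Finset.sum_le_sum fun a _ =>
            mul_le_mul_of_nonneg_left (S.sum_step_le_one hP' x a) ((hπ x).1 a)
        simp only [mul_one, (hπ x).2] at this
        exact mul_le_of_le_one_right (abs_nonneg _) this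

theorem LoopFree.sum_abs_stateProb_sub_le (hP : S.IsTransition P) (hP' : S.IsTransition P')
    (hπ : IsPolicy π) {k : ℕ} (hk : k ≤ L) :
    ∑ x, |S.stateProb P' π k x - S.stateProb P π k x|
      ≤ ∑ x, ∑ a, S.occ P π (x, a) * ∑ x', |P' x a x' - P x a x'| := by
  set ξ : X → A → ℝ := fun x a => ∑ x', |P' x a x' - P x a x'| with hξ
  have hξ0 : ∀ x a, 0 ≤ ξ x a := fun x a => Finset.sum_nonneg fun _ _ => abs_nonneg _
  have h1 : ∀ k, ∑ x, |S.stateProb P' π k x - S.stateProb P π k x|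
      ≤ ∑ j ∈ Finset.range k, ∑ x, ∑ a, S.stateProb P π j x * (π x a * ξ x a) := by
    intro k
    induction k with
    | zero => simp [S.stateProb_zero]
    | succ k ih =>
      rw [Finset.sum_range_succ]
      exact (S.sum_abs_stateProb_sub_succ_le hP hP' hπ k).trans (add_le_add_left ih _)
  have h0 : ∀ j x a, 0 ≤ S.stateProb P π j x * (π x a * ξ x a) := fun j x a =>
    mul_nonneg (S.stateProb_nonneg hP hπ j x) (mul_nonneg ((hπ x).1 a) (hξ0 x a))
  calc _ ≤ ∑ j ∈ Finset.range k, ∑ x, ∑ a, S.stateProb P π j x * (π x a * ξ x a) := h1 k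
    _ ≤ ∑ j ∈ Finset.range L, ∑ x, ∑ a, S.stateProb P π j x * (π x a * ξ x a) :=
        Finset.sum_le_sum_of_subset_of_nonneg (Finset.range_mono hk) fun j _ _ =>
          Finset.sum_nonneg fun x _ => Finset.sum_nonneg fun a _ => h0 j x a
    _ = _ := by
        rw [Finset.sum_comm]
        refine Finset.sum_congr rfl fun x _ => ?_
        rw [Finset.sum_comm]
        refine Finset.sum_congr rfl fun a _ => ?_
        rw [S.sum_range_stateProb_mul hP]
        split_ifs with hx
        · rw [S.occ_of_lt hP hπ hx, mul_assoc]
        · rw [S.occ_final (le_antisymm (S.layer_le x) (not_lt.1 hx)), zero_mul]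

/-- The occupancy vectors of one policy under two transition functions. -/
theorem LoopFree.sum_abs_occ_sub_le (hP : S.IsTransition P) (hP' : S.IsTransition P')
    (hπ : IsPolicy π) :
    ∑ x, ∑ a, |S.occ P' π (x, a) - S.occ P π (x, a)|
      ≤ L * ∑ x, ∑ a, S.occ P π (x, a) * ∑ x', |P' x a x' - P x a x'| := by
  have h : ∀ x, ∑ a, |S.occ P' π (x, a) - S.occ P π (x, a)|
      ≤ ∑ k ∈ Finset.range L, |S.stateProb P' π k x - S.stateProb P π k x| := by
    intro x
    rcases (S.layer_le x).lt_or_eq with hx | hx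
    · refine le_trans (le_of_eq ?_) (Finset.single_le_sum
        (f := fun k => |S.stateProb P' π k x - S.stateProb P π k x|)
        (fun k _ => abs_nonneg _) (Finset.mem_range.2 hx))
      simp_rw [S.occ_of_lt hP hπ hx, S.occ_of_lt hP' hπ hx, ← sub_mul, abs_mul]
      rw [← Finset.mul_sum, Finset.sum_congr rfl fun a _ => abs_of_nonneg ((hπ x).1 a), (hπ x).2,
        mul_one]
    · simp only [S.occ_final hx, sub_self, abs_zero, Finset.sum_const_zero]
      exact Finset.sum_nonneg fun _ _ => abs_nonneg _
  calc _ ≤ ∑ x, ∑ k ∈ Finset.range L, |S.stateProb P' π k x - S.stateProb P π k x| :=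
        Finset.sum_le_sum fun x _ => h x
    _ = ∑ k ∈ Finset.range L, ∑ x, |S.stateProb P' π k x - S.stateProb P π k x| :=
        Finset.sum_comm
    _ ≤ ∑ _k ∈ Finset.range L, ∑ x, ∑ a, S.occ P π (x, a) * ∑ x', |P' x a x' - P x a x'| :=
        Finset.sum_le_sum fun k hk =>
          S.sum_abs_stateProb_sub_le hP hP' hπ (Finset.mem_range.1 hk).le
    _ = _ := by rw [Finset.sum_const, Finset.card_range, nsmul_eq_mul]

end OccDifference

end CMDP

namespace CMDP

/-! ### The linear program and the feasibility parameter -/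

section LinearProgram

variable {X A : Type*} [Fintype X] [Fintype A]

theorem dot_sub (r : X → A → ℝ) (q q' : Vec X A) : dot r (q - q') = dot r q - dot r q' := by
  simp [dot, mul_sub, Finset.sum_sub_distrib]

theorem dot_eq_inner (r : X → A → ℝ) (q : Vec X A) :
    dot r q = inner ℝ (WithLp.toLp 2 fun p : X × A => r p.1 p.2 : Vec X A) q := by
  rw [PiLp.inner_apply, Fintype.sum_prod_type]
  simp [dot, mul_comm]

theorem continuous_dot (r : X → A → ℝ) : Continuous (dot r) := by
  unfold dot
  fun_prop

theorem abs_dot_le {r : X → A → ℝ} {B : ℝ} (hr : ∀ x a, |r x a| ≤ B) (q : Vec X A) :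
    |dot r q| ≤ B * ∑ x, ∑ a, |q (x, a)| := by
  unfold dot
  rw [Finset.mul_sum]
  refine (Finset.abs_sum_le_sum_abs _ _).trans (Finset.sum_le_sum fun x _ => ?_)
  rw [Finset.mul_sum]
  refine (Finset.abs_sum_le_sum_abs _ _).trans (Finset.sum_le_sum fun a _ => ?_)
  rw [abs_mul]
  exact mul_le_mul_of_nonneg_right (hr x a) (abs_nonneg _)

theorem dot_loss {m : ℕ} (r : X → A → ℝ) (G : X → A → Fin m → ℝ)
    (lam : EuclideanSpace ℝ (Fin m)) (q : Vec X A) :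
    dot (loss r G lam) q = ∑ i, lam i * viol G q i - dot r q := by
  unfold viol dot loss
  simp only [sub_mul, Finset.sum_sub_distrib, Finset.sum_mul, Finset.mul_sum]
  congr 1
  symm
  rw [Finset.sum_comm]
  refine Finset.sum_congr rfl fun x _ => ?_
  rw [Finset.sum_comm]
  refine Finset.sum_congr rfl fun a _ => Finset.sum_congr rfl fun i _ => ?_
  ring

variable [DecidableEq X] [DecidableEq A] {L m : ℕ} (S : LoopFree X L)
  {P : X → A → X → ℝ} {𝒬 : Set (X → A → X → ℝ)}

theorem LoopFree.nonneg_of_mem_Delta (h𝒬 : ∀ P ∈ 𝒬, S.IsTransition P) {q : Vec X A}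
    (hq : q ∈ S.Delta 𝒬) (p : X × A) : 0 ≤ q p := by
  obtain ⟨P, hP, π, hπ, rfl⟩ := hq
  exact S.occ_nonneg (h𝒬 P hP) hπ p

theorem LoopFree.le_one_of_mem_Delta (h𝒬 : ∀ P ∈ 𝒬, S.IsTransition P) {q : Vec X A}
    (hq : q ∈ S.Delta 𝒬) (p : X × A) : q p ≤ 1 := by
  obtain ⟨P, hP, π, hπ, rfl⟩ := hq
  exact S.occ_le_one (h𝒬 P hP) hπ p

theorem LoopFree.sum_of_mem_Delta (h𝒬 : ∀ P ∈ 𝒬, S.IsTransition P) {q : Vec X A}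
    (hq : q ∈ S.Delta 𝒬) : ∑ x, ∑ a, q (x, a) = L := by
  obtain ⟨P, hP, π, hπ, rfl⟩ := hq
  exact S.sum_sum_occ (h𝒬 P hP) hπ

theorem LoopFree.sum_abs_of_mem_Delta (h𝒬 : ∀ P ∈ 𝒬, S.IsTransition P) {q : Vec X A}
    (hq : q ∈ S.Delta 𝒬) : ∑ x, ∑ a, |q (x, a)| = L := by
  rw [← S.sum_of_mem_Delta h𝒬 hq]
  exact Finset.sum_congr rfl fun x _ => Finset.sum_congr rfl fun a _ =>
    abs_of_nonneg (S.nonneg_of_mem_Delta h𝒬 hq _)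

theorem LoopFree.isTransition_of_mem_singleton (hP : S.IsTransition P) :
    ∀ P' ∈ ({P} : Set (X → A → X → ℝ)), S.IsTransition P' := by
  rintro P' rfl
  exact hP

/-- For numbers u, v in [0, 1] one has (u - v)² ≤ u + v. The squared diameter is therefore of order
L rather than |X||A|. -/
theorem LoopFree.norm_sub_sq_le {q q' : Vec X A} (hq0 : ∀ p, 0 ≤ q p)
    (hq1 : ∀ p, q p ≤ 1) (hq : ∑ x, ∑ a, q (x, a) = L) (hq0' : ∀ p, 0 ≤ q' p)
    (hq1' : ∀ p, q' p ≤ 1) (hq' : ∑ x, ∑ a, q' (x, a) = L) :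
    ‖q - q'‖ ^ 2 ≤ 2 * L := by
  rw [EuclideanSpace.norm_sq_eq, Fintype.sum_prod_type]
  calc ∑ x, ∑ a, ‖(q - q') (x, a)‖ ^ 2 ≤ ∑ x, ∑ a, (q (x, a) + q' (x, a)) := by
        refine Finset.sum_le_sum fun x _ => Finset.sum_le_sum fun a _ => ?_
        simp only [PiLp.sub_apply, Real.norm_eq_abs, sq_abs]
        have := hq0 (x, a)
        have := hq1 (x, a)
        have := hq0' (x, a)
        have := hq1' (x, a)
        nlinarith
    _ = 2 * L := by
        simp_rw [Finset.sum_add_distrib]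
        rw [hq, hq']
        ring

theorem LoopFree.isCompact_Delta_singleton : IsCompact (S.Delta {P}) :=
  S.isCompact_Delta isCompact_singleton

theorem LoopFree.Delta_nonempty [Nonempty A] (P : X → A → X → ℝ) : (S.Delta {P}).Nonempty := by
  refine ⟨S.occ P (inducedPolicy 0), P, rfl, _, isPolicy_inducedPolicy (fun p => ?_), rfl⟩
  simp

/-- The supremum defining ρ is attained, by compactness. The maximizer is the strictly feasible
comparator q₀ of the drift argument, and it also makes the linear program feasible. -/
theorem LoopFree.exists_le_neg_viol [Nonempty A] (hm : 0 < m) (G : X → A → Fin m → ℝ) :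
    ∃ q ∈ S.Delta {P}, ∀ i, S.rho P G ≤ -viol G q i := by
  have : Nonempty (Fin m) := ⟨⟨0, hm⟩⟩
  have hc : Continuous fun q : Vec X A => ⨅ i : Fin m, -viol G q i := by
    have e : (fun q : Vec X A => ⨅ i : Fin m, -viol G q i)
        = fun q => Finset.univ.inf' Finset.univ_nonempty fun i => -viol G q i := by
      funext q
      rw [Finset.inf'_univ_eq_ciInf]
    rw [e]
    exact Continuous.finset_inf'_apply _ fun i _ => (continuous_dot _).neg
  obtain ⟨q, hq, hmax⟩ := S.isCompact_Delta_singleton.exists_isMaxOn (S.Delta_nonempty P)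
    hc.continuousOn
  refine ⟨q, hq, fun i => ?_⟩
  have h1 : S.rho P G ≤ ⨅ i : Fin m, -viol G q i := by
    refine csSup_le ((S.Delta_nonempty P).image _) ?_
    rintro _ ⟨q', hq', rfl⟩
    exact hmax hq'
  exact h1.trans (ciInf_le (Set.finite_range _).bddBelow i)

theorem LoopFree.rho_le [Nonempty A] (hm : 0 < m) (hP : S.IsTransition P) {G : X → A → Fin m → ℝ}
    (hG : ∀ x a i, |G x a i| ≤ 1) : S.rho P G ≤ L := by
  obtain ⟨q, hq, h⟩ := S.exists_le_neg_viol (P := P) hm G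
  have h1 := abs_dot_le (fun x a => hG x a ⟨0, hm⟩) q
  rw [S.sum_abs_of_mem_Delta (S.isTransition_of_mem_singleton hP) hq, one_mul] at h1
  exact (h ⟨0, hm⟩).trans ((neg_le_abs _).trans h1)

theorem LoopFree.exists_isOptimal [Nonempty A] (hm : 0 < m) {G : X → A → Fin m → ℝ}
    (hρ : 0 ≤ S.rho P G) (r : X → A → ℝ) : ∃ q, S.IsOptimal P r G q := by
  have hcl : IsCompact (S.feasible P G) := by
    have e : S.feasible P G = S.Delta {P} ∩ ⋂ i, {q | viol G q i ≤ 0} := by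
      ext q
      simp [LoopFree.feasible]
    rw [e]
    exact S.isCompact_Delta_singleton.inter_right
      (isClosed_iInter fun i => isClosed_le (continuous_dot _) continuous_const)
  obtain ⟨q, hq, h⟩ := S.exists_le_neg_viol (P := P) hm G
  obtain ⟨q', hq', hmax⟩ := hcl.exists_isMaxOn
    ⟨q, hq, fun i => by linarith [h i]⟩ (continuous_dot r).continuousOn
  exact ⟨q', hq', fun w hw => hmax hw⟩

theorem LoopFree.IsOptimal.OPT_eq {r : X → A → ℝ} {G : X → A → Fin m → ℝ} {q : Vec X A}
    (h : S.IsOptimal P r G q) : S.OPT P r G = dot r q := by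
  refine IsGreatest.csSup_eq ⟨⟨q, h.1, rfl⟩, ?_⟩
  rintro _ ⟨q', hq', rfl⟩
  exact h.2 q' hq'

end LinearProgram

/-! ### Parameters -/

section Parameters

variable {X A : Type*} [Fintype X] [DecidableEq X] [Fintype A] [DecidableEq A] [Nonempty A]
  {L m : ℕ} (S : LoopFree X L) {P : X → A → X → ℝ} {T : ℕ} {G : X → A → Fin m → ℝ}

theorem LoopFree.rho_pos (hm : 0 < m) (hT : 0 < T)
    (hρ : (T : ℝ) ^ (-(1 : ℝ) / 8) * L * Real.sqrt (20 * m) ≤ S.rho P G) : 0 < S.rho P G := by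
  have hL := S.horizon_pos
  refine lt_of_lt_of_le ?_ hρ
  positivity

theorem LoopFree.le_zeta (hρ0 : 0 < S.rho P G) (hρL : S.rho P G ≤ L) :
    20 * (m : ℝ) ≤ S.zeta P G := by
  unfold LoopFree.zeta
  rw [le_div_iff₀ (by positivity)]
  have : S.rho P G ^ 2 ≤ (L : ℝ) ^ 2 := by gcongr
  nlinarith [(by positivity : (0 : ℝ) ≤ m)]

/-- This is the lower bound on ρ, squared. It places ζ below the ceiling of the dual box. -/
theorem LoopFree.zeta_le (hm : 0 < m) (hT : 0 < T)
    (hρ : (T : ℝ) ^ (-(1 : ℝ) / 8) * L * Real.sqrt (20 * m) ≤ S.rho P G) :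
    S.zeta P G ≤ (T : ℝ) ^ ((1 : ℝ) / 4) := by
  have hρ0 := S.rho_pos hm hT hρ
  unfold LoopFree.zeta
  rw [div_le_iff₀ (by positivity)]
  have hT' : (0 : ℝ) < T := by positivity
  have h1 : ((T : ℝ) ^ (-(1 : ℝ) / 8) * L * Real.sqrt (20 * m)) ^ 2 ≤ S.rho P G ^ 2 := by
    gcongr
  have h2 : ((T : ℝ) ^ (-(1 : ℝ) / 8) * L * Real.sqrt (20 * m)) ^ 2
      = (T : ℝ) ^ (-(1 : ℝ) / 4) * (20 * m * L ^ 2) := by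
    rw [mul_pow, mul_pow, Real.sq_sqrt (by positivity), ← Real.rpow_natCast,
      ← Real.rpow_mul hT'.le]
    norm_num
    ring
  have h3 : (T : ℝ) ^ ((1 : ℝ) / 4) * (T : ℝ) ^ (-(1 : ℝ) / 4) = 1 := by
    rw [← Real.rpow_add hT']
    norm_num
  calc 20 * m * (L : ℝ) ^ 2
      = (T : ℝ) ^ ((1 : ℝ) / 4) * ((T : ℝ) ^ (-(1 : ℝ) / 4) * (20 * m * L ^ 2)) := by
        rw [← mul_assoc, h3, one_mul]
    _ ≤ _ := by
        rw [← h2]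
        gcongr

/-- From 20 ≤ 20m ≤ ζ ≤ T^{1/4} ≤ T. All later numerical estimates on logarithms rely on this. -/
theorem LoopFree.twenty_le (hm : 0 < m) (hT : 0 < T)
    (hρ : (T : ℝ) ^ (-(1 : ℝ) / 8) * L * Real.sqrt (20 * m) ≤ S.rho P G)
    (hρL : S.rho P G ≤ L) : (20 : ℝ) ≤ T := by
  have h1 := (S.le_zeta (S.rho_pos hm hT hρ) hρL).trans (S.zeta_le hm hT hρ)
  have h2 : (T : ℝ) ^ ((1 : ℝ) / 4) ≤ (T : ℝ) ^ (1 : ℝ) :=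
    Real.rpow_le_rpow_of_exponent_le (by exact_mod_cast hT) (by norm_num)
  rw [Real.rpow_one] at h2
  have : (1 : ℝ) ≤ m := by exact_mod_cast hm
  linarith

theorem one_le_log_of_le {y : ℝ} (hy : 4 ≤ y) : 1 ≤ Real.log y := by
  rw [Real.le_log_iff_exp_le (by linarith)]
  linarith [Real.exp_one_lt_d9]

theorem le_div_of_mem_Ioo {δ c y : ℝ} (hδ : δ ∈ Set.Ioo (0 : ℝ) 1) (hc : 0 ≤ c) (h : c ≤ y) :
    c ≤ y / δ := by
  rw [le_div_iff₀ hδ.1]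
  nlinarith [hδ.1, hδ.2]

theorem one_le_log_sq_div {δ : ℝ} (hT : (20 : ℝ) ≤ T) (hδ : δ ∈ Set.Ioo (0 : ℝ) 1) :
    1 ≤ Real.log ((T : ℝ) ^ 2 / δ) :=
  one_le_log_of_le (le_div_of_mem_Ioo hδ (by norm_num) (by nlinarith))

theorem one_le_log_mul_card_div [Nonempty X] {δ : ℝ} (hT : (20 : ℝ) ≤ T)
    (hδ : δ ∈ Set.Ioo (0 : ℝ) 1) :
    1 ≤ Real.log (T * Fintype.card X * Fintype.card A / δ) := by
  have hX : (1 : ℝ) ≤ Fintype.card X := by exact_mod_cast Fintype.card_pos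
  have hA : (1 : ℝ) ≤ Fintype.card A := by exact_mod_cast Fintype.card_pos
  refine one_le_log_of_le (le_div_of_mem_Ioo hδ (by norm_num) ?_)
  calc (4 : ℝ) ≤ T * 1 * 1 := by linarith
    _ ≤ _ := by gcongr

end Parameters

/-! ### Layers -/

section Layers

variable {X A : Type*} [Fintype X] [DecidableEq X] [Fintype A] [DecidableEq A] [Nonempty A]
  {L m : ℕ} (S : LoopFree X L) {P : X → A → X → ℝ}

theorem LoopFree.mem_layerSet {k : ℕ} {x : X} : x ∈ S.layerSet k ↔ S.layer x = k := by
  simp [LoopFree.layerSet]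

theorem LoopFree.layerSet_nonempty (hP : S.IsTransition P) {k : ℕ} (hk : k ≤ L) :
    (S.layerSet k).Nonempty := by
  obtain ⟨_, _, _, _, hπ, _⟩ := S.Delta_nonempty P
  have h := S.sum_stateProb hP hπ hk
  by_contra hc
  rw [Finset.sum_eq_zero] at h
  · exact zero_ne_one h
  · intro x _
    refine S.stateProb_eq_zero hP fun hx => hc ⟨x, S.mem_layerSet.2 hx⟩

theorem LoopFree.sum_card_layerSet_le (K : Finset ℕ) :
    ∑ k ∈ K, (S.layerSet k).card ≤ Fintype.card X := by
  rw [← Finset.card_biUnion]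
  · exact Finset.card_le_univ _
  · intro i _ j _ hij
    rw [Function.onFun, Finset.disjoint_left]
    intro x hi hj
    exact hij ((S.mem_layerSet.1 hi).symm.trans (S.mem_layerSet.1 hj))

theorem LoopFree.horizon_lt_card (hP : S.IsTransition P) : L < Fintype.card X := by
  have h := S.sum_card_layerSet_le (Finset.range (L + 1))
  have h2 : ∑ _k ∈ Finset.range (L + 1), 1 ≤ ∑ k ∈ Finset.range (L + 1), (S.layerSet k).card :=
    Finset.sum_le_sum fun k hk => Finset.card_pos.2
      (S.layerSet_nonempty hP (by have := Finset.mem_range.1 hk; omega))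
  simp only [Finset.sum_const, Finset.card_range, smul_eq_mul, mul_one] at h2
  omega

/-- The transition function that moves to a uniform state of the next layer. -/
noncomputable def LoopFree.uniformTransition (x : X) (_ : A) (x' : X) : ℝ :=
  if S.layer x' = S.layer x + 1 then 1 / ((S.layerSet (S.layer x + 1)).card : ℝ) else 0

theorem LoopFree.sum_uniformTransition (hP : S.IsTransition P) {x : X} (hx : S.layer x < L)
    (a : A) : ∑ x', S.uniformTransition x a x' = 1 := by
  have hne := Finset.card_pos.2 (S.layerSet_nonempty hP (k := S.layer x + 1) (by omega))
  unfold LoopFree.uniformTransition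
  rw [← Finset.sum_filter, Finset.sum_const, nsmul_eq_mul]
  change ((S.layerSet (S.layer x + 1)).card : ℝ) * _ = 1
  field_simp

theorem LoopFree.isTransition_uniformTransition (hP : S.IsTransition P) :
    S.IsTransition (S.uniformTransition (A := A)) := by
  refine ⟨fun x a x' => ?_, fun x a x' h => ?_, fun x a hx => S.sum_uniformTransition hP hx a⟩
  · unfold LoopFree.uniformTransition
    split_ifs <;> positivity
  · by_contra hc
    simp [LoopFree.uniformTransition, hc] at h

theorem LoopFree.initState_q (hP : S.IsTransition P) {x : X} (hx : S.layer x < L) (a : A) :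
    (S.initState (A := A) (m := m)).q (x, a)
      = 1 / ((S.layerSet (S.layer x)).card * Fintype.card A) := by
  have hne := Finset.card_pos.2 (S.layerSet_nonempty hP (k := S.layer x + 1) (by omega))
  have hne' := Finset.card_pos.2 (S.layerSet_nonempty hP (k := S.layer x) (by omega))
  simp only [LoopFree.initState, Finset.sum_const, nsmul_eq_mul]
  field_simp

theorem LoopFree.initState_q_final {x : X} (hx : S.layer x = L) (a : A) :
    (S.initState (A := A) (m := m)).q (x, a) = 0 := by
  have : S.layerSet (S.layer x + 1) = ∅ := by
    refine Finset.eq_empty_of_forall_notMem fun y hy => ?_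
    have := S.mem_layerSet.1 hy
    have := S.layer_le y
    omega
  simp [LoopFree.initState, this]

/-- Under uniform transitions and the uniform policy, each layer carries unit mass spread evenly,
which is what the flow equations express here. -/
theorem LoopFree.initState_q_eq_occ (hP : S.IsTransition P) :
    (S.initState (A := A) (m := m)).q
      = S.occ S.uniformTransition (inducedPolicy (0 : Vec X A)) := by
  have hπ : IsPolicy (inducedPolicy (0 : Vec X A)) := isPolicy_inducedPolicy (fun p => by simp)
  refine LoopFree.IsFlow.eq_occ S (S.isTransition_uniformTransition hP) hπ
    ⟨fun x a hx => S.initState_q_final hx a, fun x a hx => ?_⟩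
  have hu : inducedPolicy (0 : Vec X A) x a = 1 / Fintype.card A := by simp [inducedPolicy]
  have hin : S.inflow S.uniformTransition (S.initState (A := A) (m := m)).q x
      = 1 / ((S.layerSet (S.layer x)).card : ℝ) := by
    unfold LoopFree.inflow
    split_ifs with h
    · have : S.layerSet (S.layer x) = {x} := by
        ext y
        rw [S.mem_layerSet, (S.layer_eq_zero_iff x).2 h, S.layer_eq_zero_iff, h,
          Finset.mem_singleton]
      simp [this]
    · obtain ⟨j, hj⟩ : ∃ j, S.layer x = j + 1 :=
        Nat.exists_eq_succ_of_ne_zero fun h0 => h ((S.layer_eq_zero_iff x).1 h0)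
      have hne := Finset.card_pos.2 (S.layerSet_nonempty hP (k := j) (by omega))
      have h1 : ∀ y, ∑ b : A, (S.initState (A := A) (m := m)).q (y, b) * S.uniformTransition y b x
          = if S.layer y = j then
              1 / ((S.layerSet j).card * (S.layerSet (j + 1)).card : ℝ) else 0 := by
        intro y
        split_ifs with hy
        · have : ∀ b : A, (S.initState (A := A) (m := m)).q (y, b) * S.uniformTransition y b x
              = 1 / ((S.layerSet j).card * Fintype.card A) *
                (1 / ((S.layerSet (j + 1)).card : ℝ)) := by
            intro b
            rw [S.initState_q hP (by omega), LoopFree.uniformTransition, if_pos (by omega), hy]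
          simp_rw [this]
          rw [Finset.sum_const, Finset.card_univ, nsmul_eq_mul]
          field_simp
        · refine Finset.sum_eq_zero fun b _ => ?_
          rw [LoopFree.uniformTransition, if_neg (by omega), mul_zero]
      simp_rw [h1]
      rw [← Finset.sum_filter, Finset.sum_const, nsmul_eq_mul, hj]
      change ((S.layerSet j).card : ℝ) * _ = _
      field_simp
  rw [hin, hu, S.initState_q hP hx]
  field_simp

/-- At an unvisited pair the empirical row is 0, so its distance to any probability row is 1,
whereas the radius is at least √2. Such pairs impose no restriction. -/
theorem LoopFree.sum_abs_le_radius_of_eq_zero {T : ℕ} {δ : ℝ} (hT : (20 : ℝ) ≤ T)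
    (hδ : δ ∈ Set.Ioo (0 : ℝ) 1) (hP : S.IsTransition P) {N : X → A → ℕ} {M : X → A → X → ℕ}
    {x : X} {a : A} (hN : N x a = 0) (hM : ∀ x', M x a x' = 0) :
    ∑ x', |P x a x' - (M x a x' : ℝ) / max 1 (N x a : ℝ)| ≤ S.radius T δ N x a := by
  have e : ∑ x', |P x a x' - (M x a x' : ℝ) / max 1 (N x a : ℝ)| = ∑ x', P x a x' := by
    refine Finset.sum_congr rfl fun x' _ => ?_
    rw [hM]
    simpa using hP.1 x a x'
  rw [e]
  rcases (S.layer_le x).lt_or_eq with hx | hx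
  · rw [hP.2.2 x a hx, LoopFree.radius, hN]
    apply Real.le_sqrt_of_sq_le
    have hc : (1 : ℝ) ≤ (S.layerSet (S.layer x + 1)).card := by
      exact_mod_cast Finset.card_pos.2 (S.layerSet_nonempty hP (k := S.layer x + 1) (by omega))
    have : Nonempty X := ⟨x⟩
    have hl := one_le_log_mul_card_div (X := X) (A := A) hT hδ
    simp only [Nat.cast_zero, max_eq_left zero_le_one, div_one]
    nlinarith
  · simp only [S.transition_final hP a _ hx, Finset.sum_const_zero]
    exact Real.sqrt_nonneg _

theorem LoopFree.initState_q_mem {T : ℕ} {δ : ℝ} (hT : (20 : ℝ) ≤ T)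
    (hδ : δ ∈ Set.Ioo (0 : ℝ) 1) (hP : S.IsTransition P) :
    (S.initState (A := A) (m := m)).q
      ∈ S.Delta (S.confSet T δ (fun _ _ => 0) (fun _ _ _ => 0)) := by
  have hu := S.isTransition_uniformTransition (A := A) hP
  have hconf : S.uniformTransition ∈ S.confSet (A := A) T δ (fun _ _ => 0) (fun _ _ _ => 0) :=
    ⟨hu, fun x a => S.sum_abs_le_radius_of_eq_zero (N := fun _ _ => 0) (M := fun _ _ _ => 0)
      hT hδ hu rfl fun _ => rfl⟩
  have hπ : IsPolicy (inducedPolicy (0 : Vec X A)) := isPolicy_inducedPolicy (fun p => by simp)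
  exact ⟨_, hconf, _, hπ, S.initState_q_eq_occ hP⟩

end Layers

end CMDP

namespace CMDP

/-! ### Pathwise analysis of the algorithm -/

section Run

variable {X A : Type*} [Fintype X] [DecidableEq X] [Fintype A] [DecidableEq A]
  {L m : ℕ} (S : LoopFree X L) {P : X → A → X → ℝ} {T : ℕ} {δ : ℝ} {f : ℕ → Feedback X A L m}

/-- Bounded feedback, trajectories that respect the layers, and confidence sets that contain the
true transition function. -/
structure LoopFree.Regular (P : X → A → X → ℝ) (T : ℕ) (δ : ℝ) (f : ℕ → Feedback X A L m) :
    Prop where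
  isTransition : S.IsTransition P
  r_mem : ∀ t < T, ∀ x a, (f t).r x a ∈ Set.Icc (0 : ℝ) 1
  G_mem : ∀ t < T, ∀ x a i, (f t).G x a i ∈ Set.Icc (-1 : ℝ) 1
  layer_eq : ∀ t < T, ∀ k, S.layer ((f t).τ.1 k) = k
  conf : ∀ t ≤ T, P ∈ S.confSet T δ (S.run T δ f t).N₀ (S.run T δ f t).M₀

/-- The `ℓ¹`-norm of the dual vector in episode `t`. -/
noncomputable def LoopFree.lamSum (T : ℕ) (δ : ℝ) (f : ℕ → Feedback X A L m) (t : ℕ) : ℝ :=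
  ∑ i, (S.run T δ f t).lam i

/-- The Lagrangian loss in episode `t`. -/
noncomputable def LoopFree.lossAt (T : ℕ) (δ : ℝ) (f : ℕ → Feedback X A L m) (t : ℕ) : X → A → ℝ :=
  loss (f t).r (f t).G (S.run T δ f t).lam

/-- The inverse of the primal learning rate in episode `t`. -/
noncomputable def LoopFree.invRate (T : ℕ) (δ : ℝ) (f : ℕ → Feedback X A L m) (t : ℕ) : ℝ :=
  (S.run T δ f (t + 1)).lbar * primalC X A L * Real.sqrt T

theorem LoopFree.run_succ_q (t : ℕ) : (S.run T δ f (t + 1)).q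
    = proj (S.Delta (S.confSet T δ (S.run T δ f (t + 1)).N₀ (S.run T δ f (t + 1)).M₀))
      ((S.run T δ f t).q - (1 / S.invRate T δ f t) •
        WithLp.toLp 2 fun p : X × A => S.lossAt T δ f t p.1 p.2) := rfl

theorem LoopFree.run_succ_lam (t : ℕ) : (S.run T δ f (t + 1)).lam
    = proj (dualBox m T) ((S.run T δ f t).lam + dualRate X A m T δ •
        WithLp.toLp 2 fun i => viol (f t).G (S.run T δ f t).q i) := rfl

theorem LoopFree.run_succ_lbar (t : ℕ) : (S.run T δ f (t + 1)).lbar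
    = max (S.run T δ f t).lbar ‖fun p : X × A => S.lossAt T δ f t p.1 p.2‖ := rfl

theorem LoopFree.run_lam_succ_apply (t : ℕ) (i : Fin m) : (S.run T δ f (t + 1)).lam i
    = max 0 (min ((S.run T δ f t).lam i
      + dualRate X A m T δ * viol (f t).G (S.run T δ f t).q i) ((T : ℝ) ^ ((1 : ℝ) / 4))) := by
  rw [S.run_succ_lam, proj_dualBox_apply]
  rfl

theorem LoopFree.run_lam_nonneg (t : ℕ) (i : Fin m) : 0 ≤ (S.run T δ f t).lam i := by
  cases t with
  | zero => exact le_rfl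
  | succ t =>
    rw [S.run_lam_succ_apply]
    exact le_max_left _ _

theorem LoopFree.lamSum_nonneg (t : ℕ) : 0 ≤ S.lamSum T δ f t :=
  Finset.sum_nonneg fun i _ => S.run_lam_nonneg t i

theorem LoopFree.run_lam_le_lamSum (t : ℕ) (i : Fin m) :
    (S.run T δ f t).lam i ≤ S.lamSum T δ f t :=
  Finset.single_le_sum (f := fun i => (S.run T δ f t).lam i) (fun i _ => S.run_lam_nonneg t i)
    (Finset.mem_univ i)

theorem LoopFree.lamSum_zero : S.lamSum T δ f 0 = 0 :=
  Finset.sum_eq_zero fun _ _ => rfl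

theorem LoopFree.lbar_nonneg (t : ℕ) : 0 ≤ (S.run T δ f t).lbar := by
  induction t with
  | zero => exact le_rfl
  | succ t ih => exact ih.trans (le_max_left _ _)

theorem LoopFree.lbar_le_succ (t : ℕ) : (S.run T δ f t).lbar ≤ (S.run T δ f (t + 1)).lbar :=
  le_max_left _ _

theorem LoopFree.abs_lossAt_le_lbar (t : ℕ) (x : X) (a : A) :
    |S.lossAt T δ f t x a| ≤ (S.run T δ f (t + 1)).lbar := by
  rw [S.run_succ_lbar]
  exact (norm_le_pi_norm (fun p : X × A => S.lossAt T δ f t p.1 p.2) (x, a)).trans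
    (le_max_right _ _)

include S in
theorem LoopFree.card_pos : 0 < Fintype.card X :=
  Fintype.card_pos_iff.2 ⟨S.init⟩

variable [Nonempty A]

include S in
theorem LoopFree.primalC_pos : 0 < primalC X A L := by
  have h1 : (0 : ℝ) < Fintype.card X := by exact_mod_cast S.card_pos
  have h2 : (0 : ℝ) < Fintype.card A := by exact_mod_cast Fintype.card_pos
  have h3 : (0 : ℝ) < L := by exact_mod_cast S.horizon_pos
  unfold primalC
  positivity

theorem sum_sq_toLp_le {ℓ : X → A → ℝ} {B : ℝ} (hℓ : ∀ x a, |ℓ x a| ≤ B) :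
    ‖(WithLp.toLp 2 fun p : X × A => ℓ p.1 p.2 : Vec X A)‖ ^ 2
      ≤ Fintype.card X * Fintype.card A * B ^ 2 := by
  rw [EuclideanSpace.norm_sq_eq]
  calc ∑ p : X × A, ‖ℓ p.1 p.2‖ ^ 2 ≤ ∑ _p : X × A, B ^ 2 := by
        refine Finset.sum_le_sum fun p _ => ?_
        rw [Real.norm_eq_abs]
        exact pow_le_pow_left₀ (abs_nonneg _) (hℓ p.1 p.2) 2
    _ = _ := by
        rw [Finset.sum_const, Finset.card_univ, Fintype.card_prod, nsmul_eq_mul]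
        push_cast
        ring

variable {S}

namespace LoopFree.Regular

variable (h : S.Regular P T δ f)
include h

/-- `proj` is a genuine projection only onto a nonempty set; here the true transition function
witnesses nonemptiness. -/
theorem run_q_mem (hT : (20 : ℝ) ≤ T) (hδ : δ ∈ Set.Ioo (0 : ℝ) 1) {t : ℕ} (ht : t ≤ T) :
    (S.run T δ f t).q ∈ S.Delta (S.confSet T δ (S.run T δ f t).N₀ (S.run T δ f t).M₀) := by
  cases t with
  | zero => exact S.initState_q_mem hT hδ h.isTransition
  | succ t =>
    rw [S.run_succ_q]
    have hπ : IsPolicy (inducedPolicy (0 : Vec X A)) := isPolicy_inducedPolicy (fun p => by simp)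
    have hne : (S.Delta (S.confSet T δ (S.run T δ f (t + 1)).N₀
        (S.run T δ f (t + 1)).M₀)).Nonempty := ⟨_, _, h.conf _ ht, _, hπ, rfl⟩
    exact (proj_spec hne (S.isClosed_Delta_confSet _ _ _ _)
      (S.convex_Delta_confSet _ _ _ _) _).1

theorem run_q_nonneg (hT : (20 : ℝ) ≤ T) (hδ : δ ∈ Set.Ioo (0 : ℝ) 1) {t : ℕ} (ht : t ≤ T)
    (p : X × A) : 0 ≤ (S.run T δ f t).q p :=
  S.nonneg_of_mem_Delta (fun _ hP => hP.1) (h.run_q_mem hT hδ ht) p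

theorem run_q_le_one (hT : (20 : ℝ) ≤ T) (hδ : δ ∈ Set.Ioo (0 : ℝ) 1) {t : ℕ} (ht : t ≤ T)
    (p : X × A) : (S.run T δ f t).q p ≤ 1 :=
  S.le_one_of_mem_Delta (fun _ hP => hP.1) (h.run_q_mem hT hδ ht) p

theorem sum_run_q (hT : (20 : ℝ) ≤ T) (hδ : δ ∈ Set.Ioo (0 : ℝ) 1) {t : ℕ} (ht : t ≤ T) :
    ∑ x, ∑ a, (S.run T δ f t).q (x, a) = L :=
  S.sum_of_mem_Delta (fun _ hP => hP.1) (h.run_q_mem hT hδ ht)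

theorem sum_abs_run_q (hT : (20 : ℝ) ≤ T) (hδ : δ ∈ Set.Ioo (0 : ℝ) 1) {t : ℕ} (ht : t ≤ T) :
    ∑ x, ∑ a, |(S.run T δ f t).q (x, a)| = L :=
  S.sum_abs_of_mem_Delta (fun _ hP => hP.1) (h.run_q_mem hT hδ ht)

theorem isPolicy_run (hT : (20 : ℝ) ≤ T) (hδ : δ ∈ Set.Ioo (0 : ℝ) 1) {t : ℕ} (ht : t ≤ T) :
    IsPolicy (inducedPolicy (S.run T δ f t).q) :=
  isPolicy_inducedPolicy (h.run_q_nonneg hT hδ ht)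

theorem played_mem (hT : (20 : ℝ) ≤ T) (hδ : δ ∈ Set.Ioo (0 : ℝ) 1) {t : ℕ} (ht : t ≤ T) :
    S.played P T δ f t ∈ S.Delta {P} :=
  ⟨P, rfl, _, h.isPolicy_run hT hδ ht, rfl⟩

theorem abs_G_le {t : ℕ} (ht : t < T) (x : X) (a : A) (i : Fin m) : |(f t).G x a i| ≤ 1 :=
  abs_le.2 (h.G_mem t ht x a i)

theorem abs_r_le {t : ℕ} (ht : t < T) (x : X) (a : A) : |(f t).r x a| ≤ 1 :=
  abs_le.2 ⟨by linarith [(h.r_mem t ht x a).1], (h.r_mem t ht x a).2⟩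

theorem abs_viol_run_le (hT : (20 : ℝ) ≤ T) (hδ : δ ∈ Set.Ioo (0 : ℝ) 1) {t : ℕ} (ht : t < T)
    (i : Fin m) : |viol (f t).G (S.run T δ f t).q i| ≤ L := by
  have := abs_dot_le (fun x a => h.abs_G_le ht x a i) (S.run T δ f t).q
  rwa [h.sum_abs_run_q hT hδ ht.le, one_mul] at this

theorem abs_lossAt_le {t : ℕ} (ht : t < T) (x : X) (a : A) :
    |S.lossAt T δ f t x a| ≤ 1 + S.lamSum T δ f t := by
  unfold LoopFree.lossAt loss LoopFree.lamSum
  rw [add_comm]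
  refine (abs_sub _ _).trans (add_le_add ?_ (h.abs_r_le ht x a))
  refine (Finset.abs_sum_le_sum_abs _ _).trans (Finset.sum_le_sum fun i _ => ?_)
  rw [abs_mul, abs_of_nonneg (S.run_lam_nonneg t i)]
  exact mul_le_of_le_one_left (S.run_lam_nonneg t i) (h.abs_G_le ht x a i)

theorem lbar_le {Z : ℝ} (hZ : 0 ≤ Z) {b : ℕ} (hb : b ≤ T)
    (hΛ : ∀ s < b, S.lamSum T δ f s ≤ Z) : (S.run T δ f b).lbar ≤ 1 + Z := by
  induction b with
  | zero =>
    change (0 : ℝ) ≤ _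
    linarith
  | succ b ih =>
    rw [S.run_succ_lbar]
    refine max_le (ih (by omega) fun s hs => hΛ s (by omega)) ?_
    rw [pi_norm_le_iff_of_nonneg (by linarith)]
    intro p
    rw [Real.norm_eq_abs]
    have h1 := h.abs_lossAt_le (t := b) (by omega) p.1 p.2
    have h2 := hΛ b (by omega)
    linarith

/-- Clipping to an interval that contains 0 does not increase absolute values, so the square of the
unclipped step may be expanded instead. -/
theorem sum_sq_lam_succ_le (hT : (20 : ℝ) ≤ T) (hδ : δ ∈ Set.Ioo (0 : ℝ) 1) {t : ℕ} (ht : t < T) :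
    ∑ i, (S.run T δ f (t + 1)).lam i ^ 2 ≤ ∑ i, (S.run T δ f t).lam i ^ 2
      + 2 * dualRate X A m T δ *
        ∑ i, (S.run T δ f t).lam i * viol (f t).G (S.run T δ f t).q i
      + dualRate X A m T δ ^ 2 * (m * L ^ 2) := by
  have e : (dualRate X A m T δ ^ 2 * (m * L ^ 2) : ℝ)
      = ∑ _i : Fin m, dualRate X A m T δ ^ 2 * (L : ℝ) ^ 2 := by
    rw [Finset.sum_const, Finset.card_univ, Fintype.card_fin, nsmul_eq_mul]
    ring
  rw [e, Finset.mul_sum, ← Finset.sum_add_distrib, ← Finset.sum_add_distrib]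
  refine Finset.sum_le_sum fun i _ => ?_
  rw [S.run_lam_succ_apply]
  have hv := h.abs_viol_run_le hT hδ ht i
  set l := (S.run T δ f t).lam i
  set v := viol (f t).G (S.run T δ f t).q i
  set η := dualRate X A m T δ
  have hB : (0 : ℝ) ≤ (T : ℝ) ^ ((1 : ℝ) / 4) := by positivity
  have h1 : max 0 (min (l + η * v) ((T : ℝ) ^ ((1 : ℝ) / 4))) ^ 2 ≤ (l + η * v) ^ 2 := by
    rw [sq_le_sq]
    rw [abs_of_nonneg (le_max_left _ _)]
    exact max_le (abs_nonneg _) ((min_le_left _ _).trans (le_abs_self _))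
  have h2 : v ^ 2 ≤ (L : ℝ) ^ 2 := by
    rw [sq_le_sq]
    exact hv.trans (le_abs_self _)
  nlinarith [mul_le_mul_of_nonneg_left h2 (sq_nonneg η)]

theorem sum_sq_lam_le (hT : (20 : ℝ) ≤ T) (hδ : δ ∈ Set.Ioo (0 : ℝ) 1) {a b : ℕ} (hab : a ≤ b)
    (hb : b ≤ T) :
    ∑ i, (S.run T δ f b).lam i ^ 2 ≤ ∑ i, (S.run T δ f a).lam i ^ 2
      + 2 * dualRate X A m T δ * ∑ t ∈ Finset.Ico a b,
        ∑ i, (S.run T δ f t).lam i * viol (f t).G (S.run T δ f t).q i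
      + dualRate X A m T δ ^ 2 * (m * L ^ 2) * (b - a) := by
  induction b, hab using Nat.le_induction with
  | base => simp
  | succ b hab ih =>
    have h1 := ih (by omega)
    have h2 := h.sum_sq_lam_succ_le hT hδ (t := b) (by omega)
    rw [Finset.sum_Ico_succ_top hab]
    push_cast
    linarith

/-- The standard estimate for one projected gradient step, multiplied by the inverse rate. The
comparator belongs to the random decision set because `P` belongs to the confidence set. -/
theorem two_mul_dot_lossAt_le {t : ℕ} (ht : t < T) {q : Vec X A} (hq : q ∈ S.Delta {P}) :
    2 * dot (S.lossAt T δ f t) ((S.run T δ f t).q - q)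
      ≤ S.invRate T δ f t *
          (‖(S.run T δ f t).q - q‖ ^ 2 - ‖(S.run T δ f (t + 1)).q - q‖ ^ 2)
        + (S.run T δ f (t + 1)).lbar * L / (5 * Real.sqrt T) := by
  have hqc : q ∈ S.Delta
      (S.confSet T δ (S.run T δ f (t + 1)).N₀ (S.run T δ f (t + 1)).M₀) := by
    obtain ⟨P', rfl, π, hπ, rfl⟩ := hq
    exact ⟨_, h.conf _ ht, π, hπ, rfl⟩
  have hstep := norm_proj_sub_le (S.isClosed_Delta_confSet T δ _ _)
    (S.convex_Delta_confSet T δ _ _) ((S.run T δ f t).q - (1 / S.invRate T δ f t) •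
        WithLp.toLp 2 fun p : X × A => S.lossAt T δ f t p.1 p.2) hqc
  rw [← S.run_succ_q] at hstep
  have hTpos : (0 : ℝ) < T := by exact_mod_cast (Nat.zero_le t).trans_lt ht
  have hsq : 0 < Real.sqrt T := Real.sqrt_pos.2 hTpos
  have hC := S.primalC_pos (A := A)
  have hL : (0 : ℝ) < L := by exact_mod_cast S.horizon_pos
  have hn := sum_sq_toLp_le (S.abs_lossAt_le_lbar (T := T) (δ := δ) (f := f) t)
  rw [dot_eq_inner]
  have hlb := S.lbar_nonneg (T := T) (δ := δ) (f := f) (t + 1)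
  have hloss := S.abs_lossAt_le_lbar (T := T) (δ := δ) (f := f) t
  unfold LoopFree.invRate at hstep ⊢
  set lb := (S.run T δ f (t + 1)).lbar
  set ℓ : Vec X A := WithLp.toLp 2 fun p : X × A => S.lossAt T δ f t p.1 p.2
  set q₁ := (S.run T δ f t).q
  set q₂ := (S.run T δ f (t + 1)).q
  -- If no nonzero loss has occurred, division by zero yields the rate 0, as the algorithm
  -- prescribes, and every term vanishes.
  rcases hlb.eq_or_lt with h0 | hpos
  · have hz : ℓ = 0 := by
      ext p
      have := hloss p.1 p.2
      rw [← h0] at this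
      exact abs_nonpos_iff.1 this
    rw [hz, ← h0]
    simp
  · set κ := lb * primalC X A L * Real.sqrt T with hκ
    have hκpos : 0 < κ := by positivity
    have e : q₁ - (1 / κ) • ℓ - q = (q₁ - q) - (1 / κ) • ℓ := by abel
    rw [e, norm_sub_sq_real (q₁ - q), inner_smul_right, norm_smul, mul_pow,
      Real.norm_eq_abs, sq_abs, real_inner_comm] at hstep
    have h1 : κ * ‖q₂ - q‖ ^ 2 ≤ κ * ‖q₁ - q‖ ^ 2 - 2 * inner ℝ ℓ (q₁ - q)
        + ‖ℓ‖ ^ 2 / κ := by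
      have := mul_le_mul_of_nonneg_left hstep hκpos.le
      refine this.trans_eq ?_
      field_simp
    -- Uses ‖ℓ‖² ≤ |X||A| ℓ̄² and the value of `primalC`, in which the factor |X||A| cancels.
    have h2 : ‖ℓ‖ ^ 2 / κ ≤ lb * L / (5 * Real.sqrt T) := by
      rw [div_le_div_iff₀ hκpos (by positivity), hκ]
      have e2 : lb * L * (lb * primalC X A L * Real.sqrt T)
          = (Fintype.card X * Fintype.card A * lb ^ 2) * (5 * Real.sqrt T) := by
        unfold primalC
        field_simp
      rw [e2]
      gcongr
    linarith

/-- Inverse rates are nondecreasing, so Abel summation against the squared diameter 2L leaves only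
the last inverse rate. Twice the sum is then at most (10 + 1)|X||A| ℓ̄ √T. The estimate holds on
every interval, since the drift argument starts at an arbitrary time. -/
theorem sum_dot_lossAt_le (hT : (20 : ℝ) ≤ T) (hδ : δ ∈ Set.Ioo (0 : ℝ) 1) {q : Vec X A}
    (hq : q ∈ S.Delta {P}) {a b : ℕ} (hab : a < b) (hb : b ≤ T) :
    ∑ t ∈ Finset.Ico a b, dot (S.lossAt T δ f t) ((S.run T δ f t).q - q)
      ≤ 6 * (Fintype.card X * Fintype.card A) * (S.run T δ f b).lbar * Real.sqrt T := by
  have hq0 := S.nonneg_of_mem_Delta (S.isTransition_of_mem_singleton h.isTransition) hq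
  have hq1 := S.le_one_of_mem_Delta (S.isTransition_of_mem_singleton h.isTransition) hq
  have hqL := S.sum_of_mem_Delta (S.isTransition_of_mem_singleton h.isTransition) hq
  have hd : ∀ t ≤ T, ‖(S.run T δ f t).q - q‖ ^ 2 ≤ 2 * L := fun t ht =>
    LoopFree.norm_sub_sq_le (h.run_q_nonneg hT hδ ht) (h.run_q_le_one hT hδ ht)
      (h.sum_run_q hT hδ ht) hq0 hq1 hqL
  have hTpos : (0 : ℝ) < T := by linarith
  have hsq : 0 < Real.sqrt T := Real.sqrt_pos.2 hTpos
  have hC := S.primalC_pos (A := A)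
  have hL : (0 : ℝ) < L := by exact_mod_cast S.horizon_pos
  -- The induction keeps the unspent distance term, weighted by the rate of episode `b - 1`, in
  -- order to absorb the next rate increase.
  have key : ∀ b, a + 1 ≤ b → b ≤ T →
      2 * ∑ t ∈ Finset.Ico a b, dot (S.lossAt T δ f t) ((S.run T δ f t).q - q)
        + S.invRate T δ f (b - 1) * ‖(S.run T δ f b).q - q‖ ^ 2
      ≤ S.invRate T δ f (b - 1) * (2 * L)
        + (b - a) * ((S.run T δ f b).lbar * L / (5 * Real.sqrt T)) := by
    intro b hab
    induction b, hab using Nat.le_induction with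
    | base =>
      intro hb
      rw [Finset.sum_Ico_succ_top le_rfl]
      simp only [Finset.Ico_self, Finset.sum_empty, zero_add, Nat.add_sub_cancel]
      have h1 := h.two_mul_dot_lossAt_le (t := a) (by omega) hq
      have h2 := mul_le_mul_of_nonneg_left (hd a (by omega))
        (by
          unfold LoopFree.invRate
          have := S.lbar_nonneg (T := T) (δ := δ) (f := f) (a + 1)
          positivity : 0 ≤ S.invRate T δ f a)
      push_cast
      linarith
    | succ b hab ih =>
      intro hb
      obtain ⟨c, rfl⟩ : ∃ c, b = c + 1 := ⟨b - 1, by omega⟩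
      have ih := ih (by omega)
      rw [Finset.sum_Ico_succ_top (by omega)]
      simp only [Nat.add_sub_cancel] at ih ⊢
      have h1 := h.two_mul_dot_lossAt_le (t := c + 1) (by omega) hq
      have hlb := S.lbar_le_succ (T := T) (δ := δ) (f := f) (c + 1)
      have hmono : S.invRate T δ f c ≤ S.invRate T δ f (c + 1) := by
        unfold LoopFree.invRate
        gcongr
      have h2 := mul_le_mul_of_nonneg_left (hd (c + 1) (by omega)) (sub_nonneg.2 hmono)
      have h3 : ((c + 1 : ℕ) - a : ℝ) * ((S.run T δ f (c + 1)).lbar * L / (5 * Real.sqrt T))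
          ≤ ((c + 1 : ℕ) - a : ℝ) * ((S.run T δ f (c + 1 + 1)).lbar * L / (5 * Real.sqrt T)) := by
        have : (0 : ℝ) ≤ ((c + 1 : ℕ) - a : ℝ) := by
          rw [sub_nonneg]
          exact_mod_cast (by omega : a ≤ c + 1)
        gcongr
      push_cast at ih h3 ⊢
      linarith
  have hk := key b hab hb
  obtain ⟨c, rfl⟩ : ∃ c, b = c + 1 := ⟨b - 1, by omega⟩
  have hlb := S.lbar_nonneg (T := T) (δ := δ) (f := f) (c + 1)
  simp only [Nat.add_sub_cancel, LoopFree.invRate] at hk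
  set lb := (S.run T δ f (c + 1)).lbar
  have hA : (1 : ℝ) ≤ Fintype.card A := by exact_mod_cast Fintype.card_pos
  have hX : (L : ℝ) ≤ Fintype.card X := by exact_mod_cast (S.horizon_lt_card h.isTransition).le
  have h1 : lb * primalC X A L * Real.sqrt T * (2 * L)
      = 10 * (Fintype.card X * Fintype.card A) * lb * Real.sqrt T := by
    unfold primalC
    field_simp
    ring
  have h2 : ((c + 1 : ℕ) - a : ℝ) * (lb * L / (5 * Real.sqrt T))
      ≤ (Fintype.card X * Fintype.card A) * lb * Real.sqrt T := by
    have hcT : ((c + 1 : ℕ) - a : ℝ) ≤ T := by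
      have : ((c + 1 : ℕ) : ℝ) ≤ T := by exact_mod_cast hb
      have : (0 : ℝ) ≤ a := by positivity
      linarith
    have hLXA : (L : ℝ) ≤ Fintype.card X * Fintype.card A := by nlinarith
    calc ((c + 1 : ℕ) - a : ℝ) * (lb * L / (5 * Real.sqrt T))
        ≤ T * (lb * L / (5 * Real.sqrt T)) := by gcongr
      _ = lb * L * Real.sqrt T / 5 := by
          nth_rewrite 1 [← Real.mul_self_sqrt hTpos.le]
          field_simp
      _ ≤ lb * (Fintype.card X * Fintype.card A) * Real.sqrt T / 5 := by gcongr
      _ ≤ _ := by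
          have : 0 ≤ lb * (Fintype.card X * Fintype.card A) * Real.sqrt T := by positivity
          linarith
  have h3 : 0 ≤ lb * primalC X A L * Real.sqrt T * ‖(S.run T δ f (c + 1)).q - q‖ ^ 2 := by
    positivity
  have h4 : 0 ≤ (Fintype.card X * Fintype.card A) * lb * Real.sqrt T := by positivity
  linarith

end LoopFree.Regular

end Run

end CMDP

namespace CMDP

/-! ### Boundedness of the dual variables -/

section DualBound

variable {X A : Type*} [Fintype X] [DecidableEq X] [Fintype A] [DecidableEq A] [Nonempty A]
  {L m : ℕ} {S : LoopFree X L} {P : X → A → X → ℝ} {T : ℕ} {δ : ℝ} {f : ℕ → Feedback X A L m}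

/-- The common scale `√(T ln (T²/δ))` of the bounds. -/
noncomputable def scale (T : ℕ) (δ : ℝ) : ℝ := Real.sqrt (T * Real.log (T ^ 2 / δ))

theorem sqrt_le_scale (hT : (20 : ℝ) ≤ T) (hδ : δ ∈ Set.Ioo (0 : ℝ) 1) :
    Real.sqrt T ≤ scale T δ := by
  apply Real.sqrt_le_sqrt
  have := one_le_log_sq_div hT hδ
  nlinarith

theorem one_le_scale (hT : (20 : ℝ) ≤ T) (hδ : δ ∈ Set.Ioo (0 : ℝ) 1) : 1 ≤ scale T δ := by
  refine le_trans ?_ (sqrt_le_scale hT hδ)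
  rw [Real.one_le_sqrt]
  linarith

theorem le_scale_sq (hT : (20 : ℝ) ≤ T) (hδ : δ ∈ Set.Ioo (0 : ℝ) 1) :
    (T : ℝ) ≤ scale T δ ^ 2 := by
  have h1 := one_le_log_sq_div hT hδ
  rw [scale, Real.sq_sqrt (by positivity)]
  nlinarith

theorem sqrt_two_mul_le_scale (T : ℕ) (δ : ℝ) :
    Real.sqrt (2 * T * Real.log (T ^ 2 / δ)) ≤ 3 / 2 * scale T δ := by
  rw [mul_assoc, Real.sqrt_mul (by norm_num : (0 : ℝ) ≤ 2)]
  refine mul_le_mul_of_nonneg_right ?_ (Real.sqrt_nonneg _)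
  rw [Real.sqrt_le_left (by norm_num)]
  norm_num

variable (S) in
include S in
theorem LoopFree.dualRate_mul (hm : 0 < m) (hT : (20 : ℝ) ≤ T) (hδ : δ ∈ Set.Ioo (0 : ℝ) 1) :
    dualRate X A m T δ * (100 * m * (Fintype.card X * Fintype.card A) * scale T δ) = 1 := by
  have h1 : (0 : ℝ) < Fintype.card X := by exact_mod_cast S.card_pos
  have h2 : (0 : ℝ) < Fintype.card A := by exact_mod_cast Fintype.card_pos
  have h3 : (0 : ℝ) < m := by exact_mod_cast hm
  have h4 : 0 < scale T δ := zero_lt_one.trans_le (one_le_scale hT hδ)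
  unfold dualRate
  rw [← scale]
  field_simp

variable (S) in
include S in
theorem LoopFree.dualRate_pos (hm : 0 < m) (hT : (20 : ℝ) ≤ T) (hδ : δ ∈ Set.Ioo (0 : ℝ) 1) :
    0 < dualRate X A m T δ := by
  have h1 : (0 : ℝ) < Fintype.card X := by exact_mod_cast S.card_pos
  have h2 : (0 : ℝ) < Fintype.card A := by exact_mod_cast Fintype.card_pos
  have h3 : (0 : ℝ) < m := by exact_mod_cast hm
  have h4 : 0 < scale T δ := zero_lt_one.trans_le (one_le_scale hT hδ)
  unfold dualRate
  rw [← scale]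
  positivity

theorem LoopFree.horizon_le_card_mul_card (hP : S.IsTransition P) :
    (L : ℝ) ≤ Fintype.card X * Fintype.card A := by
  have hA : (1 : ℝ) ≤ Fintype.card A := by exact_mod_cast Fintype.card_pos
  have hX : (L : ℝ) ≤ Fintype.card X := by exact_mod_cast (S.horizon_lt_card hP).le
  have : (0 : ℝ) ≤ L := by positivity
  nlinarith

/-- The dual vector, set to zero when its norm exceeds `Z`. -/
noncomputable def LoopFree.truncLam (S : LoopFree X L) (T : ℕ) (δ : ℝ)
    (f : ℕ → Feedback X A L m) (Z : ℝ) (t : ℕ) (i : Fin m) : ℝ :=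
  if S.lamSum T δ f t ≤ Z then (S.run T δ f t).lam i else 0

theorem LoopFree.truncLam_nonneg (Z : ℝ) (t : ℕ) (i : Fin m) : 0 ≤ S.truncLam T δ f Z t i := by
  unfold LoopFree.truncLam
  split_ifs
  · exact S.run_lam_nonneg t i
  · exact le_rfl

/-- The truncated multiplier is bounded on every outcome, so concentration inequalities apply to it
before the dual vector is known to be bounded. -/
theorem LoopFree.sum_truncLam_le {Z : ℝ} (hZ : 0 ≤ Z) (t : ℕ) :
    ∑ i, S.truncLam T δ f Z t i ≤ Z := by
  unfold LoopFree.truncLam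
  split_ifs with h
  · exact h
  · simpa using hZ

theorem viol_eq_sub_dot (G Gbar : X → A → Fin m → ℝ) (q : Vec X A) (i : Fin m) :
    viol G q i - viol Gbar q i = dot (fun x a => G x a i - Gbar x a i) q := by
  simp [viol, dot, sub_mul, Finset.sum_sub_distrib]

namespace LoopFree.Regular

variable (h : S.Regular P T δ f)
include h

/-- Write λᵀGᵀq̂ = ℓ·(q̂ - q₀) + λᵀGᵀq₀ + r·q̂ - r·q₀. The first term is primal regret, the reward
terms give at most L, and replacing G by its mean turns λᵀGᵀq₀ into at most -ρ‖λ‖₁ plus noise. -/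
theorem sum_lam_mul_viol_le (hT : (20 : ℝ) ≤ T) (hδ : δ ∈ Set.Ioo (0 : ℝ) 1)
    {Gbar : X → A → Fin m → ℝ} {q₀ : Vec X A} (hq₀ : q₀ ∈ S.Delta {P}) {ρ Z : ℝ} (hZ : 0 ≤ Z)
    (hq₀ρ : ∀ i, ρ ≤ -viol Gbar q₀ i)
    (hconc : ∀ n ≤ T, |∑ t ∈ Finset.range n, ∑ i, S.truncLam T δ f Z t i *
      (viol (f t).G q₀ i - viol Gbar q₀ i)| ≤ Z * L * Real.sqrt (2 * T * Real.log (T ^ 2 / δ)))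
    {a b : ℕ} (hab : a < b) (hb : b ≤ T) (hlt : ∀ t < b, S.lamSum T δ f t ≤ Z) :
    ∑ t ∈ Finset.Ico a b, ∑ i, (S.run T δ f t).lam i * viol (f t).G (S.run T δ f t).q i
      ≤ ∑ t ∈ Finset.Ico a b, (L - ρ * S.lamSum T δ f t)
        + 2 * (Z * L * Real.sqrt (2 * T * Real.log (T ^ 2 / δ)))
        + 6 * (Fintype.card X * Fintype.card A) * (1 + Z) * Real.sqrt T := by
  have hreg := h.sum_dot_lossAt_le hT hδ hq₀ hab hb
  have hlb := h.lbar_le hZ hb hlt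
  have hreg' : ∑ t ∈ Finset.Ico a b, dot (S.lossAt T δ f t) ((S.run T δ f t).q - q₀)
      ≤ 6 * (Fintype.card X * Fintype.card A) * (1 + Z) * Real.sqrt T :=
    hreg.trans (by gcongr)
  have hco : ∑ t ∈ Finset.Ico a b, ∑ i, S.truncLam T δ f Z t i *
      (viol (f t).G q₀ i - viol Gbar q₀ i)
      ≤ 2 * (Z * L * Real.sqrt (2 * T * Real.log (T ^ 2 / δ))) := by
    -- The interval sum is a difference of two prefix sums, each controlled by `hconc`; hence the
    -- factor 2.
    rw [Finset.sum_Ico_eq_sub _ hab.le]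
    have h1 := (abs_le.1 (hconc b hb)).2
    have h2 := (abs_le.1 (hconc a (hab.le.trans hb))).1
    linarith
  refine le_trans ?_ (add_le_add (add_le_add_right hco _) hreg')
  rw [← Finset.sum_add_distrib, ← Finset.sum_add_distrib]
  refine Finset.sum_le_sum fun t ht => ?_
  have htb : t < b := (Finset.mem_Ico.1 ht).2
  have htT : t < T := htb.trans_le hb
  rw [dot_sub, LoopFree.lossAt, dot_loss, dot_loss]
  have hr1 : dot (f t).r (S.run T δ f t).q ≤ L := by
    have := abs_dot_le (fun x a => h.abs_r_le htT x a) (S.run T δ f t).q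
    rw [h.sum_abs_run_q hT hδ htT.le, one_mul] at this
    exact (le_abs_self _).trans this
  have hr2 : 0 ≤ dot (f t).r q₀ :=
    Finset.sum_nonneg fun x _ => Finset.sum_nonneg fun a _ => mul_nonneg (h.r_mem t htT x a).1
      (S.nonneg_of_mem_Delta (S.isTransition_of_mem_singleton h.isTransition) hq₀ _)
  have htr : ∀ i, S.truncLam T δ f Z t i = (S.run T δ f t).lam i := fun i => if_pos (hlt t htb)
  have hneg : ρ * S.lamSum T δ f t + ∑ i, (S.run T δ f t).lam i * viol Gbar q₀ i ≤ 0 := by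
    unfold LoopFree.lamSum
    rw [Finset.mul_sum, ← Finset.sum_add_distrib]
    refine Finset.sum_nonpos fun i _ => ?_
    nlinarith [S.run_lam_nonneg (T := T) (δ := δ) (f := f) t i, hq₀ρ i]
  simp only [htr, mul_sub, Finset.sum_sub_distrib]
  linarith

/-- Above the level L/ρ the dual vector drifts back, because q₀ is then a profitable deviation for
the primal player. To climb from L/ρ to ζ it would have to gain more than the regret and the noise
allow at the rate η. -/
theorem lamSum_lt (hm : 0 < m) (hT : (20 : ℝ) ≤ T) (hδ : δ ∈ Set.Ioo (0 : ℝ) 1)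
    {Gbar : X → A → Fin m → ℝ} {q₀ : Vec X A} (hq₀ : q₀ ∈ S.Delta {P})
    (hρ0 : 0 < S.rho P Gbar) (hρL : S.rho P Gbar ≤ L)
    (hq₀ρ : ∀ i, S.rho P Gbar ≤ -viol Gbar q₀ i)
    (hconc : ∀ n ≤ T, |∑ t ∈ Finset.range n, ∑ i, S.truncLam T δ f (S.zeta P Gbar) t i *
      (viol (f t).G q₀ i - viol Gbar q₀ i)|
        ≤ S.zeta P Gbar * L * Real.sqrt (2 * T * Real.log (T ^ 2 / δ)))
    (b : ℕ) (hb : b ≤ T) : S.lamSum T δ f b < S.zeta P Gbar := by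
  have hm1 : (1 : ℝ) ≤ m := by exact_mod_cast hm
  have hζ := S.le_zeta hρ0 hρL
  have hζ20 : 20 ≤ S.zeta P Gbar := by linarith
  induction b using Nat.strong_induction_on with
  | _ b ih =>
    rcases Nat.eq_zero_or_pos b with rfl | hb0
    · rw [S.lamSum_zero]
      linarith
    by_contra hcon
    push Not at hcon
    set ρ := S.rho P Gbar with hρdef
    set ζ := S.zeta P Gbar with hζdef
    -- The last time before `b` at the low level; it exists because λ starts at 0.
    obtain ⟨a, hab, ha, hgt⟩ : ∃ a < b, S.lamSum T δ f a ≤ L / ρ ∧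
        ∀ t, a < t → t < b → L / ρ < S.lamSum T δ f t := by
      classical
      have h0 : S.lamSum T δ f 0 ≤ L / ρ := by
        rw [S.lamSum_zero]
        positivity
      have hle := Nat.findGreatest_le (P := fun s => S.lamSum T δ f s ≤ L / ρ) (b - 1)
      refine ⟨Nat.findGreatest (fun s => S.lamSum T δ f s ≤ L / ρ) (b - 1), by omega,
        Nat.findGreatest_spec (P := fun s => S.lamSum T δ f s ≤ L / ρ) (Nat.zero_le _) h0, ?_⟩
      intro t h1 h2
      exact not_le.1 (Nat.findGreatest_is_greatest h1 (by omega))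
    have hW := h.sum_lam_mul_viol_le hT hδ hq₀ (by linarith : 0 ≤ ζ) hq₀ρ hconc hab hb
      fun t ht => (ih t ht (by omega)).le
    -- Only the term at `a` can be positive, and it is at most L.
    have hdrift : ∑ t ∈ Finset.Ico a b, (L - ρ * S.lamSum T δ f t) ≤ L := by
      calc ∑ t ∈ Finset.Ico a b, (L - ρ * S.lamSum T δ f t)
          ≤ ∑ t ∈ Finset.Ico a b, if t = a then (L : ℝ) else 0 := by
            refine Finset.sum_le_sum fun t ht => ?_
            obtain ⟨h1, h2⟩ := Finset.mem_Ico.1 ht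
            split_ifs with hta
            · nlinarith [S.lamSum_nonneg (T := T) (δ := δ) (f := f) t]
            · have := hgt t (by omega) h2
              rw [div_lt_iff₀ hρ0] at this
              linarith
        _ = L := by
            rw [Finset.sum_ite_eq', if_pos (Finset.mem_Ico.2 ⟨le_rfl, hab⟩)]
    have hsq := h.sum_sq_lam_le hT hδ hab.le hb
    have hXA := LoopFree.horizon_le_card_mul_card (A := A) h.isTransition
    have hη := S.dualRate_mul (A := A) hm hT hδ
    have hη0 := S.dualRate_pos (A := A) hm hT hδ
    have hD1 := one_le_scale hT hδ
    have hDT := sqrt_le_scale hT hδ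
    have hDsq := le_scale_sq hT hδ
    have hD2 := sqrt_two_mul_le_scale T δ
    have hL1 : (1 : ℝ) ≤ L := by exact_mod_cast S.horizon_pos
    set η := dualRate X A m T δ
    set XA : ℝ := Fintype.card X * Fintype.card A
    set D := scale T δ
    set W := ∑ t ∈ Finset.Ico a b,
      ∑ i, (S.run T δ f t).lam i * viol (f t).G (S.run T δ f t).q i
    have hXA1 : 1 ≤ XA := hL1.trans hXA
    -- In units of |X||A|D: 1 from the drift, 2 · (3/2)ζ from the noise, and 6(1 + ζ) from the
    -- regret.
    have hWb : W ≤ XA * D * (7 + 9 * ζ) := by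
      have h1 : ζ * L * Real.sqrt (2 * T * Real.log (T ^ 2 / δ)) ≤ ζ * XA * (3 / 2 * D) := by
        gcongr
      have h2 : 6 * XA * (1 + ζ) * Real.sqrt T ≤ 6 * XA * (1 + ζ) * D := by gcongr
      have h3 : (L : ℝ) ≤ XA * D := by nlinarith
      linarith
    have hfirst : ∑ i, (S.run T δ f a).lam i ^ 2 ≤ (L / ρ) ^ 2 := by
      have h1 : ∑ i, (S.run T δ f a).lam i ^ 2 ≤ S.lamSum T δ f a ^ 2 :=
        Finset.sum_sq_le_sq_sum_of_nonneg fun i _ => S.run_lam_nonneg a i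
      exact h1.trans (pow_le_pow_left₀ (S.lamSum_nonneg a) ha 2)
    -- Cauchy-Schwarz passes from the ℓ¹-norm to the Euclidean norm, which is the one that the dual
    -- step controls.
    have hlast : ζ ^ 2 ≤ m * ∑ i, (S.run T δ f b).lam i ^ 2 := by
      have h1 : S.lamSum T δ f b ^ 2 ≤ m * ∑ i, (S.run T δ f b).lam i ^ 2 := by
        have := sq_sum_le_card_mul_sum_sq (s := (Finset.univ : Finset (Fin m)))
          (f := fun i => (S.run T δ f b).lam i)
        simpa [LoopFree.lamSum] using this
      exact (pow_le_pow_left₀ (by linarith) hcon 2).trans h1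
    -- This is the reason for the form of ζ: the starting level L/ρ contributes only a small
    -- multiple of ζ.
    have hζeq : m * (L / ρ) ^ 2 = ζ / 20 := by
      rw [hζdef, LoopFree.zeta, ← hρdef]
      field_simp
    have hmid : m * (2 * η * W) ≤ (7 + 9 * ζ) / 50 := by
      have h1 : m * (2 * η * W) ≤ m * (2 * η * (XA * D * (7 + 9 * ζ))) := by gcongr
      have h2 : m * (2 * η * (XA * D * (7 + 9 * ζ)))
          = (η * (100 * m * XA * D)) * ((7 + 9 * ζ) / 50) := by ring
      rw [h2, hη, one_mul] at h1
      exact h1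
    have hsmall : m * (η ^ 2 * (m * L ^ 2) * (b - a)) ≤ 1 := by
      have hba : ((b : ℝ) - a) ≤ D ^ 2 := by
        have : (b : ℝ) ≤ T := by exact_mod_cast hb
        have : (0 : ℝ) ≤ a := by positivity
        linarith
      have hba0 : (0 : ℝ) ≤ (b : ℝ) - a := sub_nonneg.2 (by exact_mod_cast hab.le)
      calc m * (η ^ 2 * (m * L ^ 2) * (b - a)) ≤ m * (η ^ 2 * (m * XA ^ 2) * D ^ 2) := by gcongr
        _ = (η * (100 * m * XA * D)) ^ 2 / 10000 := by ring
        _ ≤ 1 := by rw [hη]; norm_num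
    have hfin : m * ∑ i, (S.run T δ f b).lam i ^ 2
        ≤ m * (L / ρ) ^ 2 + m * (2 * η * W) + m * (η ^ 2 * (m * L ^ 2) * (b - a)) := by
      have h1 := mul_le_mul_of_nonneg_left hsq (by linarith : (0 : ℝ) ≤ m)
      have h2 := mul_le_mul_of_nonneg_left hfirst (by linarith : (0 : ℝ) ≤ m)
      linarith
    -- The estimates combine to ζ² ≤ ζ/20 + (7 + 9ζ)/50 + 1, impossible for ζ ≥ 20.
    nlinarith

/-- The ceiling T^{1/4} is never attained, so a dual step is altered only by clipping at 0, which
raises λ. Hence λ dominates η times the cumulated violation. -/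
theorem sum_viol_run_le (hm : 0 < m) (hT : (20 : ℝ) ≤ T) (hδ : δ ∈ Set.Ioo (0 : ℝ) 1) {Z : ℝ}
    (hZ : Z ≤ (T : ℝ) ^ ((1 : ℝ) / 4)) (hΛ : ∀ t ≤ T, S.lamSum T δ f t < Z) (i : Fin m) :
    ∑ t ∈ Finset.range T, viol (f t).G (S.run T δ f t).q i ≤ 1 / dualRate X A m T δ * Z := by
  have hη0 := S.dualRate_pos (A := A) hm hT hδ
  have key : ∀ n ≤ T, dualRate X A m T δ *
      ∑ t ∈ Finset.range n, viol (f t).G (S.run T δ f t).q i ≤ (S.run T δ f n).lam i := by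
    intro n
    induction n with
    | zero =>
      intro _
      simpa using S.run_lam_nonneg (T := T) (δ := δ) (f := f) 0 i
    | succ n ih =>
      intro hn
      have h1 := ih (by omega)
      have h2 := (S.run_lam_le_lamSum (T := T) (δ := δ) (f := f) (n + 1) i).trans_lt
        ((hΛ (n + 1) hn).trans_le hZ)
      rw [Finset.sum_range_succ, mul_add]
      rw [S.run_lam_succ_apply] at h2 ⊢
      have h3 := (max_lt_iff.1 h2).2
      have h4 := (min_lt_iff.1 h3).resolve_right (lt_irrefl _)
      rw [min_eq_left h4.le]
      exact le_trans (by linarith) (le_max_right _ _)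
  have h1 := (key T le_rfl).trans ((S.run_lam_le_lamSum T i).trans (hΛ T le_rfl).le)
  rw [one_div, ← div_eq_inv_mul, le_div_iff₀ hη0, mul_comm]
  exact h1

theorem violation_le (hm : 0 < m) (hT : (20 : ℝ) ≤ T) (hδ : δ ∈ Set.Ioo (0 : ℝ) 1) {Z : ℝ}
    (hZ : Z ≤ (T : ℝ) ^ ((1 : ℝ) / 4)) (hΛ : ∀ t ≤ T, S.lamSum T δ f t < Z)
    (hQ : ∑ t ∈ Finset.range T, ∑ x, ∑ a,
      |(S.run T δ f t).q (x, a) - S.played P T δ f t (x, a)| ≤ errQ X A L T δ) :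
    S.violation P T δ f ≤ 1 / dualRate X A m T δ * Z + errQ X A L T δ := by
  have : Nonempty (Fin m) := ⟨⟨0, hm⟩⟩
  refine ciSup_le fun i => ?_
  refine le_trans ?_ (add_le_add (h.sum_viol_run_le hm hT hδ hZ hΛ i) hQ)
  rw [← Finset.sum_add_distrib]
  refine Finset.sum_le_sum fun t ht => ?_
  have htT := Finset.mem_range.1 ht
  have h1 := abs_dot_le (fun x a => h.abs_G_le htT x a i)
    ((S.run T δ f t).q - S.played P T δ f t)
  rw [one_mul, dot_sub] at h1
  have h2 := (abs_le.1 h1).1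
  simp only [PiLp.sub_apply] at h2
  unfold viol
  linarith

end LoopFree.Regular

end DualBound

/-! ### The regret decomposition -/

section Regret

variable {X A : Type*} [Fintype X] [DecidableEq X] [Fintype A] [DecidableEq A] [Nonempty A]
  {L m : ℕ} {S : LoopFree X L} {P : X → A → X → ℝ} {T : ℕ} {δ : ℝ} {f : ℕ → Feedback X A L m}

/-- Pure algebra, with no sign or boundedness assumption: expand ℓ = Gλ - r in the primal regret and
insert q̂_t in the dual term. -/
theorem LoopFree.sum_dot_sub_played_eq (q : Vec X A) :
    ∑ t ∈ Finset.range T, (dot (f t).r q - dot (f t).r (S.played P T δ f t))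
      = S.dualRegret T δ f 0 + S.primalRegret P T δ f q
        + ∑ t ∈ Finset.range T, ∑ i, (S.run T δ f t).lam i * viol (f t).G q i
        + ∑ t ∈ Finset.range T, ∑ i, (S.run T δ f t).lam i *
          viol (f t).G ((S.run T δ f t).q - S.played P T δ f t) i := by
  unfold LoopFree.dualRegret LoopFree.primalRegret
  rw [← Finset.sum_add_distrib, ← Finset.sum_add_distrib, ← Finset.sum_add_distrib]
  refine Finset.sum_congr rfl fun t _ => ?_
  rw [dot_sub, dot_loss, dot_loss]
  have e : ∀ i, viol (f t).G ((S.run T δ f t).q - S.played P T δ f t) i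
      = viol (f t).G (S.run T δ f t).q i - viol (f t).G (S.played P T δ f t) i :=
    fun i => dot_sub _ _ _
  simp only [e, mul_sub, sub_mul, Finset.sum_sub_distrib]
  simp only [PiLp.zero_apply, zero_mul, Finset.sum_const_zero]
  ring

theorem sum_lam_mul_viol_eq {lam : ℕ → Fin m → ℝ} {G : ℕ → X → A → Fin m → ℝ} (q : Vec X A) :
    ∑ t ∈ Finset.range T, ∑ i, lam t i * viol (G t) q i
      = ∑ x, ∑ a, q (x, a) * ∑ t ∈ Finset.range T, ∑ i, lam t i * G t x a i := by
  unfold viol dot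
  simp only [Finset.mul_sum]
  rw [Finset.sum_congr rfl fun t _ => Finset.sum_comm, Finset.sum_comm]
  refine Finset.sum_congr rfl fun x _ => ?_
  rw [Finset.sum_congr rfl fun t _ => Finset.sum_comm, Finset.sum_comm]
  refine Finset.sum_congr rfl fun a _ => Finset.sum_congr rfl fun t _ =>
    Finset.sum_congr rfl fun i _ => ?_
  ring

namespace LoopFree.Regular

variable (h : S.Regular P T δ f)
include h

theorem sum_abs_played (hT : (20 : ℝ) ≤ T) (hδ : δ ∈ Set.Ioo (0 : ℝ) 1) {t : ℕ} (ht : t ≤ T) :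
    ∑ x, ∑ a, |S.played P T δ f t (x, a)| = L :=
  S.sum_abs_of_mem_Delta (S.isTransition_of_mem_singleton h.isTransition) (h.played_mem hT hδ ht)

theorem sum_lam_mul_viol_le_mul {Z : ℝ} {t : ℕ} (ht : t < T)
    (hΛ : S.lamSum T δ f t ≤ Z) (q : Vec X A) :
    ∑ i, (S.run T δ f t).lam i * viol (f t).G q i ≤ Z * ∑ x, ∑ a, |q (x, a)| := by
  have hs : 0 ≤ ∑ x, ∑ a, |q (x, a)| :=
    Finset.sum_nonneg fun _ _ => Finset.sum_nonneg fun _ _ => abs_nonneg _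
  refine le_trans ?_ (mul_le_mul_of_nonneg_right hΛ hs)
  unfold LoopFree.lamSum
  rw [Finset.sum_mul]
  refine Finset.sum_le_sum fun i _ =>
    mul_le_mul_of_nonneg_left ?_ (S.run_lam_nonneg t i)
  have := abs_dot_le (fun x a => h.abs_G_le ht x a i) q
  rw [one_mul] at this
  exact (le_abs_self _).trans this

/-- With at least T state-action pairs the estimation error is vacuous: |X|√(T|A|) is already at
least T. -/
theorem mul_horizon_le_errQ (hT : (20 : ℝ) ≤ T) (hδ : δ ∈ Set.Ioo (0 : ℝ) 1)
    (hXA : (T : ℝ) ≤ Fintype.card X * Fintype.card A) : 3 * L * T ≤ errQ X A L T δ := by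
  have : Nonempty X := ⟨S.init⟩
  have hlog := one_le_log_mul_card_div (X := X) (A := A) hT hδ
  have hA : (1 : ℝ) ≤ Fintype.card A := by exact_mod_cast Fintype.card_pos
  have hX : (1 : ℝ) ≤ Fintype.card X := by exact_mod_cast Fintype.card_pos
  unfold errQ
  have h1 : 0 ≤ 4 * L * Fintype.card X * Real.sqrt (2 * T * Real.log (1 / δ)) := by positivity
  have h2 : (T : ℝ) ≤ Fintype.card X * Real.sqrt (2 * T * Fintype.card A *
      Real.log (T * Fintype.card X * Fintype.card A / δ)) := by
    have h3 : Real.sqrt (T * Fintype.card A) ≤ Real.sqrt (2 * T * Fintype.card A *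
        Real.log (T * Fintype.card X * Fintype.card A / δ)) := by
      apply Real.sqrt_le_sqrt
      have : (0 : ℝ) ≤ T * Fintype.card A := by positivity
      nlinarith
    refine le_trans ?_ (mul_le_mul_of_nonneg_left h3 (by positivity))
    apply le_of_sq_le_sq _ (by positivity)
    rw [mul_pow, Real.sq_sqrt (by positivity)]
    have : (0 : ℝ) ≤ T := by positivity
    nlinarith [mul_le_mul_of_nonneg_left hXA this, mul_nonneg this (by positivity :
      (0 : ℝ) ≤ Fintype.card X * Fintype.card A)]
  have h4 : (0 : ℝ) ≤ L := by positivity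
  have h5 := mul_le_mul_of_nonneg_left h2 h4
  have h6 : 0 ≤ L * (T : ℝ) := by positivity
  nlinarith

/-- Feasibility of q for the mean constraints removes the mean part of λᵀGᵀq. The noise is bounded
for each pair separately and then averaged with the weights q(x, a), so q may be any random feasible
vector. -/
theorem sum_dot_sub_played_le (hT : (20 : ℝ) ≤ T) (hδ : δ ∈ Set.Ioo (0 : ℝ) 1)
    {Gbar : X → A → Fin m → ℝ} {Z : ℝ} (hZ : 0 ≤ Z)
    (hΛ : ∀ t ≤ T, S.lamSum T δ f t < Z)
    (hconc : ∀ x a, ∑ t ∈ Finset.range T, ∑ i, S.truncLam T δ f Z t i *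
      ((f t).G x a i - Gbar x a i)
        ≤ Z * Real.sqrt (2 * T * Real.log (Fintype.card X * Fintype.card A / δ)))
    (hQ : ∑ t ∈ Finset.range T, ∑ x, ∑ a,
      |(S.run T δ f t).q (x, a) - S.played P T δ f t (x, a)| ≤ errQ X A L T δ)
    {q : Vec X A} (hq : q ∈ S.feasible P Gbar) :
    ∑ t ∈ Finset.range T, (dot (f t).r q - dot (f t).r (S.played P T δ f t))
      ≤ Z * errG L T δ + Z * errQ X A L T δ + S.dualRegret T δ f 0
        + S.primalRegret P T δ f q := by
  rw [LoopFree.sum_dot_sub_played_eq]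
  have hTr := S.isTransition_of_mem_singleton h.isTransition
  have hsumq := S.sum_abs_of_mem_Delta hTr hq.1
  suffices hs : ∑ t ∈ Finset.range T, ∑ i, (S.run T δ f t).lam i * viol (f t).G q i
        + ∑ t ∈ Finset.range T, ∑ i, (S.run T δ f t).lam i *
          viol (f t).G ((S.run T δ f t).q - S.played P T δ f t) i
      ≤ Z * errG L T δ + Z * errQ X A L T δ by linarith
  have hLZ : 0 ≤ Z * errG L T δ := mul_nonneg hZ (by unfold errG; positivity)
  -- The union bound over entries costs ln(|X||A|/δ), which `errG` covers only when |X||A| is below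
  -- T². Otherwise the trivial bounds ZLT and 2ZLT fit into Z · `errQ`; the threshold T serves both
  -- cases.
  rcases lt_or_ge (Fintype.card X * Fintype.card A : ℝ) T with hXA | hXA
  · refine add_le_add ?_ ?_
    · have h1 : ∑ t ∈ Finset.range T, ∑ i, (S.run T δ f t).lam i * viol (f t).G q i
          ≤ ∑ t ∈ Finset.range T, ∑ i, S.truncLam T δ f Z t i *
            viol (fun x a i => (f t).G x a i - Gbar x a i) q i := by
        refine Finset.sum_le_sum fun t ht => Finset.sum_le_sum fun i _ => ?_
        have hl := S.run_lam_nonneg (T := T) (δ := δ) (f := f) t i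
        have htr : S.truncLam T δ f Z t i = (S.run T δ f t).lam i :=
          if_pos (hΛ t (Finset.mem_range.1 ht).le).le
        have e : viol (fun x a i => (f t).G x a i - Gbar x a i) q i
            = viol (f t).G q i - viol Gbar q i := (viol_eq_sub_dot _ _ _ _).symm
        rw [htr, e]
        exact mul_le_mul_of_nonneg_left (by linarith [hq.2 i]) hl
      refine h1.trans ?_
      rw [sum_lam_mul_viol_eq (lam := fun t i => S.truncLam T δ f Z t i)
        (G := fun t x a i => (f t).G x a i - Gbar x a i)]
      have h2 : Real.sqrt (2 * T * Real.log (Fintype.card X * Fintype.card A / δ))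
          ≤ Real.sqrt (2 * T * Real.log (T ^ 2 / δ)) := by
        have hXA0 : (0 : ℝ) < Fintype.card X * Fintype.card A := by
          have h1 : (0 : ℝ) < Fintype.card X := by exact_mod_cast S.card_pos
          have h2 : (0 : ℝ) < Fintype.card A := by exact_mod_cast Fintype.card_pos
          positivity
        have hδ0 := hδ.1
        apply Real.sqrt_le_sqrt
        gcongr
        nlinarith
      calc ∑ x, ∑ a, q (x, a) * ∑ t ∈ Finset.range T, ∑ i, S.truncLam T δ f Z t i *
            ((f t).G x a i - Gbar x a i)
          ≤ ∑ x, ∑ a, |q (x, a)| * (Z * Real.sqrt (2 * T * Real.log (T ^ 2 / δ))) := by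
            refine Finset.sum_le_sum fun x _ => Finset.sum_le_sum fun a _ => ?_
            have h0 := S.nonneg_of_mem_Delta hTr hq.1 (x, a)
            rw [abs_of_nonneg h0]
            exact mul_le_mul_of_nonneg_left
              ((hconc x a).trans (mul_le_mul_of_nonneg_left h2 hZ)) h0
        _ = L * (Z * Real.sqrt (2 * T * Real.log (T ^ 2 / δ))) := by
            simp_rw [← Finset.sum_mul]
            rw [hsumq]
        _ ≤ Z * errG L T δ := by
            unfold errG
            have : 0 ≤ L * (Z * Real.sqrt (2 * T * Real.log (T ^ 2 / δ))) := by positivity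
            linarith
    · refine le_trans ?_ (mul_le_mul_of_nonneg_left hQ hZ)
      rw [Finset.mul_sum]
      refine Finset.sum_le_sum fun t ht => ?_
      have htT := Finset.mem_range.1 ht
      exact h.sum_lam_mul_viol_le_mul htT (hΛ t htT.le).le
        ((S.run T δ f t).q - S.played P T δ f t)
  · have hE := h.mul_horizon_le_errQ hT hδ hXA
    have h1 : ∑ t ∈ Finset.range T, ∑ i, (S.run T δ f t).lam i * viol (f t).G q i
        ≤ ∑ _t ∈ Finset.range T, Z * L := by
      refine Finset.sum_le_sum fun t ht => ?_
      have htT := Finset.mem_range.1 ht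
      have := h.sum_lam_mul_viol_le_mul htT (hΛ t htT.le).le q
      rwa [hsumq] at this
    have h2 : ∑ t ∈ Finset.range T, ∑ i, (S.run T δ f t).lam i *
        viol (f t).G ((S.run T δ f t).q - S.played P T δ f t) i
        ≤ ∑ _t ∈ Finset.range T, Z * (2 * L) := by
      refine Finset.sum_le_sum fun t ht => ?_
      have htT := Finset.mem_range.1 ht
      refine (h.sum_lam_mul_viol_le_mul htT (hΛ t htT.le).le _).trans
        (mul_le_mul_of_nonneg_left ?_ hZ)
      calc ∑ x, ∑ a, |((S.run T δ f t).q - S.played P T δ f t) (x, a)|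
          ≤ ∑ x, ∑ a, (|(S.run T δ f t).q (x, a)| + |S.played P T δ f t (x, a)|) :=
            Finset.sum_le_sum fun x _ => Finset.sum_le_sum fun a _ => abs_sub _ _
        _ = 2 * L := by
            simp_rw [Finset.sum_add_distrib]
            rw [h.sum_abs_run_q hT hδ htT.le, h.sum_abs_played hT hδ htT.le]
            ring
    simp only [Finset.sum_const, Finset.card_range, nsmul_eq_mul] at h1 h2
    have h3 := mul_le_mul_of_nonneg_left hE hZ
    linarith

end LoopFree.Regular

end Regret

end CMDP

namespace CMDP

/-! ### Counters and the cost of not knowing the transition function -/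

section Counters

variable {X A : Type*} [Fintype X] [DecidableEq X] [Fintype A] [DecidableEq A]
  {L m : ℕ} (S : LoopFree X L) {P : X → A → X → ℝ} {T : ℕ} {δ : ℝ} {f : ℕ → Feedback X A L m}

/-- The number of visits of a trajectory to a state-action pair. -/
def visitCount (τ : Traj X A L) (x : X) (a : A) : ℕ :=
  (Finset.univ.filter fun k : Fin L => τ.1 k.castSucc = x ∧ τ.2 k = a).card

/-- The number of occurrences of a transition in a trajectory. -/
def moveCount (τ : Traj X A L) (x : X) (a : A) (x' : X) : ℕ :=
  (Finset.univ.filter fun k : Fin L =>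
    τ.1 k.castSucc = x ∧ τ.2 k = a ∧ τ.1 k.succ = x').card

theorem LoopFree.run_succ_N (t : ℕ) (x : X) (a : A) :
    (S.run T δ f (t + 1)).N x a = (S.run T δ f t).N x a + visitCount (f t).τ x a := rfl

theorem LoopFree.run_succ_M (t : ℕ) (x : X) (a : A) (x' : X) :
    (S.run T δ f (t + 1)).M x a x' = (S.run T δ f t).M x a x' + moveCount (f t).τ x a x' := rfl

theorem sum_moveCount (τ : Traj X A L) (x : X) (a : A) :
    ∑ x', moveCount τ x a x' = visitCount τ x a := by
  unfold moveCount visitCount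
  rw [← Finset.card_biUnion]
  · congr 1
    ext k
    simp
  · intro y _ z _ hyz
    rw [Function.onFun, Finset.disjoint_left]
    intro k hy hz
    simp only [Finset.mem_filter, Finset.mem_univ, true_and] at hy hz
    exact hyz (hy.2.2.symm.trans hz.2.2)

theorem sum_sum_moveCount_comm (τ : Traj X A L) (g : X → A → X → ℝ) :
    ∑ x, ∑ a, ∑ x', (moveCount τ x a x' : ℝ) * g x a x'
      = ∑ k : Fin L, g (τ.1 k.castSucc) (τ.2 k) (τ.1 k.succ) := by
  have h : ∀ x a x', (moveCount τ x a x' : ℝ) * g x a x'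
      = ∑ k : Fin L, if τ.1 k.castSucc = x ∧ τ.2 k = a ∧ τ.1 k.succ = x' then
          g (τ.1 k.castSucc) (τ.2 k) (τ.1 k.succ) else 0 := by
    intro x a x'
    rw [moveCount, Finset.card_eq_sum_ones, Finset.sum_filter]
    push_cast
    rw [Finset.sum_mul]
    refine Finset.sum_congr rfl fun k _ => ?_
    split_ifs with hk
    · rw [one_mul, hk.1, hk.2.1, hk.2.2]
    · rw [zero_mul]
  simp_rw [h]
  rw [Finset.sum_congr rfl fun x _ => Finset.sum_congr rfl fun a _ => Finset.sum_comm]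
  rw [Finset.sum_congr rfl fun x _ => Finset.sum_comm, Finset.sum_comm]
  refine Finset.sum_congr rfl fun k _ => ?_
  rw [Finset.sum_eq_single (τ.1 k.castSucc), Finset.sum_eq_single (τ.2 k),
    Finset.sum_eq_single (τ.1 k.succ)]
  · simp
  · intro y _ hy; simp [hy.symm]
  · simp
  · intro y _ hy; simp [hy.symm]
  · simp
  · intro y _ hy; simp [hy.symm]
  · simp

theorem sum_sum_visitCount_comm (τ : Traj X A L) (g : X → A → ℝ) :
    ∑ x, ∑ a, (visitCount τ x a : ℝ) * g x a = ∑ k : Fin L, g (τ.1 k.castSucc) (τ.2 k) := by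
  rw [← sum_sum_moveCount_comm τ (fun x a _ => g x a)]
  refine Finset.sum_congr rfl fun x _ => Finset.sum_congr rfl fun a _ => ?_
  rw [← Finset.sum_mul, ← sum_moveCount]
  push_cast
  rfl

/-- A counter that would break the inequality has just been visited, so it triggers an epoch and
resets N₀ to N. Pairs not visited keep their counter. -/
theorem LoopFree.run_N_lt (t : ℕ) (x : X) (a : A) :
    (S.run T δ f t).N x a < max 1 (2 * (S.run T δ f t).N₀ x a) := by
  classical
  induction t with
  | zero => exact Nat.zero_lt_one
  | succ t ih =>
    have hN₀ : (S.run T δ f (t + 1)).N₀ = if ∃ k : Fin L,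
        max 1 (2 * (S.run T δ f t).N₀ ((f t).τ.1 k.castSucc) ((f t).τ.2 k))
          ≤ (S.run T δ f (t + 1)).N ((f t).τ.1 k.castSucc) ((f t).τ.2 k)
        then (S.run T δ f (t + 1)).N else (S.run T δ f t).N₀ := by
      change ite _ _ _ = _
      congr
    rw [hN₀]
    split_ifs with h
    · rw [lt_max_iff]
      omega
    · push Not at h
      by_cases hv : ∃ k : Fin L, (f t).τ.1 k.castSucc = x ∧ (f t).τ.2 k = a
      · obtain ⟨k, rfl, rfl⟩ := hv
        exact h k
      · have h0 : visitCount (f t).τ x a = 0 := by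
          unfold visitCount
          rw [Finset.card_eq_zero, Finset.filter_eq_empty_iff]
          exact fun k _ hk => hv ⟨k, hk⟩
        rw [S.run_succ_N, h0, add_zero]
        exact ih

theorem LoopFree.exists_epoch_start (t : ℕ) : ∃ s ≤ t,
    (S.run T δ f t).N₀ = (S.run T δ f s).N ∧ (S.run T δ f t).M₀ = (S.run T δ f s).M := by
  classical
  induction t with
  | zero => exact ⟨0, le_rfl, rfl, rfl⟩
  | succ t ih =>
    obtain ⟨s, hs, h1, h2⟩ := ih
    by_cases h : ∃ k : Fin L,
        max 1 (2 * (S.run T δ f t).N₀ ((f t).τ.1 k.castSucc) ((f t).τ.2 k))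
          ≤ (S.run T δ f (t + 1)).N ((f t).τ.1 k.castSucc) ((f t).τ.2 k)
    · exact ⟨t + 1, le_rfl, if_pos h, if_pos h⟩
    · exact ⟨s, by omega, (if_neg h).trans h1, (if_neg h).trans h2⟩

theorem LoopFree.run_N_succ_le (t : ℕ) (x : X) (a : A) :
    ((S.run T δ f t).N x a + 1 : ℝ) ≤ 2 * max 1 ((S.run T δ f t).N₀ x a : ℝ) := by
  have h := S.run_N_lt (T := T) (δ := δ) (f := f) t x a
  have h2 : (S.run T δ f t).N x a + 1 ≤ 2 * max 1 ((S.run T δ f t).N₀ x a) := by omega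
  have h3 : (((S.run T δ f t).N x a + 1 : ℕ) : ℝ)
      ≤ ((2 * max 1 ((S.run T δ f t).N₀ x a) : ℕ) : ℝ) := by exact_mod_cast h2
  push_cast at h3
  exact h3

variable {S}

theorem visitCount_le_one {τ : Traj X A L} (hτ : ∀ k, S.layer (τ.1 k) = k) (x : X) (a : A) :
    visitCount τ x a ≤ 1 := by
  unfold visitCount
  rw [Finset.card_le_one]
  intro k hk j hj
  simp only [Finset.mem_filter, Finset.mem_univ, true_and] at hk hj
  have h1 := hτ k.castSucc
  have h2 := hτ j.castSucc
  rw [hk.1] at h1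
  rw [hj.1, h1] at h2
  exact Fin.ext (by simpa using h2)

theorem visitCount_final {τ : Traj X A L} (hτ : ∀ k, S.layer (τ.1 k) = k) {x : X}
    (hx : S.layer x = L) (a : A) : visitCount τ x a = 0 := by
  unfold visitCount
  rw [Finset.card_eq_zero, Finset.filter_eq_empty_iff]
  rintro k - ⟨hk, -⟩
  have h1 := hτ k.castSucc
  rw [hk, hx] at h1
  have := k.2
  simp at h1
  omega

theorem moveCount_eq_zero {τ : Traj X A L} (hτ : ∀ k, S.layer (τ.1 k) = k) {x x' : X}
    (hx : S.layer x' ≠ S.layer x + 1) (a : A) : moveCount τ x a x' = 0 := by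
  unfold moveCount
  rw [Finset.card_eq_zero, Finset.filter_eq_empty_iff]
  rintro k - ⟨h1, -, h2⟩
  have h3 := hτ k.castSucc
  have h4 := hτ k.succ
  rw [h1] at h3
  rw [h2] at h4
  simp at h3 h4
  omega

theorem moveCount_eq_ite {τ : Traj X A L} (hτ : ∀ k, S.layer (τ.1 k) = k) (x : X) (a : A)
    (x' : X) [Decidable (S.Visits τ x a x')] :
    moveCount τ x a x' = if S.Visits τ x a x' then 1 else 0 := by
  have hle : moveCount τ x a x' ≤ 1 :=
    ((Finset.single_le_sum (f := fun y => moveCount τ x a y) (fun _ _ => Nat.zero_le _)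
      (Finset.mem_univ x')).trans_eq (sum_moveCount τ x a)).trans (visitCount_le_one hτ x a)
  split_ifs with h
  · obtain ⟨k, -, hk⟩ := h
    refine le_antisymm hle (Finset.card_pos.2 ⟨k, ?_⟩)
    simpa using hk
  · unfold moveCount
    rw [Finset.card_eq_zero, Finset.filter_eq_empty_iff]
    rintro k - hk
    refine h ⟨k, ?_, hk⟩
    have := hτ k.castSucc
    rw [hk.1] at this
    simpa using this.symm

theorem sum_layer_visitCount {τ : Traj X A L} (hτ : ∀ k, S.layer (τ.1 k) = k) {j : ℕ}
    (hj : j < L) : ∑ x ∈ S.layerSet j, ∑ a, (visitCount τ x a : ℝ) = 1 := by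
  have h := sum_sum_visitCount_comm τ (fun x _ => if S.layer x = j then (1 : ℝ) else 0)
  have e : ∑ x ∈ S.layerSet j, ∑ a, (visitCount τ x a : ℝ)
      = ∑ x, ∑ a, (visitCount τ x a : ℝ) * (if S.layer x = j then (1 : ℝ) else 0) := by
    rw [LoopFree.layerSet, Finset.sum_filter]
    refine Finset.sum_congr rfl fun x _ => ?_
    split_ifs <;> simp
  rw [e, h]
  simp only [hτ]
  rw [Finset.sum_eq_single ⟨j, hj⟩]
  · simp
  · intro k _ hk
    rw [if_neg]
    intro h'
    exact hk (Fin.ext (by simpa using h'))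
  · simp

theorem one_div_sqrt_succ_le (n : ℕ) :
    1 / Real.sqrt (n + 1 : ℝ) ≤ 2 * Real.sqrt (n + 1 : ℝ) - 2 * Real.sqrt n := by
  have h1 : 0 < Real.sqrt (n + 1 : ℝ) := Real.sqrt_pos.2 (by positivity)
  have h2 : Real.sqrt (n : ℝ) ≤ Real.sqrt (n + 1 : ℝ) := Real.sqrt_le_sqrt (by linarith)
  have h3 := Real.mul_self_sqrt (by positivity : (0 : ℝ) ≤ n + 1)
  have h4 := Real.mul_self_sqrt (by positivity : (0 : ℝ) ≤ n)
  have h5 := Real.sqrt_nonneg (n : ℝ)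
  rw [div_le_iff₀ h1]
  nlinarith

namespace LoopFree.Regular

variable (h : S.Regular P T δ f)
include h

/-- Stale counters cost only a factor √2, because N + 1 ≤ 2 max(1, N₀). The sum of 1/√(N + 1) over
visits then telescopes to 2√N. -/
theorem sum_visitCount_div_le (x : X) (a : A) {n : ℕ} (hn : n ≤ T) :
    ∑ t ∈ Finset.range n, (visitCount (f t).τ x a : ℝ) /
        Real.sqrt (max 1 ((S.run T δ f t).N₀ x a : ℝ))
      ≤ Real.sqrt 2 * (2 * Real.sqrt ((S.run T δ f n).N x a)) := by
  induction n with
  | zero => simp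
  | succ n ih =>
    rw [Finset.sum_range_succ, S.run_succ_N]
    have ih := ih (by omega)
    have hle := visitCount_le_one (h.layer_eq n (by omega)) x a
    obtain h0 | h1 : visitCount (f n).τ x a = 0 ∨ visitCount (f n).τ x a = 1 := by omega
    · rw [h0]
      simpa using ih
    · rw [h1]
      push_cast
      have hN := S.run_N_succ_le (T := T) (δ := δ) (f := f) n x a
      set N := (S.run T δ f n).N x a
      set M := max 1 ((S.run T δ f n).N₀ x a : ℝ)
      have hM : 1 ≤ M := le_max_left _ _
      have h2 : 1 / Real.sqrt M ≤ Real.sqrt 2 * (1 / Real.sqrt (N + 1 : ℝ)) := by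
        rw [mul_one_div, div_le_div_iff₀ (Real.sqrt_pos.2 (by linarith))
          (Real.sqrt_pos.2 (by positivity)), one_mul, ← Real.sqrt_mul (by norm_num)]
        exact Real.sqrt_le_sqrt hN
      have h3 := mul_le_mul_of_nonneg_left (one_div_sqrt_succ_le N) (Real.sqrt_nonneg 2)
      linarith

theorem sum_layer_N {j : ℕ} (hj : j < L) {n : ℕ} (hn : n ≤ T) :
    ∑ x ∈ S.layerSet j, ∑ a, ((S.run T δ f n).N x a : ℝ) = n := by
  induction n with
  | zero => simp [LoopFree.run, LoopFree.initState]
  | succ n ih =>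
    simp only [S.run_succ_N]
    push_cast
    simp_rw [Finset.sum_add_distrib]
    rw [ih (by omega), sum_layer_visitCount (h.layer_eq n (by omega)) hj]

/-- Cauchy-Schwarz within a layer, which is visited exactly once per episode. -/
theorem sum_layer_sqrt_N_le {j : ℕ} (hj : j < L) :
    ∑ x ∈ S.layerSet j, ∑ a, Real.sqrt ((S.run T δ f T).N x a)
      ≤ Real.sqrt ((S.layerSet j).card * Fintype.card A * T) := by
  apply Real.le_sqrt_of_sq_le
  rw [← Finset.sum_product' (f := fun x a => Real.sqrt ((S.run T δ f T).N x a))]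
  refine (sq_sum_le_card_mul_sum_sq).trans_eq ?_
  rw [Finset.card_product, Finset.card_univ]
  have e : ∀ p : X × A, Real.sqrt ((S.run T δ f T).N p.1 p.2) ^ 2 = ((S.run T δ f T).N p.1 p.2 : ℝ) :=
    fun p => Real.sq_sqrt (by positivity)
  simp_rw [e]
  rw [Finset.sum_product' (f := fun x a => ((S.run T δ f T).N x a : ℝ)),
    h.sum_layer_N hj le_rfl]
  push_cast
  ring

end LoopFree.Regular

end Counters

/-! ### Distance between optimistic and true occupancy vectors -/

section Estimation

variable {X A : Type*} [Fintype X] [DecidableEq X] [Fintype A] [DecidableEq A] [Nonempty A]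
  {L m : ℕ} {S : LoopFree X L} {P : X → A → X → ℝ} {T : ℕ} {δ : ℝ} {f : ℕ → Feedback X A L m}

/-- The exploration bonus `min {2, 2 ε(x, a)}`. -/
noncomputable def LoopFree.bonus (S : LoopFree X L) (T : ℕ) (δ : ℝ) (N : X → A → ℕ) (x : X)
    (a : A) : ℝ :=
  min 2 (2 * S.radius T δ N x a)

theorem LoopFree.bonus_nonneg (N : X → A → ℕ) (x : X) (a : A) : 0 ≤ S.bonus T δ N x a :=
  le_min zero_le_two (mul_nonneg zero_le_two (Real.sqrt_nonneg _))

theorem LoopFree.sum_eq_sum_layers (g : X → ℝ) (hg : ∀ x, S.layer x = L → g x = 0) :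
    ∑ x, g x = ∑ j ∈ Finset.range L, ∑ x ∈ S.layerSet j, g x := by
  rw [← Finset.sum_fiberwise_of_maps_to (s := Finset.univ) (t := Finset.range (L + 1))
    (g := S.layer) (fun x _ => Finset.mem_range.2 (Nat.lt_succ_of_le (S.layer_le x))),
    Finset.sum_range_succ]
  rw [Finset.sum_eq_zero (s := Finset.univ.filter fun x => S.layer x = L), add_zero]
  · rfl
  · intro x hx
    exact hg x (Finset.mem_filter.1 hx).2

/-- By the arithmetic-geometric mean inequality each term is at most half the size of two adjacent
layers, and each of the two resulting sums is at most |X|. -/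
theorem LoopFree.sum_sqrt_card_layers_le :
    ∑ j ∈ Finset.range L, Real.sqrt (((S.layerSet j).card : ℝ) * (S.layerSet (j + 1)).card)
      ≤ Fintype.card X := by
  have h1 : ∀ j, Real.sqrt (((S.layerSet j).card : ℝ) * (S.layerSet (j + 1)).card)
      ≤ (((S.layerSet j).card : ℝ) + (S.layerSet (j + 1)).card) / 2 := by
    intro j
    rw [Real.sqrt_le_left (by positivity)]
    nlinarith [sq_nonneg (((S.layerSet j).card : ℝ) - (S.layerSet (j + 1)).card)]
  have h2 : (∑ j ∈ Finset.range L, ((S.layerSet j).card : ℝ)) ≤ Fintype.card X := by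
    exact_mod_cast S.sum_card_layerSet_le (Finset.range L)
  have h3 : (∑ j ∈ Finset.range L, ((S.layerSet (j + 1)).card : ℝ)) ≤ Fintype.card X := by
    have h := S.sum_card_layerSet_le (Finset.range (L + 1))
    rw [Finset.sum_range_succ'] at h
    have h' : ∑ j ∈ Finset.range L, (S.layerSet (j + 1)).card ≤ Fintype.card X := by omega
    exact_mod_cast h'
  calc _ ≤ ∑ j ∈ Finset.range L, (((S.layerSet j).card : ℝ) + (S.layerSet (j + 1)).card) / 2 :=
        Finset.sum_le_sum fun j _ => h1 j
    _ = ((∑ j ∈ Finset.range L, ((S.layerSet j).card : ℝ))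
        + ∑ j ∈ Finset.range L, ((S.layerSet (j + 1)).card : ℝ)) / 2 := by
        rw [← Finset.sum_div, Finset.sum_add_distrib]
    _ ≤ _ := by linarith

namespace LoopFree.Regular

variable (h : S.Regular P T δ f)
include h

theorem sum_visitCount_mul_radius_le (x : X) (a : A) :
    ∑ t ∈ Finset.range T, (visitCount (f t).τ x a : ℝ) *
        S.radius T δ (S.run T δ f t).N₀ x a
      ≤ Real.sqrt (2 * (S.layerSet (S.layer x + 1)).card *
          Real.log (T * Fintype.card X * Fintype.card A / δ)) *
        (Real.sqrt 2 * (2 * Real.sqrt ((S.run T δ f T).N x a))) := by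
  refine le_trans (le_of_eq ?_) (mul_le_mul_of_nonneg_left (h.sum_visitCount_div_le x a le_rfl)
    (Real.sqrt_nonneg _))
  rw [Finset.mul_sum]
  refine Finset.sum_congr rfl fun t _ => ?_
  unfold LoopFree.radius
  rw [Real.sqrt_div' _ (le_trans zero_le_one (le_max_left _ _))]
  ring

/-- A factor 2 comes from the bonus and 2√2 from summing radii over visits; 4√2 ≤ 6. Working layer
by layer gives |X|√|A| instead of a larger power of the number of states. -/
theorem sum_visitCount_mul_bonus_le (hT : (20 : ℝ) ≤ T) (hδ : δ ∈ Set.Ioo (0 : ℝ) 1) :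
    ∑ t ∈ Finset.range T, ∑ x, ∑ a, (visitCount (f t).τ x a : ℝ) *
        S.bonus T δ (S.run T δ f t).N₀ x a
      ≤ 6 * Fintype.card X * Real.sqrt (2 * T * Fintype.card A *
        Real.log (T * Fintype.card X * Fintype.card A / δ)) := by
  have : Nonempty X := ⟨S.init⟩
  have hlog := one_le_log_mul_card_div (X := X) (A := A) hT hδ
  set ι := Real.log (T * Fintype.card X * Fintype.card A / δ) with hι
  have hstep : ∀ x a, ∑ t ∈ Finset.range T, (visitCount (f t).τ x a : ℝ) *
        S.bonus T δ (S.run T δ f t).N₀ x a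
      ≤ 4 * Real.sqrt 2 * Real.sqrt (2 * (S.layerSet (S.layer x + 1)).card * ι) *
        Real.sqrt ((S.run T δ f T).N x a) := by
    intro x a
    have h1 := h.sum_visitCount_mul_radius_le x a
    have h2 : ∑ t ∈ Finset.range T, (visitCount (f t).τ x a : ℝ) *
        S.bonus T δ (S.run T δ f t).N₀ x a
        ≤ 2 * ∑ t ∈ Finset.range T, (visitCount (f t).τ x a : ℝ) *
          S.radius T δ (S.run T δ f t).N₀ x a := by
      rw [Finset.mul_sum]
      refine Finset.sum_le_sum fun t _ => ?_
      have h3 : S.bonus T δ (S.run T δ f t).N₀ x a ≤ 2 * S.radius T δ (S.run T δ f t).N₀ x a :=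
        min_le_right _ _
      have := mul_le_mul_of_nonneg_left h3 (Nat.cast_nonneg (visitCount (f t).τ x a) : (0 : ℝ) ≤ _)
      linarith
    rw [← hι] at h1
    linarith
  rw [Finset.sum_comm]
  simp_rw [Finset.sum_comm (s := Finset.range T)]
  rw [LoopFree.sum_eq_sum_layers (S := S)]
  · calc ∑ j ∈ Finset.range L, ∑ x ∈ S.layerSet j, ∑ a, ∑ t ∈ Finset.range T,
          (visitCount (f t).τ x a : ℝ) * S.bonus T δ (S.run T δ f t).N₀ x a
        ≤ ∑ j ∈ Finset.range L, 6 * Real.sqrt (2 * T * Fintype.card A * ι) *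
          Real.sqrt (((S.layerSet j).card : ℝ) * (S.layerSet (j + 1)).card) := by
          refine Finset.sum_le_sum fun j hj => ?_
          calc ∑ x ∈ S.layerSet j, ∑ a, ∑ t ∈ Finset.range T,
                (visitCount (f t).τ x a : ℝ) * S.bonus T δ (S.run T δ f t).N₀ x a
              ≤ ∑ x ∈ S.layerSet j, ∑ a,
                4 * Real.sqrt 2 * Real.sqrt (2 * (S.layerSet (j + 1)).card * ι) *
                  Real.sqrt ((S.run T δ f T).N x a) := by
                refine Finset.sum_le_sum fun x hx => Finset.sum_le_sum fun a _ => ?_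
                have := hstep x a
                rwa [S.mem_layerSet.1 hx] at this
            _ = 4 * Real.sqrt 2 * Real.sqrt (2 * (S.layerSet (j + 1)).card * ι) *
                ∑ x ∈ S.layerSet j, ∑ a, Real.sqrt ((S.run T δ f T).N x a) := by
                simp_rw [Finset.mul_sum]
            _ ≤ 4 * Real.sqrt 2 * Real.sqrt (2 * (S.layerSet (j + 1)).card * ι) *
                Real.sqrt ((S.layerSet j).card * Fintype.card A * T) := by
                gcongr
                exact h.sum_layer_sqrt_N_le (Finset.mem_range.1 hj)
            _ = 4 * Real.sqrt 2 * (Real.sqrt (2 * T * Fintype.card A * ι) *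
                Real.sqrt (((S.layerSet j).card : ℝ) * (S.layerSet (j + 1)).card)) := by
                rw [mul_assoc, ← Real.sqrt_mul (by positivity), ← Real.sqrt_mul (by positivity)]
                congr 2
                ring
            _ ≤ 6 * (Real.sqrt (2 * T * Fintype.card A * ι) *
                Real.sqrt (((S.layerSet j).card : ℝ) * (S.layerSet (j + 1)).card)) := by
                gcongr
                have : Real.sqrt 2 ≤ 3 / 2 := by
                  rw [Real.sqrt_le_left (by norm_num)]
                  norm_num
                linarith
            _ = _ := by ring
      _ = 6 * Real.sqrt (2 * T * Fintype.card A * ι) * ∑ j ∈ Finset.range L,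
          Real.sqrt (((S.layerSet j).card : ℝ) * (S.layerSet (j + 1)).card) := by
          rw [Finset.mul_sum]
      _ ≤ 6 * Real.sqrt (2 * T * Fintype.card A * ι) * Fintype.card X := by
          gcongr
          exact LoopFree.sum_sqrt_card_layers_le
      _ = _ := by ring
  · intro x hx
    refine Finset.sum_eq_zero fun a _ => Finset.sum_eq_zero fun t ht => ?_
    rw [visitCount_final (h.layer_eq t (Finset.mem_range.1 ht)) hx]
    simp

/-- The vector q̂_t is the occupancy vector of its own induced policy under some member of the
confidence set, and two members differ by at most 2ε. The trivial bound 2 is kept as well, since the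
martingale of the visits needs a bounded bonus. -/
theorem sum_abs_run_q_sub_played_le (hT : (20 : ℝ) ≤ T) (hδ : δ ∈ Set.Ioo (0 : ℝ) 1) {t : ℕ}
    (ht : t ≤ T) :
    ∑ x, ∑ a, |(S.run T δ f t).q (x, a) - S.played P T δ f t (x, a)|
      ≤ L * ∑ x, ∑ a, S.played P T δ f t (x, a) * S.bonus T δ (S.run T δ f t).N₀ x a := by
  obtain ⟨P', hP', π, hπ, hq⟩ := h.run_q_mem hT hδ ht
  have hpol := h.isPolicy_run hT hδ ht
  have hq' : (S.run T δ f t).q = S.occ P' (inducedPolicy (S.run T δ f t).q) := by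
    rw [hq, S.occ_inducedPolicy hP'.1 hπ]
  have h1 := S.sum_abs_occ_sub_le h.isTransition hP'.1 hpol
  rw [← hq'] at h1
  refine h1.trans (mul_le_mul_of_nonneg_left ?_ (Nat.cast_nonneg L))
  refine Finset.sum_le_sum fun x _ => Finset.sum_le_sum fun a _ => ?_
  refine mul_le_mul_of_nonneg_left (le_min ?_ ?_) (S.occ_nonneg h.isTransition hpol _)
  · calc ∑ x', |P' x a x' - P x a x'| ≤ ∑ x', (P' x a x' + P x a x') := by
          refine Finset.sum_le_sum fun x' _ => ?_
          refine (abs_sub _ _).trans_eq ?_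
          rw [abs_of_nonneg (hP'.1.1 x a x'), abs_of_nonneg (h.isTransition.1 x a x')]
      _ ≤ 2 := by
          rw [Finset.sum_add_distrib]
          linarith [S.sum_step_le_one hP'.1 x a, S.sum_step_le_one h.isTransition x a]
  · set N := (S.run T δ f t).N₀
    set M := (S.run T δ f t).M₀
    calc ∑ x', |P' x a x' - P x a x'|
        ≤ ∑ x', (|P' x a x' - (M x a x' : ℝ) / max 1 (N x a : ℝ)|
          + |P x a x' - (M x a x' : ℝ) / max 1 (N x a : ℝ)|) := by
          refine Finset.sum_le_sum fun x' _ => ?_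
          rw [abs_sub_comm (P x a x')]
          exact abs_sub_le _ _ _
      _ ≤ _ := by
          rw [Finset.sum_add_distrib]
          linarith [hP'.2 x a, (h.conf t ht).2 x a]

theorem sum_sum_abs_run_q_sub_played_le (hT : (20 : ℝ) ≤ T) (hδ : δ ∈ Set.Ioo (0 : ℝ) 1)
    (hmart : ∑ t ∈ Finset.range T, ∑ x, ∑ a,
      (S.played P T δ f t (x, a) - visitCount (f t).τ x a) *
        S.bonus T δ (S.run T δ f t).N₀ x a ≤ L * Real.sqrt (2 * T * Real.log (1 / δ))) :
    ∑ t ∈ Finset.range T, ∑ x, ∑ a,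
      |(S.run T δ f t).q (x, a) - S.played P T δ f t (x, a)| ≤ errQ X A L T δ := by
  have h1 : ∑ t ∈ Finset.range T, ∑ x, ∑ a,
      |(S.run T δ f t).q (x, a) - S.played P T δ f t (x, a)|
      ≤ L * ∑ t ∈ Finset.range T, ∑ x, ∑ a, S.played P T δ f t (x, a) *
        S.bonus T δ (S.run T δ f t).N₀ x a := by
    rw [Finset.mul_sum]
    exact Finset.sum_le_sum fun t ht =>
      h.sum_abs_run_q_sub_played_le hT hδ (Finset.mem_range.1 ht).le
  have h2 := h.sum_visitCount_mul_bonus_le hT hδ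
  simp only [sub_mul, Finset.sum_sub_distrib] at hmart
  have hL : (0 : ℝ) ≤ L := by positivity
  have hX : (L : ℝ) ≤ Fintype.card X := by exact_mod_cast (S.horizon_lt_card h.isTransition).le
  have h3 := mul_le_mul_of_nonneg_left (show ∑ t ∈ Finset.range T, ∑ x, ∑ a,
      S.played P T δ f t (x, a) * S.bonus T δ (S.run T δ f t).N₀ x a
      ≤ L * Real.sqrt (2 * T * Real.log (1 / δ)) + 6 * Fintype.card X *
        Real.sqrt (2 * T * Fintype.card A *
          Real.log (T * Fintype.card X * Fintype.card A / δ)) by linarith) hL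
  refine h1.trans (h3.trans ?_)
  unfold errQ
  have h4 : L * Real.sqrt (2 * T * Real.log (1 / δ))
      ≤ Fintype.card X * Real.sqrt (2 * T * Real.log (1 / δ)) := by gcongr
  have h5 := mul_le_mul_of_nonneg_left h4 hL
  have h6 : 0 ≤ L * (Fintype.card X * Real.sqrt (2 * T * Real.log (1 / δ))) := by positivity
  linarith

end LoopFree.Regular

end Estimation

end CMDP

namespace CMDP

/-! ### Orders of magnitude -/

section Order

variable {X A : Type*} [Fintype X] [DecidableEq X] [Fintype A] [DecidableEq A] [Nonempty A]
  {L m : ℕ} {S : LoopFree X L} {P : X → A → X → ℝ} {T : ℕ} {δ : ℝ} {f : ℕ → Feedback X A L m}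

theorem errG_le (L T : ℕ) (δ : ℝ) : errG L T δ ≤ 3 * L * scale T δ := by
  have h := mul_le_mul_of_nonneg_left (sqrt_two_mul_le_scale T δ) (by positivity : (0 : ℝ) ≤ 2 * L)
  unfold errG
  linarith

theorem errR_le (L : ℕ) (hT : (20 : ℝ) ≤ T) (hδ : δ ∈ Set.Ioo (0 : ℝ) 1) :
    errR L T δ ≤ L * scale T δ := by
  have hδ0 := hδ.1
  have h1 : Real.sqrt (T * Real.log (2 / δ)) ≤ scale T δ := by
    apply Real.sqrt_le_sqrt
    gcongr
    nlinarith
  have h2 : (L : ℝ) / Real.sqrt 2 ≤ L :=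
    div_le_self (by positivity) (Real.one_le_sqrt.2 (by norm_num))
  unfold errR
  exact mul_le_mul h2 h1 (Real.sqrt_nonneg _) (by positivity)

/-- The constant in the bound of `errQ` by the common scale. -/
noncomputable def errQConst (X A : Type*) [Fintype X] [Fintype A] (L : ℕ) : ℝ :=
  6 * L * Fintype.card X + 9 * L * Fintype.card X *
    Real.sqrt (Fintype.card A * (1 + Real.log (Fintype.card X * Fintype.card A)))

theorem errQConst_nonneg : 0 ≤ errQConst X A L := by
  unfold errQConst
  positivity

/-- As ln(T²/δ) ≥ 1, the additional ln(|X||A|) is absorbed into a multiplicative constant that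
depends only on the spaces. -/
theorem errQ_le [Nonempty X] (hT : (20 : ℝ) ≤ T) (hδ : δ ∈ Set.Ioo (0 : ℝ) 1) :
    errQ X A L T δ ≤ errQConst X A L * scale T δ := by
  have hδ0 := hδ.1
  have hX : (1 : ℝ) ≤ Fintype.card X := by exact_mod_cast Fintype.card_pos
  have hA : (1 : ℝ) ≤ Fintype.card A := by exact_mod_cast Fintype.card_pos
  have hD := sqrt_two_mul_le_scale T δ
  have hlog := one_le_log_sq_div hT hδ
  have h1 : Real.sqrt (2 * T * Real.log (1 / δ)) ≤ 3 / 2 * scale T δ := by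
    refine le_trans (Real.sqrt_le_sqrt ?_) hD
    gcongr
    nlinarith
  have hXA : 0 ≤ Real.log (Fintype.card X * Fintype.card A : ℝ) :=
    Real.log_nonneg (by nlinarith)
  have h2 : Real.log (T * Fintype.card X * Fintype.card A / δ)
      ≤ (1 + Real.log (Fintype.card X * Fintype.card A)) * Real.log (T ^ 2 / δ) := by
    have e : (T * Fintype.card X * Fintype.card A / δ : ℝ)
        = (Fintype.card X * Fintype.card A) * (T / δ) := by ring
    have h3 : Real.log (T / δ) ≤ Real.log (T ^ 2 / δ) := by
      have hT0 : (0 : ℝ) < T := by linarith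
      gcongr
      nlinarith
    rw [e, Real.log_mul (by positivity) (by positivity)]
    nlinarith
  have h4 : Real.sqrt (2 * T * Fintype.card A *
      Real.log (T * Fintype.card X * Fintype.card A / δ))
      ≤ Real.sqrt (Fintype.card A * (1 + Real.log (Fintype.card X * Fintype.card A))) *
        (3 / 2 * scale T δ) := by
    refine le_trans ?_ (mul_le_mul_of_nonneg_left hD (Real.sqrt_nonneg _))
    rw [← Real.sqrt_mul (by positivity)]
    apply Real.sqrt_le_sqrt
    calc (2 * T * Fintype.card A * Real.log (T * Fintype.card X * Fintype.card A / δ) : ℝ)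
        ≤ 2 * T * Fintype.card A *
          ((1 + Real.log (Fintype.card X * Fintype.card A)) * Real.log (T ^ 2 / δ)) := by gcongr
      _ = _ := by ring
  unfold errQ errQConst
  calc _ ≤ 4 * L * Fintype.card X * (3 / 2 * scale T δ) + 6 * L * Fintype.card X *
        (Real.sqrt (Fintype.card A * (1 + Real.log (Fintype.card X * Fintype.card A))) *
          (3 / 2 * scale T δ)) := by gcongr
    _ = _ := by ring

namespace LoopFree.Regular

variable (h : S.Regular P T δ f)
include h

/-- Telescope the squares from λ = 0 and drop the final one. What remains is ηmL²T/2, and the value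
of η makes it at most LD. -/
theorem dualRegret_zero_le (hm : 0 < m) (hT : (20 : ℝ) ≤ T) (hδ : δ ∈ Set.Ioo (0 : ℝ) 1) :
    S.dualRegret T δ f 0 ≤ L * scale T δ := by
  have h1 := h.sum_sq_lam_le hT hδ (Nat.zero_le T) le_rfl
  have h0 : ∑ i, (S.run T δ f 0).lam i ^ 2 = 0 :=
    Finset.sum_eq_zero fun i _ => by
      change (0 : ℝ) ^ 2 = 0
      norm_num
  have hp : 0 ≤ ∑ i, (S.run T δ f T).lam i ^ 2 := Finset.sum_nonneg fun i _ => sq_nonneg _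
  have e : S.dualRegret T δ f 0 = -∑ t ∈ Finset.Ico 0 T,
      ∑ i, (S.run T δ f t).lam i * viol (f t).G (S.run T δ f t).q i := by
    rw [Nat.Ico_zero_eq_range, LoopFree.dualRegret, ← Finset.sum_neg_distrib]
    refine Finset.sum_congr rfl fun t _ => ?_
    rw [← Finset.sum_neg_distrib]
    refine Finset.sum_congr rfl fun i _ => ?_
    simp
  have hXA := LoopFree.horizon_le_card_mul_card (A := A) h.isTransition
  have hη := S.dualRate_mul (A := A) hm hT hδ
  have hη0 := S.dualRate_pos (A := A) hm hT hδ
  have hD1 := one_le_scale hT hδ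
  have hDsq := le_scale_sq hT hδ
  rw [h0] at h1
  rw [e]
  set η := dualRate X A m T δ
  set XA : ℝ := Fintype.card X * Fintype.card A
  set D := scale T δ
  set W := ∑ t ∈ Finset.Ico 0 T,
      ∑ i, (S.run T δ f t).lam i * viol (f t).G (S.run T δ f t).q i
  have h2 : η * (m * L ^ 2) * T ≤ L * D := by
    calc η * (m * L ^ 2) * T ≤ η * (m * (L * XA)) * D ^ 2 := by
          have hLL : (L : ℝ) ^ 2 ≤ L * XA := by
            rw [sq]
            gcongr
          gcongr
      _ = (η * (100 * m * XA * D)) * (L * D) / 100 := by ring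
      _ ≤ L * D := by
          rw [hη]
          have : 0 ≤ L * D := by positivity
          linarith
  have h3 : η * (-W) ≤ η * (L * D) := by
    have h4 := mul_le_mul_of_nonneg_left h2 hη0.le
    have h5 : 0 ≤ η * (L * D) := by positivity
    push_cast at h1
    nlinarith
  exact le_of_mul_le_mul_left h3 hη0

/-- Gradient descent bounds the regret of q̂_t; passing to the played q_t costs the largest loss, at
most 1 + Z, times the estimation error. -/
theorem primalRegret_le (hT : (20 : ℝ) ≤ T) (hδ : δ ∈ Set.Ioo (0 : ℝ) 1) {Z : ℝ} (hZ : 0 ≤ Z)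
    (hΛ : ∀ t ≤ T, S.lamSum T δ f t < Z)
    (hQ : ∑ t ∈ Finset.range T, ∑ x, ∑ a,
      |(S.run T δ f t).q (x, a) - S.played P T δ f t (x, a)| ≤ errQ X A L T δ)
    {q : Vec X A} (hq : q ∈ S.Delta {P}) :
    S.primalRegret P T δ f q
      ≤ 6 * (Fintype.card X * Fintype.card A) * (1 + Z) * scale T δ
        + (1 + Z) * errQ X A L T δ := by
  have hT0 : 0 < T := by
    have : (0 : ℝ) < T := by linarith
    exact_mod_cast this
  have h1 := h.sum_dot_lossAt_le hT hδ hq hT0 le_rfl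
  have hlb := h.lbar_le hZ le_rfl fun s hs => (hΛ s hs.le).le
  have hD := sqrt_le_scale hT hδ
  have h2 : 6 * (Fintype.card X * Fintype.card A) * (S.run T δ f T).lbar * Real.sqrt T
      ≤ 6 * (Fintype.card X * Fintype.card A) * (1 + Z) * scale T δ := by
    have := S.lbar_nonneg (T := T) (δ := δ) (f := f) T
    gcongr
  rw [Nat.Ico_zero_eq_range] at h1
  refine le_trans ?_ (add_le_add (h1.trans h2) (mul_le_mul_of_nonneg_left hQ
    (by linarith : 0 ≤ 1 + Z)))
  rw [LoopFree.primalRegret, Finset.mul_sum, ← Finset.sum_add_distrib]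
  refine Finset.sum_le_sum fun t ht => ?_
  have htT := Finset.mem_range.1 ht
  have hl : ∀ x a, |S.lossAt T δ f t x a| ≤ 1 + Z := fun x a =>
    (h.abs_lossAt_le htT x a).trans (by linarith [hΛ t htT.le])
  have h3 := (abs_le.1 (abs_dot_le hl ((S.run T δ f t).q - S.played P T δ f t))).1
  rw [dot_sub] at h3
  simp only [PiLp.sub_apply] at h3
  change dot (S.lossAt T δ f t) _ ≤ _
  rw [dot_sub, dot_sub]
  linarith

end LoopFree.Regular

/-- The constant in the final bounds. -/
noncomputable def finalConst (X A : Type*) [Fintype X] [Fintype A] (L m : ℕ) : ℝ :=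
  5 * L + 12 * (Fintype.card X * Fintype.card A) + 3 * errQConst X A L
    + 100 * m * (Fintype.card X * Fintype.card A)

theorem finalConst_pos (S : LoopFree X L) : 0 < finalConst X A L m := by
  have hL : (0 : ℝ) < L := by exact_mod_cast S.horizon_pos
  have := errQConst_nonneg (X := X) (A := A) (L := L)
  unfold finalConst
  positivity

theorem LoopFree.Regular.order_le (h : S.Regular P T δ f) (hm : 0 < m) (hT : (20 : ℝ) ≤ T)
    (hδ : δ ∈ Set.Ioo (0 : ℝ) 1) {Z : ℝ} (hZ : 1 ≤ Z)
    (hΛ : ∀ t ≤ T, S.lamSum T δ f t < Z)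
    (hQ : ∑ t ∈ Finset.range T, ∑ x, ∑ a,
      |(S.run T δ f t).q (x, a) - S.played P T δ f t (x, a)| ≤ errQ X A L T δ)
    {q : Vec X A} (hq : q ∈ S.Delta {P}) :
    errR L T δ + Z * errG L T δ + Z * errQ X A L T δ + S.dualRegret T δ f 0
        + S.primalRegret P T δ f q
      ≤ finalConst X A L m * (Z * scale T δ) ∧
    1 / dualRate X A m T δ * Z + errQ X A L T δ ≤ finalConst X A L m * (Z * scale T δ) := by
  have : Nonempty X := ⟨S.init⟩
  have h1 := h.dualRegret_zero_le hm hT hδ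
  have h2 := h.primalRegret_le hT hδ (by linarith) hΛ hQ hq
  have h3 := errR_le (T := T) (δ := δ) L hT hδ
  have h4 := mul_le_mul_of_nonneg_left (errG_le L T δ) (by linarith : 0 ≤ Z)
  have h5 := errQ_le (X := X) (A := A) (L := L) hT hδ
  have h6 := mul_le_mul_of_nonneg_left h5 (by linarith : 0 ≤ Z)
  have hη := S.dualRate_mul (A := A) hm hT hδ
  have hη0 := S.dualRate_pos (A := A) hm hT hδ
  have hD := one_le_scale hT hδ
  have hC := errQConst_nonneg (X := X) (A := A) (L := L)
  have hη' : 1 / dualRate X A m T δ = 100 * m * (Fintype.card X * Fintype.card A) * scale T δ := by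
    rw [eq_comm, eq_div_iff hη0.ne', mul_comm]
    exact hη
  rw [hη']
  unfold finalConst
  set D := scale T δ
  set XA : ℝ := Fintype.card X * Fintype.card A with hXA
  set C := errQConst X A L
  have hXA0 : 0 ≤ XA := by positivity
  have hm0 : (0 : ℝ) ≤ m := by positivity
  have hZD : D ≤ Z * D := by nlinarith
  have a1 : L * D ≤ L * (Z * D) := by gcongr
  have a2 : C * D ≤ C * (Z * D) := by gcongr
  have a3 : XA * D ≤ XA * (Z * D) := by gcongr
  have p1 : 0 ≤ (L : ℝ) * (Z * D) := by positivity
  have p2 : 0 ≤ C * (Z * D) := by positivity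
  have p3 : 0 ≤ XA * (Z * D) := by positivity
  have p4 : 0 ≤ m * XA * (Z * D) := by positivity
  constructor <;> nlinarith

end Order

end CMDP

namespace CMDP

open scoped ENNReal

/-! ### Exponential supermartingales -/

section Concentration

variable {Ω : Type*} {m m' : MeasurableSpace Ω} {mΩ : MeasurableSpace Ω} {μ : Measure Ω}

/-- `E[exp Z | m] ≤ 1`, tested against the nonnegative `m`-measurable functions. -/
def CondExpLeOne (μ : Measure Ω) (m : MeasurableSpace Ω) (Z : Ω → ℝ) : Prop :=
  ∀ W : Ω → ℝ≥0∞, Measurable[m] W →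
    ∫⁻ ω, W ω * ENNReal.ofReal (Real.exp (Z ω)) ∂μ ≤ ∫⁻ ω, W ω ∂μ

/-- The exponential of the earlier increments is an admissible weight `W`, so one increment at a
time can be removed. -/
theorem lintegral_exp_sum_le_one [IsProbabilityMeasure μ] {ℱ : Filtration ℕ mΩ} {T : ℕ}
    {Z : ℕ → Ω → ℝ} (hm : ∀ t < T, Measurable[ℱ (t + 1)] (Z t))
    (hZ : ∀ t < T, CondExpLeOne μ (ℱ t) (Z t)) {n : ℕ} (hn : n ≤ T) :
    ∫⁻ ω, ENNReal.ofReal (Real.exp (∑ t ∈ Finset.range n, Z t ω)) ∂μ ≤ 1 := by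
  induction n with
  | zero => simp
  | succ n ih =>
    have hW : Measurable[ℱ n]
        fun ω => ENNReal.ofReal (Real.exp (∑ t ∈ Finset.range n, Z t ω)) := by
      have hs : Measurable[ℱ n] fun ω => ∑ t ∈ Finset.range n, Z t ω :=
        Finset.measurable_sum _ fun t ht => (hm t (by
          have := Finset.mem_range.1 ht
          omega)).mono (ℱ.mono (Finset.mem_range.1 ht)) le_rfl
      exact ENNReal.measurable_ofReal.comp (Real.measurable_exp.comp hs)
    refine le_trans (le_of_eq ?_) ((hZ n (by omega) _ hW).trans (ih (by omega)))
    refine lintegral_congr fun ω => ?_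
    rw [Finset.sum_range_succ, Real.exp_add, ENNReal.ofReal_mul (Real.exp_nonneg _)]

theorem measure_le_sum_le [IsProbabilityMeasure μ] {ℱ : Filtration ℕ mΩ} {T : ℕ}
    {Z : ℕ → Ω → ℝ} (hm : ∀ t < T, Measurable[ℱ (t + 1)] (Z t))
    (hZ : ∀ t < T, CondExpLeOne μ (ℱ t) (Z t)) {n : ℕ} (hn : n ≤ T) (ε : ℝ) :
    μ {ω | ε ≤ ∑ t ∈ Finset.range n, Z t ω} ≤ ENNReal.ofReal (Real.exp (-ε)) := by
  have hmeas : Measurable fun ω => ENNReal.ofReal (Real.exp (∑ t ∈ Finset.range n, Z t ω)) := by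
    have hs : Measurable fun ω => ∑ t ∈ Finset.range n, Z t ω :=
      Finset.measurable_sum _ fun t ht => (hm t (by
        have := Finset.mem_range.1 ht
        omega)).mono (ℱ.le _) le_rfl
    exact ENNReal.measurable_ofReal.comp (Real.measurable_exp.comp hs)
  have h1 := meas_ge_le_lintegral_div (μ := μ) hmeas.aemeasurable
    (ε := ENNReal.ofReal (Real.exp ε)) (by simp [Real.exp_pos]) ENNReal.ofReal_ne_top
  have h2 : {ω | ε ≤ ∑ t ∈ Finset.range n, Z t ω} ⊆ {ω | ENNReal.ofReal (Real.exp ε)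
      ≤ ENNReal.ofReal (Real.exp (∑ t ∈ Finset.range n, Z t ω))} := fun ω hω =>
    ENNReal.ofReal_le_ofReal (Real.exp_le_exp.2 hω)
  refine (measure_mono h2).trans (h1.trans ?_)
  rw [Real.exp_neg, ENNReal.ofReal_inv_of_pos (Real.exp_pos ε), div_eq_mul_inv]
  calc _ ≤ 1 * (ENNReal.ofReal (Real.exp ε))⁻¹ := by
        gcongr
        exact lintegral_exp_sum_le_one hm hZ hn
    _ = _ := one_mul _

/-- The Azuma-Hoeffding inequality in terms of conditional exponential moments. -/
theorem measure_le_sum_le_of_width [IsProbabilityMeasure μ] {ℱ : Filtration ℕ mΩ} {T : ℕ}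
    {Y : ℕ → Ω → ℝ} {w : ℝ} (hw : 0 < w) (hm : ∀ t < T, Measurable[ℱ (t + 1)] (Y t))
    (hY : ∀ t < T, ∀ θ : ℝ,
      CondExpLeOne μ (ℱ t) (fun ω => θ * Y t ω - θ ^ 2 * w ^ 2 / 8))
    {n : ℕ} (hn : n ≤ T) (hT : 0 < T) {c : ℝ} (hc : 1 ≤ c) :
    μ {ω | w * Real.sqrt (T * Real.log c / 2) < ∑ t ∈ Finset.range n, Y t ω}
      ≤ ENNReal.ofReal (1 / c) := by
  have hT' : (0 : ℝ) < T := by exact_mod_cast hT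
  have hlog : 0 ≤ Real.log c := Real.log_nonneg hc
  set s := Real.sqrt (T * Real.log c / 2) with hs
  have hs2 : s ^ 2 = T * Real.log c / 2 := Real.sq_sqrt (by positivity)
  have hs0 : 0 ≤ s := Real.sqrt_nonneg _
  -- The maximizer of θws - Tθ²w²/8; the maximum 2s²/T equals ln c.
  set θ : ℝ := 4 * s / (T * w) with hθ
  have hθ0 : 0 ≤ θ := by positivity
  have h1 := measure_le_sum_le (μ := μ) (ℱ := ℱ) (T := T)
    (Z := fun t ω => θ * Y t ω - θ ^ 2 * w ^ 2 / 8)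
    (fun t ht => ((hm t ht).const_mul θ).sub_const _) (fun t ht => hY t ht θ) hn (Real.log c)
  rw [Real.exp_neg, Real.exp_log (by linarith), ← one_div] at h1
  refine (measure_mono fun ω hω => ?_).trans h1
  simp only [Set.mem_ofPred_eq] at hω ⊢
  rw [Finset.sum_sub_distrib, ← Finset.mul_sum, Finset.sum_const, Finset.card_range, nsmul_eq_mul]
  have hn' : (n : ℝ) ≤ T := by exact_mod_cast hn
  have h2 : θ * (w * s) ≤ θ * ∑ t ∈ Finset.range n, Y t ω :=
    mul_le_mul_of_nonneg_left hω.le hθ0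
  have h3 : n * (θ ^ 2 * w ^ 2 / 8) ≤ T * (θ ^ 2 * w ^ 2 / 8) := by gcongr
  have h4 : θ * (w * s) - T * (θ ^ 2 * w ^ 2 / 8) = Real.log c := by
    have e1 : θ * (w * s) = 4 * s ^ 2 / T := by
      rw [hθ]
      field_simp
    have e2 : T * (θ ^ 2 * w ^ 2 / 8) = 2 * s ^ 2 / T := by
      rw [hθ]
      field_simp
      ring
    rw [e1, e2, hs2]
    field_simp
    ring
  linarith

/-! ### Hoeffding's lemma -/

theorem lintegral_exp_sub_le_one {E : Type*} [MeasurableSpace E] {ν : Measure E}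
    [IsProbabilityMeasure ν] {g : E → ℝ} (hg : AEMeasurable g ν) {a b : ℝ}
    (hab : ∀ᵐ y ∂ν, g y ∈ Set.Icc a b) (θ : ℝ) :
    ∫⁻ y, ENNReal.ofReal (Real.exp (θ * (g y - ∫ z, g z ∂ν) - θ ^ 2 * (b - a) ^ 2 / 8)) ∂ν
      ≤ 1 := by
  have h := hasSubgaussianMGF_of_mem_Icc hg hab
  have h1 := h.mgf_le θ
  have e : ((((‖b - a‖₊ / 2) ^ 2 : NNReal)) : ℝ) * θ ^ 2 / 2 = θ ^ 2 * (b - a) ^ 2 / 8 := by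
    push_cast
    rw [Real.norm_eq_abs, div_pow, sq_abs]
    ring
  rw [e] at h1
  have h2 : ∀ y, Real.exp (θ * (g y - ∫ z, g z ∂ν) - θ ^ 2 * (b - a) ^ 2 / 8)
      = Real.exp (θ * (g y - ∫ z, g z ∂ν)) * Real.exp (-(θ ^ 2 * (b - a) ^ 2 / 8)) := by
    intro y
    rw [← Real.exp_add]
    ring_nf
  simp_rw [h2]
  rw [← ofReal_integral_eq_lintegral_ofReal ((h.integrable_exp_mul θ).mul_const _)
    (Filter.Eventually.of_forall fun y => by positivity), integral_mul_const]
  rw [← ENNReal.ofReal_one]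
  refine ENNReal.ofReal_le_ofReal ?_
  calc _ ≤ Real.exp (θ ^ 2 * (b - a) ^ 2 / 8) * Real.exp (-(θ ^ 2 * (b - a) ^ 2 / 8)) :=
        mul_le_mul_of_nonneg_right h1 (Real.exp_nonneg _)
    _ = 1 := by rw [← Real.exp_add]; simp

/-- Hoeffding's lemma for the discrete measure with weights `p`, needed because trajectory laws are
given as finite sums. -/
theorem sum_mul_exp_sub_le_one {I : Type*} [Fintype I] {p : I → ℝ} (hp : ∀ i, 0 ≤ p i)
    (hp1 : ∑ i, p i = 1) {F : I → ℝ} {a b : ℝ} (hF : ∀ i, F i ∈ Set.Icc a b) (θ : ℝ) :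
    ∑ i, p i * Real.exp (θ * (F i - ∑ j, p j * F j) - θ ^ 2 * (b - a) ^ 2 / 8) ≤ 1 := by
  let _ : MeasurableSpace I := ⊤
  set ν : Measure I := ∑ i, ENNReal.ofReal (p i) • Measure.dirac i with hν
  have hl : ∀ G : I → ℝ≥0∞, ∫⁻ y, G y ∂ν = ∑ i, ENNReal.ofReal (p i) * G i := by
    intro G
    rw [hν, lintegral_finsetSum_measure]
    refine Finset.sum_congr rfl fun i _ => ?_
    rw [lintegral_smul_measure, lintegral_dirac, smul_eq_mul]
  have hν1 : IsProbabilityMeasure ν := by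
    constructor
    have := hl 1
    simp only [Pi.one_apply, lintegral_const, mul_one, one_mul] at this
    rw [this, ← ENNReal.ofReal_sum_of_nonneg fun i _ => hp i, hp1, ENNReal.ofReal_one]
  have hinteg : ∫ z, F z ∂ν = ∑ j, p j * F j := by
    rw [hν, integral_finsetSum_measure]
    · refine Finset.sum_congr rfl fun i _ => ?_
      rw [integral_smul_measure, integral_dirac, ENNReal.toReal_ofReal (hp i), smul_eq_mul]
    · intro i _
      exact (integrable_dirac (by simp)).smul_measure ENNReal.ofReal_ne_top
  have h := lintegral_exp_sub_le_one (ν := ν) (g := F) (measurable_from_top).aemeasurable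
    (Filter.Eventually.of_forall hF) θ
  rw [hl, hinteg] at h
  simp_rw [← ENNReal.ofReal_mul (hp _)] at h
  rw [← ENNReal.ofReal_sum_of_nonneg fun i _ => mul_nonneg (hp i) (Real.exp_nonneg _)] at h
  exact ENNReal.ofReal_le_one.1 h

/-! ### Independent and conditionally specified increments -/

theorem lintegral_mul_exp_le_of_indepFun [IsProbabilityMeasure μ] {Ω' E : Type*}
    [MeasurableSpace Ω'] [MeasurableSpace E] {U : Ω → Ω'} {Y : Ω → E} (hU : Measurable U)
    (hY : Measurable Y) (hind : IndepFun U Y μ) {Φ : Ω' × E → ℝ} (hΦ : Measurable Φ)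
    (h1 : ∀ u, ∫⁻ y, ENNReal.ofReal (Real.exp (Φ (u, y))) ∂(μ.map Y) ≤ 1)
    {W : Ω' → ℝ≥0∞} (hW : Measurable W) :
    ∫⁻ ω, W (U ω) * ENNReal.ofReal (Real.exp (Φ (U ω, Y ω))) ∂μ ≤ ∫⁻ ω, W (U ω) ∂μ := by
  have hYp : IsProbabilityMeasure (μ.map Y) := Measure.isProbabilityMeasure_map hY.aemeasurable
  have hprod := (indepFun_iff_map_prod_eq_prod_map_map hU.aemeasurable hY.aemeasurable).1 hind
  have hH : Measurable fun z : Ω' × E => W z.1 * ENNReal.ofReal (Real.exp (Φ z)) :=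
    (hW.comp measurable_fst).mul (ENNReal.measurable_ofReal.comp (Real.measurable_exp.comp hΦ))
  rw [← lintegral_map hH (hU.prodMk hY), hprod, lintegral_prod _ hH.aemeasurable,
    ← lintegral_map hW hU]
  refine lintegral_mono fun u => ?_
  have hsec : Measurable fun y => ENNReal.ofReal (Real.exp (Φ (u, y))) :=
    ENNReal.measurable_ofReal.comp (Real.measurable_exp.comp
      (hΦ.comp (measurable_const.prodMk measurable_id)))
  simp only
  rw [lintegral_const_mul _ hsec]
  exact mul_le_of_le_one_right zero_le (h1 u)

theorem CondExpLeOne.of_indep [IsProbabilityMeasure μ] {E : Type*} [MeasurableSpace E]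
    {ν : Measure E} {Y : Ω → E} (hm : m ≤ mΩ) (hY : Measurable Y)
    (hlaw : μ.map Y = ν) (hind : Indep (MeasurableSpace.comap Y inferInstance) m μ)
    {Φ : Ω × E → ℝ} (hΦ : Measurable[m.prod inferInstance] Φ)
    (h1 : ∀ ω, ∫⁻ y, ENNReal.ofReal (Real.exp (Φ (ω, y))) ∂ν ≤ 1) :
    CondExpLeOne μ m (fun ω => Φ (ω, Y ω)) := by
  intro W hW
  -- Independence of `Y` from `m` is independence of `Y` from the identity map into (Ω, m). Fubini
  -- then applies with the past itself as first coordinate.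
  have hindep : @IndepFun Ω Ω E mΩ m _ id Y μ := by
    have h := hind.symm
    rw [← @MeasurableSpace.comap_id Ω m] at h
    exact h
  subst hlaw
  exact @lintegral_mul_exp_le_of_indepFun Ω mΩ μ _ Ω E m _ id Y (measurable_id'' hm) hY hindep
    Φ hΦ h1 W hW

/-- The conditional law of the finitely valued variable `τ` given `m` is `κ`. -/
def HasCondLaw {I : Type*} (μ : Measure Ω) (m : MeasurableSpace Ω) (τ : Ω → I)
    (κ : I → Ω → ℝ) : Prop :=
  ∀ p, ∀ W : Ω → ℝ≥0∞, Measurable[m] W →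
    ∫⁻ ω in τ ⁻¹' {p}, W ω ∂μ = ∫⁻ ω, W ω * ENNReal.ofReal (κ p ω) ∂μ

theorem CondExpLeOne.of_hasCondLaw {I : Type*} [Fintype I] (hm : m ≤ mΩ)
    {τ : Ω → I} (hτ : ∀ p, MeasurableSet (τ ⁻¹' {p})) {κ : I → Ω → ℝ}
    (hκm : ∀ p, Measurable[m] (κ p)) (hlaw : HasCondLaw μ m τ κ) {F : I → Ω → ℝ}
    (hF : ∀ p, Measurable[m] (F p))
    (h1 : ∀ᵐ ω ∂μ, (∀ p, 0 ≤ κ p ω) ∧ ∑ p, κ p ω * Real.exp (F p ω) ≤ 1) :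
    CondExpLeOne μ m (fun ω => F (τ ω) ω) := by
  classical
  intro W hW
  have hWF : ∀ p, Measurable[m] fun ω => W ω * ENNReal.ofReal (Real.exp (F p ω)) := fun p =>
    hW.mul (ENNReal.measurable_ofReal.comp (Real.measurable_exp.comp (hF p)))
  have hprod : ∀ p, Measurable[mΩ] fun ω =>
      W ω * ENNReal.ofReal (Real.exp (F p ω)) * ENNReal.ofReal (κ p ω) := fun p =>
    ((hWF p).mono hm le_rfl).mul (ENNReal.measurable_ofReal.comp ((hκm p).mono hm le_rfl))
  have hsplit : ∀ ω, W ω * ENNReal.ofReal (Real.exp (F (τ ω) ω))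
      = ∑ p, (τ ⁻¹' {p}).indicator
        (fun ω => W ω * ENNReal.ofReal (Real.exp (F p ω))) ω := by
    intro ω
    rw [Finset.sum_eq_single (τ ω)]
    · simp
    · intro p _ hp
      refine Set.indicator_of_notMem ?_ _
      exact fun h => hp (Set.mem_singleton_iff.1 h).symm
    · simp
  simp_rw [hsplit]
  rw [lintegral_finsetSum _ fun p _ => ((hWF p).mono hm le_rfl).indicator (hτ p)]
  have h2 : ∀ p, ∫⁻ ω, (τ ⁻¹' {p}).indicator
      (fun ω => W ω * ENNReal.ofReal (Real.exp (F p ω))) ω ∂μ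
      = ∫⁻ ω, W ω * ENNReal.ofReal (Real.exp (F p ω)) * ENNReal.ofReal (κ p ω) ∂μ := by
    intro p
    rw [lintegral_indicator (hτ p), hlaw p _ (hWF p)]
  simp_rw [h2]
  rw [← lintegral_finsetSum _ fun p _ => hprod p]
  refine lintegral_mono_ae ?_
  filter_upwards [h1] with ω hω
  have e : ∑ p, W ω * ENNReal.ofReal (Real.exp (F p ω)) * ENNReal.ofReal (κ p ω)
      = W ω * ENNReal.ofReal (∑ p, κ p ω * Real.exp (F p ω)) := by
    rw [ENNReal.ofReal_sum_of_nonneg fun p _ => mul_nonneg (hω.1 p) (Real.exp_nonneg _),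
      Finset.mul_sum]
    refine Finset.sum_congr rfl fun p _ => ?_
    rw [ENNReal.ofReal_mul (hω.1 p)]
    ring
  rw [e]
  exact mul_le_of_le_one_right zero_le (ENNReal.ofReal_le_one.2 hω.2)

/-- The law is specified given the larger σ-algebra `m'`, which also contains the current rewards
and constraints. As κ is already `m`-measurable, the restriction of μ to {τ = p} and the measure κ_p
μ agree on `m`, hence integrate `m`-measurable weights equally. -/
theorem hasCondLaw_of_condExp [IsProbabilityMeasure μ] {I : Type*}
    (hmm : m ≤ m') (hm' : m' ≤ mΩ) {τ : Ω → I} (hτ : ∀ p, MeasurableSet (τ ⁻¹' {p}))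
    {κ : I → Ω → ℝ} (hκm : ∀ p, Measurable[m] (κ p))
    (h : ∀ p, μ⟦τ ⁻¹' {p} | m'⟧ =ᵐ[μ] κ p) : HasCondLaw μ m τ κ := by
  intro p W hW
  have hinteg : Integrable ((τ ⁻¹' {p}).indicator fun _ : Ω => (1 : ℝ)) μ :=
    (integrable_const 1).indicator (hτ p)
  have hκint : Integrable (κ p) μ := integrable_condExp.congr (h p)
  have hκ0 : 0 ≤ᵐ[μ] κ p := by
    have h0 : 0 ≤ᵐ[μ] μ⟦τ ⁻¹' {p} | m'⟧ := condExp_nonneg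
      (Filter.Eventually.of_forall fun ω => Set.indicator_nonneg (fun _ _ => zero_le_one) ω)
    filter_upwards [h0, h p] with ω h1 h2
    rwa [← h2]
  have hm := hmm.trans hm'
  have hmeas : (μ.restrict (τ ⁻¹' {p})).trim hm
      = (μ.withDensity fun ω => ENNReal.ofReal (κ p ω)).trim hm := by
    refine @Measure.ext Ω m _ _ fun s hs => ?_
    rw [trim_measurableSet_eq hm hs, trim_measurableSet_eq hm hs, Measure.restrict_apply (hm s hs),
      withDensity_apply _ (hm s hs),
      ← ofReal_integral_eq_lintegral_ofReal hκint.integrableOn (ae_restrict_of_ae hκ0),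
      ← setIntegral_congr_ae (g := κ p) (f := μ⟦τ ⁻¹' {p} | m'⟧) (hm s hs)
        ((h p).mono fun ω hω _ => hω),
      setIntegral_condExp hm' hinteg (hmm s hs),
      MeasureTheory.integral_indicator (hτ p)]
    rw [Measure.restrict_restrict (hτ p)]
    simp [Set.inter_comm]
  have hκ' : Measurable[mΩ] fun ω => ENNReal.ofReal (κ p ω) :=
    ENNReal.measurable_ofReal.comp ((hκm p).mono hm le_rfl)
  rw [← lintegral_trim hm hW, hmeas, lintegral_trim hm hW,
    lintegral_withDensity_eq_lintegral_mul₀ hκ'.aemeasurable (hW.mono hm le_rfl).aemeasurable]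
  refine lintegral_congr fun ω => ?_
  simp [mul_comm]

end Concentration

end CMDP

namespace CMDP

/-! ### Trajectories that respect the layers -/

section Valid

variable {X A : Type*} [Fintype X] [DecidableEq X] [Fintype A] [DecidableEq A] [Nonempty A]
  {L m : ℕ} {S : LoopFree X L} {P : X → A → X → ℝ} {T : ℕ} {δ : ℝ} {f : ℕ → Feedback X A L m}

theorem LoopFree.sum_run_M (t : ℕ) (x : X) (a : A) :
    ∑ x', (S.run T δ f t).M x a x' = (S.run T δ f t).N x a := by
  induction t with
  | zero => exact Finset.sum_const_zero
  | succ t ih =>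
    simp only [S.run_succ_N, S.run_succ_M, Finset.sum_add_distrib, ih, sum_moveCount]

theorem LoopFree.run_M_eq_zero (hf : ∀ t < T, ∀ k, S.layer ((f t).τ.1 k) = k) {t : ℕ}
    (ht : t ≤ T) {x x' : X} (hx : S.layer x' ≠ S.layer x + 1) (a : A) :
    (S.run T δ f t).M x a x' = 0 := by
  induction t with
  | zero => rfl
  | succ t ih => rw [S.run_succ_M, ih (by omega), moveCount_eq_zero (hf t ht) hx]

theorem LoopFree.run_N_final (hf : ∀ t < T, ∀ k, S.layer ((f t).τ.1 k) = k) {t : ℕ}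
    (ht : t ≤ T) {x : X} (hx : S.layer x = L) (a : A) : (S.run T δ f t).N x a = 0 := by
  induction t with
  | zero => rfl
  | succ t ih => rw [S.run_succ_N, ih (by omega), visitCount_final (hf t ht) hx]

theorem LoopFree.run_M_le_run_N (t : ℕ) (x : X) (a : A) (x' : X) :
    (S.run T δ f t).M x a x' ≤ (S.run T δ f t).N x a := by
  rw [← S.sum_run_M]
  exact Finset.single_le_sum (f := fun y => (S.run T δ f t).M x a y) (fun _ _ => Nat.zero_le _)
    (Finset.mem_univ x')

/-- The empirical frequencies, completed by `P` at unvisited pairs, lie in the set. This does not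
use the event that `P` does, so the learner's policies are genuine before that event is established;
its own proof requires them to be. -/
theorem LoopFree.confSet_run_nonempty (hP : S.IsTransition P) (hT : (20 : ℝ) ≤ T)
    (hδ : δ ∈ Set.Ioo (0 : ℝ) 1) (hf : ∀ t < T, ∀ k, S.layer ((f t).τ.1 k) = k) {t : ℕ}
    (ht : t ≤ T) : (S.confSet T δ (S.run T δ f t).N₀ (S.run T δ f t).M₀).Nonempty := by
  obtain ⟨s, hs, hN, hM⟩ := S.exists_epoch_start (T := T) (δ := δ) (f := f) t
  rw [hN, hM]
  set N := (S.run T δ f s).N with hNdef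
  set M := (S.run T δ f s).M with hMdef
  set Q : X → A → X → ℝ := fun x a x' =>
    if N x a = 0 then P x a x' else (M x a x' : ℝ) / N x a with hQ
  have hQT : S.IsTransition Q := by
    refine ⟨fun x a x' => ?_, fun x a x' hpos => ?_, fun x a hx => ?_⟩
    · simp only [hQ]
      split_ifs
      · exact hP.1 x a x'
      · positivity
    · by_contra hc
      simp only [hQ] at hpos
      split_ifs at hpos
      · rw [S.transition_eq_zero hP a hc] at hpos
        exact lt_irrefl _ hpos
      · rw [hMdef, LoopFree.run_M_eq_zero hf (hs.trans ht) hc] at hpos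
        simp at hpos
    · simp only [hQ]
      split_ifs with h0
      · exact hP.2.2 x a hx
      · rw [← Finset.sum_div, div_eq_one_iff_eq (by exact_mod_cast h0)]
        exact_mod_cast LoopFree.sum_run_M s x a
  refine ⟨Q, hQT, fun x a => ?_⟩
  by_cases h0 : N x a = 0
  · refine S.sum_abs_le_radius_of_eq_zero hT hδ hQT h0 fun x' => ?_
    have := LoopFree.run_M_le_run_N (S := S) (T := T) (δ := δ) (f := f) s x a x'
    rw [← hMdef, ← hNdef] at this
    omega
  · have h1 : (1 : ℝ) ≤ N x a := by exact_mod_cast Nat.one_le_iff_ne_zero.2 h0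
    have e : ∀ x', Q x a x' - (M x a x' : ℝ) / max 1 (N x a : ℝ) = 0 := by
      intro x'
      simp only [hQ]
      rw [if_neg h0, max_eq_right h1, sub_self]
    simp only [e, abs_zero, Finset.sum_const_zero]
    exact Real.sqrt_nonneg _

theorem LoopFree.isPolicy_inducedPolicy_run (hP : S.IsTransition P) (hT : (20 : ℝ) ≤ T)
    (hδ : δ ∈ Set.Ioo (0 : ℝ) 1) (hf : ∀ t < T, ∀ k, S.layer ((f t).τ.1 k) = k) {t : ℕ}
    (ht : t ≤ T) : IsPolicy (inducedPolicy (S.run T δ f t).q) := by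
  refine isPolicy_inducedPolicy ?_
  cases t with
  | zero => exact S.nonneg_of_mem_Delta (fun _ h => h.1) (S.initState_q_mem hT hδ hP)
  | succ t =>
    rw [S.run_succ_q]
    obtain ⟨Q, hQ⟩ := LoopFree.confSet_run_nonempty hP hT hδ hf ht
    have hπ : IsPolicy (inducedPolicy (0 : Vec X A)) := isPolicy_inducedPolicy (fun p => by simp)
    have hne : (S.Delta (S.confSet T δ (S.run T δ f (t + 1)).N₀
        (S.run T δ f (t + 1)).M₀)).Nonempty := ⟨_, _, hQ, _, hπ, rfl⟩
    exact S.nonneg_of_mem_Delta (fun _ h => h.1) (proj_spec hne (S.isClosed_Delta_confSet _ _ _ _)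
      (S.convex_Delta_confSet _ _ _ _) _).1

/-- A path of nonzero weight respects the layers, so each move occurs at most once and its count is
the indicator of the event defining `occ3`. -/
theorem LoopFree.sum_pathProb_mul_moveCount (hP : S.IsTransition P) (π : X → A → ℝ) (x : X)
    (a : A) (x' : X) :
    ∑ τ, S.pathProb P π τ * (moveCount τ x a x' : ℝ) = S.occ3 P π x a x' := by
  classical
  rw [LoopFree.occ3, Finset.sum_filter]
  refine Finset.sum_congr rfl fun τ _ => ?_
  by_cases h0 : S.pathProb P π τ = 0
  · simp [h0]
  · have hv := fun k => S.layer_of_pathWeight_ne_zero hP (n := L) h0 k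
    rw [moveCount_eq_ite hv]
    by_cases hV : S.Visits τ x a x'
    · rw [if_pos hV, if_pos (show ∃ _, _ from hV), Nat.cast_one, mul_one]
    · rw [if_neg hV, if_neg (show ¬∃ _, _ from hV), Nat.cast_zero, mul_zero]

theorem LoopFree.sum_pathProb_mul_visitCount (hP : S.IsTransition P) (π : X → A → ℝ) (x : X)
    (a : A) : ∑ τ, S.pathProb P π τ * (visitCount τ x a : ℝ) = S.occ P π (x, a) := by
  change _ = ∑ x', S.occ3 P π x a x'
  simp_rw [← LoopFree.sum_pathProb_mul_moveCount hP, ← sum_moveCount]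
  rw [Finset.sum_comm]
  push_cast
  simp_rw [Finset.mul_sum]

end Valid

/-! ### Measurability -/

section Measurability

variable {X A : Type*} [Fintype X] [DecidableEq X] [Fintype A] [DecidableEq A]
  {L k : ℕ} {Ω : Type*}

/-- Measurability of a random state of the algorithm. -/
structure MeasurableState (m : MeasurableSpace Ω) (s : Ω → State X A k) : Prop where
  q : Measurable[m] fun ω => (s ω).q
  lam : Measurable[m] fun ω => (s ω).lam
  lbar : Measurable[m] fun ω => (s ω).lbar
  counts : Measurable[m] fun ω => ((s ω).N, (s ω).M, (s ω).N₀, (s ω).M₀)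

theorem MeasurableState.mono {m m' : MeasurableSpace Ω} (hm : m ≤ m') {s : Ω → State X A k}
    (h : MeasurableState m s) : MeasurableState m' s :=
  ⟨h.q.mono hm le_rfl, h.lam.mono hm le_rfl, h.lbar.mono hm le_rfl, h.counts.mono hm le_rfl⟩

variable (S : LoopFree X L)

/-- The values of the counters. -/
abbrev Counters (X A : Type*) :=
  (X → A → ℕ) × (X → A → X → ℕ) × (X → A → ℕ) × (X → A → X → ℕ)

/-- The update of the counters, which does not depend on the rest of the state. -/
noncomputable def LoopFree.countStep (c : Counters X A) (τ : Traj X A L) : Counters X A :=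
  -- The horizon, confidence level, rewards and constraints are dummies: no counter reads them.
  let s : State X A 0 := S.step 0 0 ⟨0, 0, 0, c.1, c.2.1, c.2.2.1, c.2.2.2⟩ ⟨0, 0, τ⟩
  (s.N, s.M, s.N₀, s.M₀)

theorem LoopFree.counts_step (T : ℕ) (δ : ℝ) (s : State X A k) (f : Feedback X A L k) :
    ((S.step T δ s f).N, (S.step T δ s f).M, (S.step T δ s f).N₀, (S.step T δ s f).M₀)
      = S.countStep (s.N, s.M, s.N₀, s.M₀) f.τ := rfl

variable {S} [Nonempty A]

theorem measurable_apply_vec {ι : Type*} [Fintype ι] {m : MeasurableSpace Ω}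
    {q : Ω → EuclideanSpace ℝ ι}
    (hq : Measurable q) (i : ι) : Measurable fun ω => q ω i :=
  (measurable_pi_apply i).comp ((WithLp.measurable_ofLp 2 _).comp hq)

theorem measurable_viol {m : MeasurableSpace Ω} {G : Ω → X → A → Fin k → ℝ} (hG : Measurable G)
    {q : Ω → Vec X A} (hq : Measurable q) (i : Fin k) :
    Measurable fun ω => viol (G ω) (q ω) i := by
  unfold viol dot
  refine Finset.measurable_sum _ fun x _ => Finset.measurable_sum _ fun a _ => ?_
  have h1 : Measurable fun ω => G ω x a i :=
    (measurable_pi_apply i).comp ((measurable_pi_apply a).comp ((measurable_pi_apply x).comp hG))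
  exact h1.mul (measurable_apply_vec hq _)

theorem measurable_loss {m : MeasurableSpace Ω} {r : Ω → X → A → ℝ} (hr : Measurable r)
    {G : Ω → X → A → Fin k → ℝ} (hG : Measurable G) {lam : Ω → EuclideanSpace ℝ (Fin k)}
    (hlam : Measurable lam) (x : X) (a : A) :
    Measurable fun ω => loss (r ω) (G ω) (lam ω) x a := by
  unfold loss
  refine Measurable.sub (Finset.measurable_sum _ fun i _ => ?_) ?_
  · have h1 : Measurable fun ω => G ω x a i :=
      (measurable_pi_apply i).comp ((measurable_pi_apply a).comp ((measurable_pi_apply x).comp hG))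
    exact h1.mul (measurable_apply_vec hlam _)
  · exact (measurable_pi_apply a).comp ((measurable_pi_apply x).comp hr)

theorem measurable_comp_countable {C I D : Type*} [Countable C] [MeasurableSpace C]
    [MeasurableSingletonClass C] [Countable I] [MeasurableSpace D] {m : MeasurableSpace Ω}
    (g : C → I → D) {c : Ω → C} (hc : Measurable c) {τ : Ω → I}
    (hτ : ∀ p, MeasurableSet (τ ⁻¹' {p})) : Measurable fun ω => g (c ω) (τ ω) := by
  let _ : MeasurableSpace I := ⊤
  have hτ' : Measurable τ := measurable_to_countable' hτ
  have h : Measurable (Function.uncurry g) := measurable_of_countable _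
  exact h.comp (hc.prodMk hτ')

theorem measurable_comp_countable_prod {C E D : Type*} [Countable C] [MeasurableSpace C]
    [MeasurableSingletonClass C] [MeasurableSpace E] [MeasurableSpace D] {m : MeasurableSpace Ω}
    {g : C → E → D} (hg : ∀ b, Measurable (g b)) {c : Ω → C} (hc : Measurable c) {u : Ω → E}
    (hu : Measurable u) : Measurable fun ω => g (c ω) (u ω) := by
  have h : Measurable (Function.uncurry g) := measurable_from_prod_countable_right hg
  exact h.comp (hc.prodMk hu)

variable (S) in
theorem LoopFree.measurable_countStep {m : MeasurableSpace Ω} {c : Ω → Counters X A}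
    (hc : Measurable c) {τ : Ω → Traj X A L} (hτ : ∀ p, MeasurableSet (τ ⁻¹' {p})) :
    Measurable fun ω => S.countStep (c ω) (τ ω) :=
  measurable_comp_countable S.countStep hc hτ

variable (S) in
-- The random decision set depends only on the counters, which take countably many values, and for
-- each value the projection is measurable.
theorem LoopFree.measurable_proj_confSet (T : ℕ) (δ : ℝ) {m : MeasurableSpace Ω}
    {c : Ω → Counters X A} (hc : Measurable c) {u : Ω → Vec X A} (hu : Measurable u) :
    Measurable fun ω => proj (S.Delta (S.confSet T δ (c ω).2.2.1 (c ω).2.2.2)) (u ω) := by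
  let K : Counters X A → Set (Vec X A) := fun b => S.Delta (S.confSet T δ b.2.2.1 b.2.2.2)
  have hK : ∀ b, Measurable (proj (K b)) := fun b =>
    measurable_proj (S.isClosed_Delta_confSet T δ b.2.2.1 b.2.2.2)
      (S.convex_Delta_confSet T δ b.2.2.1 b.2.2.2)
  exact measurable_comp_countable_prod (g := fun b => proj (K b)) hK hc hu

theorem MeasurableState.step {m : MeasurableSpace Ω} {T : ℕ} {δ : ℝ} {s : Ω → State X A k}
    (hs : MeasurableState m s) {f : Ω → Feedback X A L k} (hr : Measurable fun ω => (f ω).r)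
    (hG : Measurable fun ω => (f ω).G)
    (hτ : ∀ p, MeasurableSet ((fun ω => (f ω).τ) ⁻¹' {p})) :
    MeasurableState m fun ω => S.step T δ (s ω) (f ω) := by
  have hcounts : Measurable fun ω => ((S.step T δ (s ω) (f ω)).N, (S.step T δ (s ω) (f ω)).M,
      (S.step T δ (s ω) (f ω)).N₀, (S.step T δ (s ω) (f ω)).M₀) := by
    simp_rw [S.counts_step]
    exact S.measurable_countStep hs.counts hτ
  have hℓ : Measurable fun ω => fun p : X × A => loss (f ω).r (f ω).G (s ω).lam p.1 p.2 :=
    measurable_pi_lambda _ fun p => measurable_loss hr hG hs.lam p.1 p.2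
  have hlbar : Measurable fun ω => (S.step T δ (s ω) (f ω)).lbar := hs.lbar.max hℓ.norm
  refine ⟨?_, ?_, hlbar, hcounts⟩
  · have hu : Measurable fun ω => (s ω).q -
        (1 / ((S.step T δ (s ω) (f ω)).lbar * primalC X A L * Real.sqrt T)) •
          (WithLp.toLp 2 fun p : X × A => loss (f ω).r (f ω).G (s ω).lam p.1 p.2 : Vec X A) := by
      have h1 : Measurable fun ω =>
          1 / ((S.step T δ (s ω) (f ω)).lbar * primalC X A L * Real.sqrt T) :=
        measurable_const.div ((hlbar.mul_const _).mul_const _)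
      have h2 : Measurable fun ω =>
          (WithLp.toLp 2 fun p : X × A => loss (f ω).r (f ω).G (s ω).lam p.1 p.2 : Vec X A) :=
        (WithLp.measurable_toLp 2 _).comp hℓ
      exact hs.q.sub (h1.smul h2)
    exact S.measurable_proj_confSet T δ hcounts hu
  · have hv : Measurable fun ω => (WithLp.toLp 2 fun i => viol (f ω).G (s ω).q i :
        EuclideanSpace ℝ (Fin k)) :=
      (WithLp.measurable_toLp 2 _).comp (measurable_pi_lambda _ fun i => measurable_viol hG hs.q i)
    exact (measurable_proj (isClosed_dualBox k T) (convex_dualBox k T)).comp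
      (hs.lam.add (hv.const_smul (dualRate X A k T δ)))

theorem LoopFree.IsInteraction.measurableState_run {mΩ : MeasurableSpace Ω} {μ : Measure Ω}
    {ℱ : Filtration ℕ mΩ} {P : X → A → X → ℝ} {T : ℕ} {δ : ℝ}
    {r : ℕ → Ω → X → A → ℝ} {G : ℕ → Ω → X → A → Fin k → ℝ} {τ : ℕ → Ω → Traj X A L}
    (h : S.IsInteraction μ ℱ P T δ r G τ) {t : ℕ} (ht : t ≤ T) :
    MeasurableState (ℱ t) fun ω => S.run T δ (feedback r G τ ω) t := by
  induction t with
  | zero =>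
    exact ⟨measurable_const, measurable_const, measurable_const,
      measurable_const (a := ((S.initState (A := A) (m := k)).N, (S.initState (A := A) (m := k)).M,
        (S.initState (A := A) (m := k)).N₀, (S.initState (A := A) (m := k)).M₀))⟩
  | succ t ih =>
    exact ((ih (by omega)).mono (ℱ.mono (Nat.le_succ t))).step
      (f := fun ω => feedback r G τ ω t) (h.r_meas t ht) (h.G_meas t ht) (h.τ_meas t ht)

theorem measurable_inducedPolicy (x : X) (a : A) :
    Measurable fun q : Vec X A => inducedPolicy q x a := by
  unfold inducedPolicy
  have hs : Measurable fun q : Vec X A => ∑ b, q (x, b) :=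
    Finset.measurable_sum _ fun b _ => measurable_apply_vec measurable_id _
  exact Measurable.ite (hs (measurableSet_singleton 0)) measurable_const
    ((measurable_apply_vec measurable_id _).div hs)

theorem LoopFree.measurable_pathProb (P : X → A → X → ℝ) (p : Traj X A L) :
    Measurable fun q : Vec X A => S.pathProb P (inducedPolicy q) p := by
  unfold LoopFree.pathProb
  split_ifs
  · exact Finset.measurable_prod _ fun j _ => (measurable_inducedPolicy _ _).mul_const _
  · exact measurable_const

theorem LoopFree.measurable_occ (P : X → A → X → ℝ) (p : X × A) :
    Measurable fun q : Vec X A => S.occ P (inducedPolicy q) p := by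
  change Measurable fun q : Vec X A => ∑ x', S.occ3 P (inducedPolicy q) p.1 p.2 x'
  unfold LoopFree.occ3
  exact Finset.measurable_sum _ fun x' _ => Finset.measurable_sum _ fun τ _ =>
    S.measurable_pathProb P τ

end Measurability

end CMDP

namespace CMDP

open scoped ENNReal

/-! ### The law of the trajectories -/

section TrajectoryLaw

variable {X A : Type*} [Fintype X] [DecidableEq X] [Fintype A] [DecidableEq A] [Nonempty A]
  {L k : ℕ} {S : LoopFree X L} {Ω : Type*} {mΩ : MeasurableSpace Ω} {μ : Measure Ω}
  [IsProbabilityMeasure μ] {ℱ : Filtration ℕ mΩ} {P : X → A → X → ℝ} {T : ℕ} {δ : ℝ}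
  {r : ℕ → Ω → X → A → ℝ} {G : ℕ → Ω → X → A → Fin k → ℝ} {τ : ℕ → Ω → Traj X A L}

omit [Nonempty A] in
theorem measurable_bonus_counters (T : ℕ) (δ : ℝ) {m : MeasurableSpace Ω} {c : Ω → Counters X A}
    (hc : Measurable c) (x : X) (a : A) : Measurable fun ω => S.bonus T δ (c ω).2.2.1 x a := by
  have h : Measurable fun N : X → A → ℕ => S.bonus T δ N x a := measurable_of_countable _
  exact h.comp (measurable_fst.comp (measurable_snd.comp (measurable_snd.comp hc)))

namespace LoopFree.IsInteraction

variable (h : S.IsInteraction μ ℱ P T δ r G τ)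

include h

theorem measurable_pathProb_run {t : ℕ} (ht : t ≤ T) (p : Traj X A L) :
    Measurable[ℱ t] fun ω =>
      S.pathProb P (inducedPolicy (S.run T δ (feedback r G τ ω) t).q) p :=
  (S.measurable_pathProb P p).comp (h.measurableState_run ht).q

theorem measurableSet_traj {t : ℕ} (ht : t < T) (p : Traj X A L) :
    MeasurableSet (τ t ⁻¹' {p}) :=
  ℱ.le _ _ (h.τ_meas t ht p)

theorem hasCondLaw {t : ℕ} (ht : t < T) : HasCondLaw μ (ℱ t) (τ t) fun p ω =>
    S.pathProb P (inducedPolicy (S.run T δ (feedback r G τ ω) t).q) p := by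
  refine hasCondLaw_of_condExp (m' := ℱ t ⊔ MeasurableSpace.comap (r t) inferInstance ⊔
    MeasurableSpace.comap (G t) inferInstance) (le_sup_left.trans le_sup_left) ?_
    (h.measurableSet_traj ht) (h.measurable_pathProb_run ht.le) (h.τ_law t ht)
  refine sup_le (sup_le (ℱ.le t) ?_) ?_
  · exact ((h.r_meas t ht).mono (ℱ.le _) le_rfl).comap_le
  · exact ((h.G_meas t ht).mono (ℱ.le _) le_rfl).comap_le

/-- A path that violates the layers has probability 0 under every policy, and there are finitely
many paths. -/
theorem ae_layer (hP : S.IsTransition P) :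
    ∀ᵐ ω ∂μ, ∀ t < T, ∀ j, S.layer ((τ t ω).1 j) = j := by
  refine ae_all_iff.2 fun t => ?_
  by_cases ht : t < T
  · have h1 : ∀ᵐ ω ∂μ, ∀ p : Traj X A L, (¬∀ j, S.layer (p.1 j) = j) → τ t ω ≠ p := by
      refine ae_all_iff.2 fun p => ?_
      by_cases hp : ∀ j, S.layer (p.1 j) = j
      · exact Filter.Eventually.of_forall fun ω hc => absurd hp hc
      · have h2 := h.hasCondLaw ht p (fun _ => 1) measurable_const
        have h3 : ∀ π : X → A → ℝ, S.pathProb P π p = 0 := by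
          intro π
          by_contra hc
          exact hp fun j => S.layer_of_pathWeight_ne_zero hP (n := L) hc j
        simp only [h3, ENNReal.ofReal_zero, mul_zero, lintegral_const, zero_mul, one_mul,
          Measure.restrict_apply MeasurableSet.univ, Set.univ_inter] at h2
        rw [ae_iff]
        refine measure_mono_null (fun ω hω => ?_) h2
        simp only [Set.mem_ofPred_eq, not_forall, not_not] at hω
        obtain ⟨_, e⟩ := hω
        exact e
    filter_upwards [h1] with ω hω _
    by_contra hc
    exact hω (τ t ω) hc rfl
  · exact Filter.Eventually.of_forall fun ω hc => absurd hc ht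

theorem ae_isPolicy (hP : S.IsTransition P) (hT : (20 : ℝ) ≤ T) (hδ : δ ∈ Set.Ioo (0 : ℝ) 1) :
    ∀ᵐ ω ∂μ, ∀ t ≤ T, IsPolicy (inducedPolicy (S.run T δ (feedback r G τ ω) t).q) := by
  filter_upwards [h.ae_layer hP] with ω hω t ht
  exact LoopFree.isPolicy_inducedPolicy_run hP hT hδ hω ht

theorem condExpLeOne (hP : S.IsTransition P) (hT : (20 : ℝ) ≤ T) (hδ : δ ∈ Set.Ioo (0 : ℝ) 1)
    {t : ℕ} (ht : t < T) {F : Traj X A L → Ω → ℝ} (hF : ∀ p, Measurable[ℱ t] (F p))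
    (h1 : ∀ ω (π : X → A → ℝ), π = inducedPolicy (S.run T δ (feedback r G τ ω) t).q →
      IsPolicy π → ∑ p, S.pathProb P π p * Real.exp (F p ω) ≤ 1) :
    CondExpLeOne μ (ℱ t) (fun ω => F (τ t ω) ω) := by
  refine CondExpLeOne.of_hasCondLaw (ℱ.le t) (h.measurableSet_traj ht)
    (h.measurable_pathProb_run ht.le) (h.hasCondLaw ht) hF ?_
  filter_upwards [h.ae_isPolicy hP hT hδ] with ω hω
  exact ⟨fun p => S.pathProb_nonneg hP (hω t ht.le) p, h1 ω _ rfl (hω t ht.le)⟩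

theorem measurable_comp_traj {t : ℕ} (ht : t < T) {F : Traj X A L → Ω → ℝ}
    (hF : ∀ p, Measurable[ℱ t] (F p)) : Measurable[ℱ (t + 1)] fun ω => F (τ t ω) ω := by
  let _ : MeasurableSpace (Traj X A L) := ⊤
  have hτ' : Measurable[ℱ (t + 1)] (τ t) :=
    @measurable_to_countable' _ _ _ _ (ℱ (t + 1)) _ (h.τ_meas t ht)
  exact @measurable_comp_countable_prod Ω (Traj X A L) Ω ℝ _ _ _ (ℱ (t + 1)) _ (ℱ (t + 1)) F
    (fun p => (hF p).mono (ℱ.mono (Nat.le_succ t)) le_rfl) (τ t) hτ' id measurable_id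

/-! ### Concentration of the visits -/

theorem measurable_bonus {t : ℕ} (ht : t ≤ T) (x : X) (a : A) : Measurable[ℱ t] fun ω =>
    S.bonus T δ (S.run T δ (feedback r G τ ω) t).N₀ x a := by
  exact measurable_bonus_counters T δ (h.measurableState_run ht).counts x a

theorem measurable_played {t : ℕ} (ht : t ≤ T) (p : X × A) : Measurable[ℱ t] fun ω =>
    S.played P T δ (feedback r G τ ω) t p :=
  (S.measurable_occ P p).comp (h.measurableState_run ht).q

/-- The bonuses are fixed before the episode, and the expected visit counts are the played occupancy
vector, so the differences form a martingale. The bonus collected along a path lies in [0, 2L],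
which gives the width. -/
theorem measure_visits_le (hP : S.IsTransition P) (hT : (20 : ℝ) ≤ T)
    (hδ : δ ∈ Set.Ioo (0 : ℝ) 1) :
    μ {ω | ¬∑ t ∈ Finset.range T, ∑ x, ∑ a,
      (S.played P T δ (feedback r G τ ω) t (x, a) - visitCount (feedback r G τ ω t).τ x a) *
        S.bonus T δ (S.run T δ (feedback r G τ ω) t).N₀ x a ≤ L * Real.sqrt (2 * T * Real.log (1 / δ))}
      ≤ ENNReal.ofReal δ := by
  have hL : (0 : ℝ) < L := by exact_mod_cast S.horizon_pos
  set F : ℕ → Traj X A L → Ω → ℝ := fun t p ω => ∑ x, ∑ a,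
      (S.played P T δ (feedback r G τ ω) t (x, a) - visitCount p x a) *
        S.bonus T δ (S.run T δ (feedback r G τ ω) t).N₀ x a with hFdef
  have hF : ∀ t < T, ∀ p, Measurable[ℱ t] (F t p) := fun t ht p =>
    Finset.measurable_sum _ fun x _ => Finset.measurable_sum _ fun a _ =>
      ((h.measurable_played ht.le (x, a)).sub_const _).mul (h.measurable_bonus ht.le x a)
  have key := measure_le_sum_le_of_width (μ := μ) (ℱ := ℱ) (T := T)
    (Y := fun t ω => F t (τ t ω) ω) (w := 2 * L) (by positivity)
    (fun t ht => h.measurable_comp_traj ht (hF t ht)) ?_ le_rfl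
    (by
      have : (0 : ℝ) < T := by linarith
      exact_mod_cast this) (c := 1 / δ) (by rw [le_div_iff₀ hδ.1]; linarith [hδ.2])
  · have e : (2 * L : ℝ) * Real.sqrt (T * Real.log (1 / δ) / 2)
        = L * Real.sqrt (2 * T * Real.log (1 / δ)) := by
      have : 2 * T * Real.log (1 / δ) = 2 ^ 2 * (T * Real.log (1 / δ) / 2) := by ring
      rw [this, Real.sqrt_mul (by positivity), Real.sqrt_sq (by norm_num)]
      ring
    rw [one_div_one_div, e] at key
    refine (measure_mono fun ω hω => ?_).trans key
    exact not_le.1 hω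
  · intro t ht θ
    refine h.condExpLeOne hP hT hδ ht
      (F := fun p ω => θ * F t p ω - θ ^ 2 * (2 * (L : ℝ)) ^ 2 / 8)
      (fun p => ((hF t ht p).const_mul θ).sub_const _) ?_
    intro ω π hπe hπ
    set b := S.bonus T δ (S.run T δ (feedback r G τ ω) t).N₀ with hb
    have h2 : ∀ p : Traj X A L, -∑ x, ∑ a, (visitCount p x a : ℝ) * b x a
        ∈ Set.Icc (-(2 * L : ℝ)) 0 := by
      intro p
      rw [sum_sum_visitCount_comm]
      have h3 : ∑ j : Fin L, b (p.1 j.castSucc) (p.2 j) ≤ ∑ _j : Fin L, (2 : ℝ) :=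
        Finset.sum_le_sum fun j _ => min_le_left _ _
      have h4 : 0 ≤ ∑ j : Fin L, b (p.1 j.castSucc) (p.2 j) :=
        Finset.sum_nonneg fun j _ => LoopFree.bonus_nonneg _ _ _
      rw [Finset.sum_const, Finset.card_univ, Fintype.card_fin, nsmul_eq_mul] at h3
      exact ⟨by linarith, by linarith⟩
    have h5 := sum_mul_exp_sub_le_one (fun p => S.pathProb_nonneg hP hπ p) (S.sum_pathProb hP hπ)
      h2 θ
    have h6 : ∑ p, S.pathProb P π p * -∑ x, ∑ a, (visitCount p x a : ℝ) * b x a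
        = -∑ x, ∑ a, S.occ P π (x, a) * b x a := by
      simp_rw [← LoopFree.sum_pathProb_mul_visitCount hP, mul_neg, Finset.sum_neg_distrib,
        Finset.mul_sum, Finset.sum_mul]
      rw [Finset.sum_comm]
      congr 1
      refine Finset.sum_congr rfl fun x _ => ?_
      rw [Finset.sum_comm]
      refine Finset.sum_congr rfl fun a _ => Finset.sum_congr rfl fun p _ => ?_
      ring
    have h7 : ∀ p, F t p ω = -(∑ x, ∑ a, (visitCount p x a : ℝ) * b x a)
        - ∑ p, S.pathProb P π p * -∑ x, ∑ a, (visitCount p x a : ℝ) * b x a := by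
      intro p
      rw [h6, hFdef]
      simp only [sub_mul, Finset.sum_sub_distrib, LoopFree.played, ← hπe, ← hb]
      ring
    simp_rw [h7]
    rw [zero_sub, neg_neg] at h5
    exact h5

end LoopFree.IsInteraction

end TrajectoryLaw

end CMDP

namespace CMDP

open scoped ENNReal

/-! ### The confidence sets contain the true transition function -/

section Confidence

/-- At most one summand is present, so the exponential is affine in the counts and its expectation
requires only expected counts. -/
theorem exp_sum_natCast_mul {I : Type*} [Fintype I] {n : I → ℕ} (hn : ∑ i, n i ≤ 1) (c : I → ℝ) :
    Real.exp (∑ i, (n i : ℝ) * c i) = 1 + ∑ i, (n i : ℝ) * (Real.exp (c i) - 1) := by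
  classical
  by_cases h0 : ∀ i, n i = 0
  · simp [h0]
  · push Not at h0
    obtain ⟨i, hi⟩ := h0
    have h1 := Finset.add_sum_erase Finset.univ n (Finset.mem_univ i)
    have h2 : ∑ j ∈ Finset.univ.erase i, n j = 0 := by omega
    have hi1 : n i = 1 := by omega
    have h3 : ∀ j, j ≠ i → n j = 0 := fun j hj =>
      Finset.sum_eq_zero_iff.1 h2 j (Finset.mem_erase.2 ⟨hj, Finset.mem_univ j⟩)
    rw [Finset.sum_eq_single i (fun j _ hj => by simp [h3 j hj]) (by simp),
      Finset.sum_eq_single i (fun j _ hj => by simp [h3 j hj]) (by simp), hi1]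
    simp

/-- The sets that test the deviation of a distribution on `s` from its mean. -/
def testSets {X : Type*} [DecidableEq X] (s : Finset X) : Finset (Finset X) :=
  s.powerset.filter fun B => B ≠ ∅ ∧ B ≠ s

/-- A test on `s` will fail with probability at most y^|s|, and fewer than 2^|s| tests are made, so
their union costs (2y)^|s| ≤ 4y² ≤ y once |s| ≥ 2. Smaller layers require no test. -/
theorem card_testSets_mul_pow_le {X : Type*} [DecidableEq X] (s : Finset X) {y : ℝ} (hy0 : 0 ≤ y)
    (hy : y ≤ 1 / 4) : ((testSets s).card : ℝ) * y ^ s.card ≤ y := by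
  rcases Nat.lt_or_ge s.card 2 with hs | hs
  · have : testSets s = ∅ := by
      unfold testSets
      rw [Finset.filter_eq_empty_iff]
      rintro B hB ⟨h1, h2⟩
      have hB := Finset.mem_powerset.1 hB
      have h3 : B.card < s.card := Finset.card_lt_card (Finset.ssubset_iff_subset_ne.2 ⟨hB, h2⟩)
      have h4 : 0 < B.card := Finset.card_pos.2 (Finset.nonempty_iff_ne_empty.2 h1)
      omega
    rw [this]
    simpa using hy0
  · have h1 : ((testSets s).card : ℝ) ≤ 2 ^ s.card := by
      have : (testSets s).card ≤ 2 ^ s.card :=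
        (Finset.card_filter_le _ _).trans_eq (Finset.card_powerset s)
      exact_mod_cast this
    calc _ ≤ (2 : ℝ) ^ s.card * y ^ s.card := by gcongr
      _ = (2 * y) ^ s.card := by rw [mul_pow]
      _ ≤ (2 * y) ^ 2 := pow_le_pow_of_le_one (by positivity) (by linarith) hs
      _ ≤ y := by nlinarith

/-- A distribution that is not exceeded on any test set is close in total variation. -/
theorem sum_abs_sub_le_of_testSets {X : Type*} [Fintype X] [DecidableEq X] {s : Finset X}
    {p q : X → ℝ} (hp : ∀ x ∉ s, p x = 0) (hq : ∀ x ∉ s, q x = 0)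
    (hpq : ∑ x, p x = ∑ x, q x) {ε : ℝ} (hε : 0 ≤ ε)
    (h : ∀ B ∈ testSets s, ∑ x ∈ B, (q x - p x) ≤ ε / 2) : ∑ x, |p x - q x| ≤ ε := by
  classical
  have hsum : ∑ x ∈ s, (q x - p x) = 0 := by
    rw [Finset.sum_subset (Finset.subset_univ s) fun x _ hx => by rw [hp x hx, hq x hx, sub_zero],
      Finset.sum_sub_distrib, hpq, sub_self]
  have habs : ∑ x, |p x - q x| = ∑ x ∈ s, |p x - q x| :=
    (Finset.sum_subset (Finset.subset_univ s) fun x _ hx => by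
      rw [hp x hx, hq x hx, sub_zero, abs_zero]).symm
  set B := s.filter fun x => p x < q x with hB
  have h1 : ∑ x ∈ s, |p x - q x| = 2 * ∑ x ∈ B, (q x - p x) - ∑ x ∈ s, (q x - p x) := by
    rw [hB, Finset.sum_filter, Finset.mul_sum, ← Finset.sum_sub_distrib]
    refine Finset.sum_congr rfl fun x _ => ?_
    split_ifs with hx
    · rw [abs_of_neg (by linarith)]
      ring
    · rw [abs_of_nonneg (by linarith)]
      ring
  rw [habs, h1, hsum, sub_zero]
  by_cases hT : B ∈ testSets s
  · linarith [h B hT]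
  -- The two excluded sets are harmless: on both, the difference of the two distributions has sum 0.
  · have h2 : B = ∅ ∨ B = s := by
      by_contra hc
      push Not at hc
      exact hT (Finset.mem_filter.2 ⟨Finset.mem_powerset.2 (Finset.filter_subset _ _), hc.1.ne_empty, hc.2⟩)
    rcases h2 with h2 | h2
    · rw [h2]
      simpa using hε
    · rw [h2, hsum]
      simpa using hε

variable {X A : Type*} [Fintype X] [DecidableEq X] [Fintype A] [DecidableEq A] [Nonempty A]
  {L k : ℕ} {S : LoopFree X L} {P : X → A → X → ℝ} {T : ℕ} {δ : ℝ}

/-- The increment of the exponent for the deviation of the empirical transitions on `B`. -/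
noncomputable def devTerm (P : X → A → X → ℝ) (x : X) (a : A) (B : Finset X) (θ : ℝ) (x' : X) : ℝ :=
  θ * ((if x' ∈ B then 1 else 0) - ∑ y ∈ B, P x a y) - θ ^ 2 / 8

theorem sum_mul_exp_devTerm_le_one (hP : S.IsTransition P) {x : X} (hx : S.layer x < L) (a : A)
    (B : Finset X) (θ : ℝ) : ∑ x', P x a x' * Real.exp (devTerm P x a B θ x') ≤ 1 := by
  have h := sum_mul_exp_sub_le_one (fun x' => hP.1 x a x') (hP.2.2 x a hx)
    (F := fun x' => if x' ∈ B then (1 : ℝ) else 0) (a := 0) (b := 1)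
    (fun x' => by split_ifs <;> simp) θ
  simpa [devTerm] using h

/-- A pair is visited at most once per episode, and the expected moves factor as q(x, a)P(x'|x, a).
The exponential moment is therefore 1 + q(x, a)(E - 1), where E ≤ 1 is the one-step moment of
Hoeffding's lemma. -/
theorem sum_pathProb_mul_exp_le_one (hP : S.IsTransition P) {π : X → A → ℝ} (hπ : IsPolicy π)
    {x : X} (hx : S.layer x < L) (a : A) (B : Finset X) (θ : ℝ) :
    ∑ p, S.pathProb P π p *
      Real.exp (∑ x', (moveCount p x a x' : ℝ) * devTerm P x a B θ x') ≤ 1 := by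
  have h1 : ∀ p, S.pathProb P π p *
      Real.exp (∑ x', (moveCount p x a x' : ℝ) * devTerm P x a B θ x')
      = S.pathProb P π p + ∑ x', S.pathProb P π p * (moveCount p x a x' : ℝ) *
        (Real.exp (devTerm P x a B θ x') - 1) := by
    intro p
    by_cases h0 : S.pathProb P π p = 0
    · simp [h0]
    · have hv := fun j => S.layer_of_pathWeight_ne_zero hP (n := L) h0 j
      rw [exp_sum_natCast_mul ((sum_moveCount p x a).trans_le (visitCount_le_one hv x a)), mul_add,
        mul_one, Finset.mul_sum]
      simp_rw [mul_assoc]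
  simp_rw [h1]
  rw [Finset.sum_add_distrib, S.sum_pathProb hP hπ, Finset.sum_comm]
  simp_rw [← Finset.sum_mul, LoopFree.sum_pathProb_mul_moveCount hP, S.occ3_eq hP hπ, mul_assoc,
    ← Finset.mul_sum, mul_sub, mul_one]
  rw [Finset.sum_sub_distrib, hP.2.2 x a hx]
  have h2 := sum_mul_exp_devTerm_le_one hP hx a B θ
  have h3 := S.occ_nonneg hP hπ (x, a)
  nlinarith

variable {f : ℕ → Feedback X A L k}

theorem LoopFree.run_N_mono {s t : ℕ} (hst : s ≤ t) (x : X) (a : A) :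
    (S.run T δ f s).N x a ≤ (S.run T δ f t).N x a := by
  induction t, hst using Nat.le_induction with
  | base => exact le_rfl
  | succ t _ ih =>
    rw [S.run_succ_N]
    omega

theorem LoopFree.run_N_le (hf : ∀ t < T, ∀ j, S.layer ((f t).τ.1 j) = j) {t : ℕ} (ht : t ≤ T)
    (x : X) (a : A) : (S.run T δ f t).N x a ≤ t := by
  induction t with
  | zero => exact le_rfl
  | succ t ih =>
    rw [S.run_succ_N]
    have := visitCount_le_one (hf t ht) x a
    have := ih (by omega)
    omega

/-- The sum stopped at the `n`-th visit. -/
theorem LoopFree.sum_stopped_eq (x : X) (a : A) (n : ℕ) (c : X → ℝ) {s : ℕ}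
    (hs : (S.run T δ f s).N x a ≤ n) :
    ∑ t ∈ Finset.range s, (if (S.run T δ f t).N x a < n then
      ∑ x', (moveCount (f t).τ x a x' : ℝ) * c x' else 0)
      = ∑ x', ((S.run T δ f s).M x a x' : ℝ) * c x' := by
  induction s with
  | zero => simp [LoopFree.run, LoopFree.initState]
  | succ s ih =>
    rw [S.run_succ_N] at hs
    rw [Finset.sum_range_succ, ih (by omega)]
    simp only [S.run_succ_M, Nat.cast_add, add_mul, Finset.sum_add_distrib]
    congr 1
    split_ifs with hlt
    · rfl
    · have h0 : ∀ x', moveCount (f s).τ x a x' = 0 := by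
        have h1 : ∑ x', moveCount (f s).τ x a x' = 0 := by
          rw [sum_moveCount]
          omega
        exact fun x' => Finset.sum_eq_zero_iff.1 h1 x' (Finset.mem_univ x')
      simp [h0]

/-- Stopping at the n-th visit replaces the random time `s` by the fixed horizon `T`. The union
bound then runs over the number of visits. -/
theorem LoopFree.sum_stopped_eq_of_eq (x : X) (a : A) {n : ℕ} (c : X → ℝ) {s : ℕ} (hsT : s ≤ T)
    (hs : (S.run T δ f s).N x a = n) :
    ∑ t ∈ Finset.range T, (if (S.run T δ f t).N x a < n then
      ∑ x', (moveCount (f t).τ x a x' : ℝ) * c x' else 0)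
      = ∑ x', ((S.run T δ f s).M x a x' : ℝ) * c x' := by
  rw [← LoopFree.sum_stopped_eq x a n c hs.le]
  refine (Finset.sum_subset (Finset.range_mono hsT) fun t _ ht => if_neg ?_).symm
  rw [Finset.mem_range, not_lt] at ht
  exact not_lt.2 (hs.symm.le.trans (LoopFree.run_N_mono ht x a))

theorem sum_M_mul_devTerm (x : X) (a : A) (B : Finset X) (θ : ℝ) (s : ℕ) :
    ∑ x', ((S.run T δ f s).M x a x' : ℝ) * devTerm P x a B θ x'
      = θ * (∑ y ∈ B, (((S.run T δ f s).M x a y : ℝ) - (S.run T δ f s).N x a * P x a y))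
        - (S.run T δ f s).N x a * (θ ^ 2 / 8) := by
  have hN : ∑ x', ((S.run T δ f s).M x a x' : ℝ) = (S.run T δ f s).N x a := by
    exact_mod_cast LoopFree.sum_run_M s x a
  have e : ∀ x', ((S.run T δ f s).M x a x' : ℝ) * devTerm P x a B θ x'
      = θ * (if x' ∈ B then ((S.run T δ f s).M x a x' : ℝ) else 0)
        - ((S.run T δ f s).M x a x' : ℝ) * (θ * ∑ y ∈ B, P x a y + θ ^ 2 / 8) := by
    intro x'
    unfold devTerm
    split_ifs <;> ring
  simp_rw [e]
  rw [Finset.sum_sub_distrib, ← Finset.mul_sum, ← Finset.sum_mul, hN, Finset.sum_ite_mem,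
    Finset.univ_inter, Finset.sum_sub_distrib, ← Finset.mul_sum]
  ring

end Confidence

end CMDP

namespace CMDP

open scoped ENNReal

/-! ### The probability that a confidence set misses the true transition function -/

section ConfidenceEvent

variable {X A : Type*} [Fintype X] [DecidableEq X] [Fintype A] [DecidableEq A] [Nonempty A]
  {L k : ℕ} {S : LoopFree X L} {P : X → A → X → ℝ} {T : ℕ} {δ : ℝ}

/-- The exponent for the deviation of the empirical transitions on `B`, stopped at the `n`-th
visit. -/
noncomputable def LoopFree.devSum (S : LoopFree X L) (P : X → A → X → ℝ) (T : ℕ) (δ : ℝ)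
    (f : ℕ → Feedback X A L k) (x : X) (a : A) (n : ℕ) (B : Finset X) (θ : ℝ) : ℝ :=
  ∑ t ∈ Finset.range T, if (S.run T δ f t).N x a < n then
    ∑ x', (moveCount (f t).τ x a x' : ℝ) * devTerm P x a B θ x' else 0

/-- The confidence radius after `n` visits. -/
noncomputable def LoopFree.visitRadius (S : LoopFree X L) (A : Type*) [Fintype A] (T : ℕ) (δ : ℝ)
    (x : X) (n : ℕ) : ℝ :=
  Real.sqrt (2 * (S.layerSet (S.layer x + 1)).card *
    Real.log (T * Fintype.card X * Fintype.card A / δ) / max 1 (n : ℝ))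

/-- With θ = 2ε the exponent is 2εD - nε²/2, where D is the excess count on B. As the threshold
equals nε²/2, it follows that D ≤ nε/2 on every test set, that is, ℓ¹-distance at most ε. -/
theorem sum_abs_le_radius_of_devSum_lt {f : ℕ → Feedback X A L k} (hP : S.IsTransition P)
    (hT : (20 : ℝ) ≤ T) (hδ : δ ∈ Set.Ioo (0 : ℝ) 1)
    (hf : ∀ t < T, ∀ j, S.layer ((f t).τ.1 j) = j) {x : X} {a : A}
    (hdev : ∀ n ∈ Finset.Icc 1 T, ∀ B ∈ testSets (S.layerSet (S.layer x + 1)),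
      S.devSum P T δ f x a n B (2 * S.visitRadius A T δ x n)
        < (S.layerSet (S.layer x + 1)).card *
          Real.log (T * Fintype.card X * Fintype.card A / δ)) {s : ℕ} (hs : s ≤ T) :
    ∑ x', |P x a x' - ((S.run T δ f s).M x a x' : ℝ) / max 1 ((S.run T δ f s).N x a : ℝ)|
      ≤ S.radius T δ (S.run T δ f s).N x a := by
  have : Nonempty X := ⟨S.init⟩
  have hlog := one_le_log_mul_card_div (X := X) (A := A) hT hδ
  have hMN := LoopFree.run_M_le_run_N (S := S) (T := T) (δ := δ) (f := f) s x a
  by_cases hN : (S.run T δ f s).N x a = 0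
  · exact S.sum_abs_le_radius_of_eq_zero hT hδ hP hN fun x' => by
      have := hMN x'
      omega
  have hx : S.layer x < L := by
    refine lt_of_le_of_ne (S.layer_le x) fun hc => hN (LoopFree.run_N_final hf hs hc a)
  set n := (S.run T δ f s).N x a with hn
  have hnT : n ≤ T := (LoopFree.run_N_le hf hs x a).trans hs
  have hn1 : 1 ≤ n := Nat.one_le_iff_ne_zero.2 hN
  have hn1' : (1 : ℝ) ≤ n := by exact_mod_cast hn1
  have hsumM : ∑ x', ((S.run T δ f s).M x a x' : ℝ) = n := by
    exact_mod_cast LoopFree.sum_run_M s x a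
  rw [max_eq_right hn1']
  change _ ≤ S.visitRadius A T δ x n
  set ε := S.visitRadius A T δ x n with hε
  refine sum_abs_sub_le_of_testSets (s := S.layerSet (S.layer x + 1)) ?_ ?_ ?_
    (Real.sqrt_nonneg _) ?_
  · intro y hy
    exact S.transition_eq_zero hP a fun hc => hy (S.mem_layerSet.2 hc)
  · intro y hy
    rw [LoopFree.run_M_eq_zero hf hs (fun hc => hy (S.mem_layerSet.2 hc))]
    simp
  · rw [hP.2.2 x a hx, ← Finset.sum_div, hsumM, div_self (by positivity)]
  · intro B hB
    have h1 := hdev n (Finset.mem_Icc.2 ⟨hn1, hnT⟩) B hB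
    rw [LoopFree.devSum, LoopFree.sum_stopped_eq_of_eq x a _ hs hn.symm, sum_M_mul_devTerm,
      ← hn, ← hε] at h1
    have hne : 0 < (S.layerSet (S.layer x + 1)).card :=
      Finset.card_pos.2 (S.layerSet_nonempty hP (by omega))
    have hne' : (0 : ℝ) < (S.layerSet (S.layer x + 1)).card := by exact_mod_cast hne
    set ι := Real.log (T * Fintype.card X * Fintype.card A / δ) with hι
    have hε2 : n * ε ^ 2 = 2 * ((S.layerSet (S.layer x + 1)).card * ι) := by
      rw [hε, LoopFree.visitRadius, Real.sq_sqrt (by positivity), max_eq_right hn1', ← hι]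
      field_simp
    have hε0 : 0 < ε := by
      rw [hε]
      exact Real.sqrt_pos.2 (by positivity)
    set D := ∑ y ∈ B, (((S.run T δ f s).M x a y : ℝ) - n * P x a y) with hD
    have h2 : ε * D ≤ ε * (n * ε / 2) := by nlinarith
    have h3 : D ≤ n * ε / 2 := le_of_mul_le_mul_left h2 hε0
    have h4 : ∑ y ∈ B, (((S.run T δ f s).M x a y : ℝ) / n - P x a y) = D / n := by
      rw [hD, Finset.sum_div]
      refine Finset.sum_congr rfl fun y _ => ?_
      field_simp
    rw [h4, div_le_iff₀ (by positivity)]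
    linarith

variable {Ω : Type*} {mΩ : MeasurableSpace Ω} {μ : Measure Ω}
  [IsProbabilityMeasure μ] {ℱ : Filtration ℕ mΩ}
  {r : ℕ → Ω → X → A → ℝ} {G : ℕ → Ω → X → A → Fin k → ℝ} {τ : ℕ → Ω → Traj X A L}

namespace LoopFree.IsInteraction

variable (h : S.IsInteraction μ ℱ P T δ r G τ)

include h

theorem measurable_run_N {t : ℕ} (ht : t ≤ T) (x : X) (a : A) :
    Measurable[ℱ t] fun ω => (S.run T δ (feedback r G τ ω) t).N x a :=
  (measurable_pi_apply a).comp ((measurable_pi_apply x).comp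
    (measurable_fst.comp (h.measurableState_run ht).counts))

theorem measure_le_devSum_le (hP : S.IsTransition P) (hT : (20 : ℝ) ≤ T)
    (hδ : δ ∈ Set.Ioo (0 : ℝ) 1) {x : X} (hx : S.layer x < L) (a : A) (n : ℕ) (B : Finset X)
    (θ b : ℝ) :
    μ {ω | b ≤ S.devSum P T δ (feedback r G τ ω) x a n B θ} ≤ ENNReal.ofReal (Real.exp (-b)) := by
  set F : ℕ → Traj X A L → Ω → ℝ := fun t p ω =>
    if (S.run T δ (feedback r G τ ω) t).N x a < n then
      ∑ x', (moveCount p x a x' : ℝ) * devTerm P x a B θ x' else 0 with hFdef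
  have hF : ∀ t < T, ∀ p, Measurable[ℱ t] (F t p) := fun t ht p =>
    Measurable.ite (h.measurable_run_N ht.le x a measurableSet_Iio) measurable_const
      measurable_const
  refine measure_le_sum_le (μ := μ) (ℱ := ℱ) (T := T) (Z := fun t ω => F t (τ t ω) ω)
    (fun t ht => h.measurable_comp_traj ht (hF t ht)) (fun t ht => ?_) le_rfl b
  refine h.condExpLeOne hP hT hδ ht (hF t ht) fun ω π _ hπ => ?_
  simp only [hFdef]
  split_ifs
  · exact sum_pathProb_mul_exp_le_one hP hπ hx a B θ
  · simp [S.sum_pathProb hP hπ]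

/-- Put y = δ/(T|X||A|). Each test fails with probability at most y^|s|, where s is the next layer,
so the tests of one (x, a, n) fail with probability at most y; there are T|X||A| such triples. -/
theorem measure_exists_le_devSum_le (hP : S.IsTransition P) (hT : (20 : ℝ) ≤ T)
    (hδ : δ ∈ Set.Ioo (0 : ℝ) 1) :
    μ {ω | ¬∀ x a, ∀ n ∈ Finset.Icc 1 T, ∀ B ∈ testSets (S.layerSet (S.layer x + 1)),
      S.devSum P T δ (feedback r G τ ω) x a n B (2 * S.visitRadius A T δ x n)
        < (S.layerSet (S.layer x + 1)).card *
          Real.log (T * Fintype.card X * Fintype.card A / δ)} ≤ ENNReal.ofReal δ := by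
  have : Nonempty X := ⟨S.init⟩
  have hX : (1 : ℝ) ≤ Fintype.card X := by exact_mod_cast Fintype.card_pos
  have hA : (1 : ℝ) ≤ Fintype.card A := by exact_mod_cast Fintype.card_pos
  set ι := Real.log (T * Fintype.card X * Fintype.card A / δ) with hι
  set y : ℝ := δ / (T * Fintype.card X * Fintype.card A) with hy
  have hδ0 := hδ.1
  have hexp : Real.exp (-ι) = y := by
    rw [Real.exp_neg, hι, Real.exp_log (by positivity), inv_div]
  have hy0 : 0 ≤ y := by positivity
  have hXA : (1 : ℝ) ≤ Fintype.card X * Fintype.card A := by nlinarith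
  have hy4 : y ≤ 1 / 4 := by
    rw [hy, div_le_iff₀ (by positivity), mul_assoc]
    nlinarith [hδ.2]
  have hsub : {ω | ¬∀ x a, ∀ n ∈ Finset.Icc 1 T, ∀ B ∈ testSets (S.layerSet (S.layer x + 1)),
      S.devSum P T δ (feedback r G τ ω) x a n B (2 * S.visitRadius A T δ x n)
        < (S.layerSet (S.layer x + 1)).card * ι}
      ⊆ ⋃ x ∈ (Finset.univ : Finset X), ⋃ a ∈ (Finset.univ : Finset A), ⋃ n ∈ Finset.Icc 1 T,
        ⋃ B ∈ testSets (S.layerSet (S.layer x + 1)),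
        {ω | (S.layerSet (S.layer x + 1)).card * ι
          ≤ S.devSum P T δ (feedback r G τ ω) x a n B (2 * S.visitRadius A T δ x n)} := by
    intro ω hω
    simp only [Set.mem_ofPred_eq, not_forall, not_lt] at hω
    obtain ⟨x, a, n, hn, B, hB, hle⟩ := hω
    simp only [Set.mem_iUnion]
    exact ⟨x, Finset.mem_univ x, a, Finset.mem_univ a, n, hn, B, hB, hle⟩
  refine (measure_mono hsub).trans ?_
  have hB : ∀ x a n, μ (⋃ B ∈ testSets (S.layerSet (S.layer x + 1)),
        {ω | (S.layerSet (S.layer x + 1)).card * ι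
          ≤ S.devSum P T δ (feedback r G τ ω) x a n B (2 * S.visitRadius A T δ x n)})
      ≤ ENNReal.ofReal y := by
    intro x a n
    refine (measure_biUnion_finset_le _ _).trans ?_
    have h1 : ∀ B ∈ testSets (S.layerSet (S.layer x + 1)),
        μ {ω | (S.layerSet (S.layer x + 1)).card * ι
          ≤ S.devSum P T δ (feedback r G τ ω) x a n B (2 * S.visitRadius A T δ x n)}
        ≤ ENNReal.ofReal (y ^ (S.layerSet (S.layer x + 1)).card) := by
      intro B hB
      have hx : S.layer x < L := by
        obtain ⟨hB1, hB2, -⟩ := Finset.mem_filter.1 hB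
        obtain ⟨z, hz⟩ := Finset.nonempty_iff_ne_empty.2 hB2
        have h2 := S.mem_layerSet.1 (Finset.mem_powerset.1 hB1 hz)
        have h3 := S.layer_le z
        omega
      refine (h.measure_le_devSum_le hP hT hδ hx a n B _ _).trans_eq ?_
      rw [← mul_neg, Real.exp_nat_mul, hexp]
    refine (Finset.sum_le_sum h1).trans ?_
    rw [Finset.sum_const, nsmul_eq_mul, ← ENNReal.ofReal_natCast,
      ← ENNReal.ofReal_mul (by positivity)]
    exact ENNReal.ofReal_le_ofReal (card_testSets_mul_pow_le _ hy0 hy4)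
  calc _ ≤ ∑ _x : X, ∑ _a : A, ∑ _n ∈ Finset.Icc 1 T, ENNReal.ofReal y :=
        (measure_biUnion_finset_le _ _).trans (Finset.sum_le_sum fun x _ =>
          (measure_biUnion_finset_le _ _).trans (Finset.sum_le_sum fun a _ =>
            (measure_biUnion_finset_le _ _).trans (Finset.sum_le_sum fun n _ => hB x a n)))
    _ = ENNReal.ofReal δ := by
        simp only [Finset.sum_const, Finset.card_univ, Nat.card_Icc, Nat.add_sub_cancel,
          nsmul_eq_mul, ← ENNReal.ofReal_natCast]
        rw [← ENNReal.ofReal_mul (by positivity), ← ENNReal.ofReal_mul (by positivity),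
          ← ENNReal.ofReal_mul (by positivity), hy]
        congr 1
        field_simp

theorem measure_not_regular_le (hP : S.IsTransition P) (hT : (20 : ℝ) ≤ T)
    (hδ : δ ∈ Set.Ioo (0 : ℝ) 1) :
    μ {ω | ¬S.Regular P T δ (feedback r G τ ω)} ≤ ENNReal.ofReal δ := by
  refine (measure_mono_ae ?_).trans (h.measure_exists_le_devSum_le hP hT hδ)
  filter_upwards [h.ae_layer hP] with ω hω hreg hdev
  refine hreg ⟨hP, fun t ht => h.r_mem t ht ω, fun t ht => h.G_mem t ht ω, hω, fun t ht => ?_⟩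
  obtain ⟨s, hs, hN, hM⟩ := S.exists_epoch_start (T := T) (δ := δ) (f := feedback r G τ ω) t
  rw [hN, hM]
  exact ⟨hP, fun x a =>
    sum_abs_le_radius_of_devSum_lt hP hT hδ hω (hdev x a) (hs.trans ht)⟩

end LoopFree.IsInteraction

end ConfidenceEvent

end CMDP

namespace CMDP

open scoped ENNReal

/-! ### Concentration of the stochastic rewards and constraints -/

section Stochastic

variable {Ω : Type*} {mΩ : MeasurableSpace Ω} {μ : Measure Ω} [IsProbabilityMeasure μ]
  {ℱ : Filtration ℕ mΩ} {T : ℕ} {E J : Type*} [MeasurableSpace E] [Fintype J]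

theorem measurable_sum_mul_sub {m : MeasurableSpace Ω} {u : Ω → J → ℝ}
    (hu : ∀ j, Measurable fun ω => u ω j) {e : J → E → ℝ} (he : ∀ j, Measurable (e j))
    (d : J → ℝ) (θ s : ℝ) :
    Measurable fun z : Ω × E => θ * ∑ j, u z.1 j * (e j z.2 - d j) - s := by
  refine Measurable.sub_const (Measurable.const_mul (Finset.measurable_sum _ fun j _ => ?_) θ) s
  exact ((hu j).comp measurable_fst).mul (((he j).comp measurable_snd).sub_const _)

theorem IsStochastic.ae_mem {𝒟 : Measure E} {Y : ℕ → Ω → E} (hD : IsStochastic μ ℱ T 𝒟 Y) {t : ℕ}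
    (ht : t < T) {e : E → ℝ} (he : Measurable e) {lo hi : ℝ}
    (h : ∀ ω, e (Y t ω) ∈ Set.Icc lo hi) : ∀ᵐ y ∂𝒟, e y ∈ Set.Icc lo hi := by
  rw [← (hD t ht).1.map_eq, ae_map_iff (hD t ht).1.aemeasurable (he measurableSet_Icc)]
  exact Filter.Eventually.of_forall h

theorem IsStochastic.isProbabilityMeasure {𝒟 : Measure E} {Y : ℕ → Ω → E}
    (hD : IsStochastic μ ℱ T 𝒟 Y) {t : ℕ} (ht : t < T) : IsProbabilityMeasure 𝒟 := by
  rw [← (hD t ht).1.map_eq]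
  exact Measure.isProbabilityMeasure_map (hD t ht).1.aemeasurable

/-- The weights `u` are determined by the past and `Y t` is independent of it, so Hoeffding's lemma
applies with the weights frozen. Centering the values at `c` shows that an increment ranges over an
interval of length 2bw. -/
theorem IsStochastic.measure_lt_sum_le {𝒟 : Measure E} {Y : ℕ → Ω → E}
    (hD : IsStochastic μ ℱ T 𝒟 Y) (hY : ∀ t < T, Measurable[ℱ (t + 1)] (Y t)) {e : J → E → ℝ}
    (he : ∀ j, Measurable (e j)) {c w : ℝ} (hw : 0 < w)
    (hbd : ∀ t < T, ∀ ω j, e j (Y t ω) ∈ Set.Icc (c - w) (c + w)) {u : ℕ → Ω → J → ℝ}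
    (hu : ∀ t < T, ∀ j, Measurable[ℱ t] fun ω => u t ω j) {b : ℝ} (hb : 0 < b)
    (hub : ∀ t < T, ∀ ω, ∑ j, |u t ω j| ≤ b) {n : ℕ} (hn : n ≤ T) (hT : 0 < T) {C : ℝ}
    (hC : 1 ≤ C) :
    μ {ω | 2 * b * w * Real.sqrt (T * Real.log C / 2)
      < ∑ t ∈ Finset.range n, ∑ j, u t ω j * (e j (Y t ω) - ∫ y, e j y ∂𝒟)}
      ≤ ENNReal.ofReal (1 / C) := by
  have : IsProbabilityMeasure 𝒟 := hD.isProbabilityMeasure hT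
  have hae : ∀ j, ∀ᵐ y ∂𝒟, e j y ∈ Set.Icc (c - w) (c + w) := fun j =>
    hD.ae_mem hT (he j) fun ω => hbd 0 hT ω j
  have hinteg : ∀ j, Integrable (e j) 𝒟 := fun j =>
    Integrable.of_mem_Icc _ _ (he j).aemeasurable (hae j)
  refine measure_le_sum_le_of_width (μ := μ) (ℱ := ℱ) (T := T) (w := 2 * b * w) (by positivity)
    (Y := fun t ω => ∑ j, u t ω j * (e j (Y t ω) - ∫ y, e j y ∂𝒟)) (fun t ht => ?_)
    (fun t ht θ => ?_) hn hT hC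
  · refine Finset.measurable_sum _ fun j _ => ?_
    exact ((hu t ht j).mono (ℱ.mono (Nat.le_succ t)) le_rfl).mul
      (((he j).comp (hY t ht)).sub_const _)
  · refine CondExpLeOne.of_indep (ν := 𝒟)
      (Φ := fun z : Ω × E => θ * ∑ j, u t z.1 j * (e j z.2 - ∫ y, e j y ∂𝒟)
        - θ ^ 2 * (2 * b * w) ^ 2 / 8)
      (ℱ.le t) ((hY t ht).mono (ℱ.le _) le_rfl) (hD t ht).1.map_eq (hD t ht).2
      (measurable_sum_mul_sub (m := ℱ t) (hu t ht) he _ _ _) fun ω => ?_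
    have hg : Measurable fun y => ∑ j, u t ω j * (e j y - c) :=
      Finset.measurable_sum _ fun j _ => ((he j).sub_const c).const_mul _
    have hgb : ∀ᵐ y ∂𝒟, ∑ j, u t ω j * (e j y - c) ∈ Set.Icc (-(b * w)) (b * w) := by
      filter_upwards [ae_all_iff.2 hae] with y hy
      refine abs_le.1 ?_
      calc |∑ j, u t ω j * (e j y - c)| ≤ ∑ j, |u t ω j| * w := by
            refine (Finset.abs_sum_le_sum_abs _ _).trans (Finset.sum_le_sum fun j _ => ?_)
            rw [abs_mul]
            have := hy j
            exact mul_le_mul_of_nonneg_left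
              (abs_le.2 ⟨by linarith [this.1], by linarith [this.2]⟩) (abs_nonneg _)
        _ ≤ b * w := by
            rw [← Finset.sum_mul]
            exact mul_le_mul_of_nonneg_right (hub t ht ω) hw.le
    have key := lintegral_exp_sub_le_one hg.aemeasurable hgb θ
    have hmean : ∫ y, ∑ j, u t ω j * (e j y - c) ∂𝒟 = ∑ j, u t ω j * ((∫ y, e j y ∂𝒟) - c) := by
      have hj : ∀ j, Integrable (fun y => u t ω j * (e j y - c)) 𝒟 := fun j =>
        ((hinteg j).sub (integrable_const c)).const_mul _
      rw [integral_finsetSum _ fun j _ => hj j]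
      refine Finset.sum_congr rfl fun j _ => ?_
      rw [integral_const_mul, integral_sub (hinteg j) (integrable_const c)]
      simp
    have hexp : ∀ y, θ * (∑ j, u t ω j * (e j y - c) - ∫ y, ∑ j, u t ω j * (e j y - c) ∂𝒟)
          - θ ^ 2 * (b * w - -(b * w)) ^ 2 / 8
        = θ * ∑ j, u t ω j * (e j y - ∫ y, e j y ∂𝒟) - θ ^ 2 * (2 * b * w) ^ 2 / 8 := by
      intro y
      rw [hmean, ← Finset.sum_sub_distrib]
      have e1 : ∀ j, u t ω j * (e j y - c) - u t ω j * ((∫ y, e j y ∂𝒟) - c)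
          = u t ω j * (e j y - ∫ y, e j y ∂𝒟) := fun j => by ring
      simp_rw [e1]
      ring
    simp_rw [hexp] at key
    exact key

end Stochastic

/-! ### The concentration events for constraints and rewards -/

section Events

variable {X A : Type*} [Fintype X] [DecidableEq X] [Fintype A] [DecidableEq A] [Nonempty A]
  {L k : ℕ} {S : LoopFree X L} {P : X → A → X → ℝ} {T : ℕ} {δ : ℝ}
  {Ω : Type*} {mΩ : MeasurableSpace Ω} {μ : Measure Ω}
  [IsProbabilityMeasure μ] {ℱ : Filtration ℕ mΩ}
  {r : ℕ → Ω → X → A → ℝ} {G : ℕ → Ω → X → A → Fin k → ℝ} {τ : ℕ → Ω → Traj X A L}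
  {𝒢 : Measure (X → A → Fin k → ℝ)}

theorem two_mul_sqrt_half (s : ℝ) : 2 * Real.sqrt (s / 2) = Real.sqrt (2 * s) := by
  rw [show 2 * s = 2 ^ 2 * (s / 2) by ring, Real.sqrt_mul (by positivity),
    Real.sqrt_sq (by norm_num)]

theorem measurable_eval_three (j : X × A × Fin k) :
    Measurable fun g : X → A → Fin k → ℝ => g j.1 j.2.1 j.2.2 :=
  (measurable_pi_apply j.2.2).comp ((measurable_pi_apply j.2.1).comp (measurable_pi_apply j.1))

namespace LoopFree.IsInteraction

variable (h : S.IsInteraction μ ℱ P T δ r G τ)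

include h

theorem abs_meanG_le (hG : IsStochastic μ ℱ T 𝒢 G) (hT : 0 < T) (x : X) (a : A) (i : Fin k) :
    |meanG 𝒢 x a i| ≤ 1 := by
  have : IsProbabilityMeasure 𝒢 := hG.isProbabilityMeasure hT
  have h1 := hG.ae_mem hT (measurable_eval_three (x, a, i)) fun ω => h.G_mem 0 hT ω x a i
  have h2 : ∀ᵐ g ∂𝒢, ‖g x a i‖ ≤ 1 := by
    filter_upwards [h1] with g hg
    exact abs_le.2 ⟨hg.1, hg.2⟩
  have h3 := norm_integral_le_of_norm_le_const h2
  rw [probReal_univ, mul_one] at h3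
  exact h3

theorem measurable_truncLam {t : ℕ} (ht : t ≤ T) (Z : ℝ) (i : Fin k) :
    Measurable[ℱ t] fun ω => S.truncLam T δ (feedback r G τ ω) Z t i := by
  have h1 : ∀ j, Measurable[ℱ t] fun ω => (S.run T δ (feedback r G τ ω) t).lam j :=
    measurable_apply_vec (h.measurableState_run ht).lam
  have h2 : Measurable[ℱ t] fun ω => S.lamSum T δ (feedback r G τ ω) t :=
    Finset.measurable_sum _ fun j _ => h1 j
  exact Measurable.ite (h2 measurableSet_Iic) (h1 i) measurable_const

/-- The weights `w` on the pairs are left general: the comparator q₀ with either sign serves the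
drift argument, and a point mass serves the entrywise bound. -/
theorem measure_lt_sum_truncLam_le (hG : IsStochastic μ ℱ T 𝒢 G) (hT : 0 < T) {Z b : ℝ}
    (hZ : 0 < Z) (hb : 0 < b) {w : X → A → ℝ} (hw : ∑ x, ∑ a, |w x a| ≤ b) {n : ℕ} (hn : n ≤ T)
    {C : ℝ} (hC : 1 ≤ C) :
    μ {ω | Z * b * Real.sqrt (2 * (T * Real.log C))
      < ∑ t ∈ Finset.range n, ∑ i, S.truncLam T δ (feedback r G τ ω) Z t i *
        ∑ x, ∑ a, (G t ω x a i - meanG 𝒢 x a i) * w x a} ≤ ENNReal.ofReal (1 / C) := by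
  have key := hG.measure_lt_sum_le h.G_meas (J := X × A × Fin k)
    (e := fun j g => g j.1 j.2.1 j.2.2) measurable_eval_three (c := 0) (w := 1) one_pos
    (fun t ht ω j => by simpa using h.G_mem t ht ω j.1 j.2.1 j.2.2)
    (u := fun t ω j => S.truncLam T δ (feedback r G τ ω) Z t j.2.2 * w j.1 j.2.1)
    (fun t ht j => (h.measurable_truncLam ht.le Z j.2.2).mul_const _) (b := Z * b)
    (by positivity) ?_ hn hT hC
  · convert key using 5 with ω
    · rw [← two_mul_sqrt_half]
      ring
    · refine Finset.sum_congr rfl fun t _ => ?_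
      simp_rw [Fintype.sum_prod_type, Finset.mul_sum]
      rw [Finset.sum_comm]
      refine Finset.sum_congr rfl fun x _ => ?_
      rw [Finset.sum_comm]
      refine Finset.sum_congr rfl fun a _ => Finset.sum_congr rfl fun i _ => ?_
      simp only [meanG]
      ring
  · intro t ht ω
    simp_rw [Fintype.sum_prod_type, abs_mul, abs_of_nonneg (S.truncLam_nonneg Z t _)]
    simp_rw [← Finset.sum_mul, ← Finset.mul_sum]
    exact mul_le_mul (S.sum_truncLam_le hZ.le t) hw
      (Finset.sum_nonneg fun x _ => Finset.sum_nonneg fun a _ => abs_nonneg _) hZ.le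

/-- All prefixes and both signs are required, because the drift argument uses intervals with random
endpoints. This is where T² enters the logarithm. -/
theorem measure_viol_le (hG : IsStochastic μ ℱ T 𝒢 G) (hP : S.IsTransition P)
    (hT : (20 : ℝ) ≤ T) (hδ : δ ∈ Set.Ioo (0 : ℝ) 1) {Z : ℝ} (hZ : 0 < Z) {q : Vec X A}
    (hq : q ∈ S.Delta {P}) :
    μ {ω | ¬∀ n ≤ T, |∑ t ∈ Finset.range n, ∑ i, S.truncLam T δ (feedback r G τ ω) Z t i *
      (viol (feedback r G τ ω t).G q i - viol (meanG 𝒢) q i)|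
        ≤ Z * L * Real.sqrt (2 * T * Real.log (T ^ 2 / δ))} ≤ ENNReal.ofReal δ := by
  have hL : (0 : ℝ) < L := by exact_mod_cast S.horizon_pos
  have hT0 : (0 : ℝ) < T := by linarith
  have hT' : 0 < T := by exact_mod_cast hT0
  have hδ0 := hδ.1
  have hC : 1 ≤ (T : ℝ) ^ 2 / δ := by
    rw [le_div_iff₀ hδ0]
    nlinarith [hδ.2]
  have hw := S.sum_abs_of_mem_Delta (S.isTransition_of_mem_singleton hP) hq
  have hp := fun n (hn : n ≤ T) => h.measure_lt_sum_truncLam_le hG hT' hZ hL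
    (w := fun x a => q (x, a)) hw.le hn hC
  have hm := fun n (hn : n ≤ T) => h.measure_lt_sum_truncLam_le hG hT' hZ hL
    (w := fun x a => -q (x, a)) (by simpa only [abs_neg] using hw.le) hn hC
  set B := Z * L * Real.sqrt (2 * (T * Real.log (T ^ 2 / δ))) with hB
  have hBnn : 0 ≤ B := by positivity
  rw [mul_assoc 2 (T : ℝ), ← hB]
  simp_rw [viol_eq_sub_dot, dot]
  have hsub : {ω | ¬∀ n ≤ T, |∑ t ∈ Finset.range n, ∑ i,
      S.truncLam T δ (feedback r G τ ω) Z t i *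
        ∑ x, ∑ a, ((feedback r G τ ω t).G x a i - meanG 𝒢 x a i) * q (x, a)| ≤ B}
      ⊆ ⋃ n ∈ Finset.Icc 1 T, ({ω | B < ∑ t ∈ Finset.range n, ∑ i,
          S.truncLam T δ (feedback r G τ ω) Z t i *
            ∑ x, ∑ a, (G t ω x a i - meanG 𝒢 x a i) * q (x, a)} ∪
        {ω | B < ∑ t ∈ Finset.range n, ∑ i, S.truncLam T δ (feedback r G τ ω) Z t i *
            ∑ x, ∑ a, (G t ω x a i - meanG 𝒢 x a i) * -q (x, a)}) := by
    intro ω hω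
    simp only [Set.mem_ofPred_eq, not_forall, not_le] at hω
    obtain ⟨n, hn, hlt⟩ := hω
    have hn0 : n ≠ 0 := by
      rintro rfl
      simp only [Finset.range_zero, Finset.sum_empty, abs_zero] at hlt
      linarith
    simp only [Set.mem_iUnion]
    refine ⟨n, Finset.mem_Icc.2 ⟨Nat.one_le_iff_ne_zero.2 hn0, hn⟩, ?_⟩
    rcases lt_abs.1 hlt with h1 | h1
    · exact Or.inl h1
    · refine Or.inr ?_
      simp only [Set.mem_ofPred_eq, mul_neg, Finset.sum_neg_distrib]
      exact h1
  refine (measure_mono hsub).trans ((measure_biUnion_finset_le _ _).trans ?_)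
  calc _ ≤ ∑ _n ∈ Finset.Icc 1 T,
        (ENNReal.ofReal (1 / (T ^ 2 / δ)) + ENNReal.ofReal (1 / (T ^ 2 / δ))) :=
        Finset.sum_le_sum fun n hn => (measure_union_le _ _).trans
          (add_le_add (hp n (Finset.mem_Icc.1 hn).2) (hm n (Finset.mem_Icc.1 hn).2))
    _ ≤ ENNReal.ofReal δ := by
        rw [← ENNReal.ofReal_add (by positivity) (by positivity), Finset.sum_const, Nat.card_Icc,
          Nat.add_sub_cancel, nsmul_eq_mul, ← ENNReal.ofReal_natCast,
          ← ENNReal.ofReal_mul (by positivity)]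
        refine ENNReal.ofReal_le_ofReal ?_
        -- T prefixes and two signs, each at level δ/T².
        have e : (T : ℝ) * (1 / (T ^ 2 / δ) + 1 / (T ^ 2 / δ)) = 2 * δ / T := by
          field_simp
          ring
        rw [e, div_le_iff₀ hT0]
        nlinarith

theorem measure_entries_le (hG : IsStochastic μ ℱ T 𝒢 G) (hT : (20 : ℝ) ≤ T)
    (hδ : δ ∈ Set.Ioo (0 : ℝ) 1) {Z : ℝ} (hZ : 0 < Z) :
    μ {ω | ¬∀ x a, ∑ t ∈ Finset.range T, ∑ i, S.truncLam T δ (feedback r G τ ω) Z t i *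
      ((feedback r G τ ω t).G x a i - meanG 𝒢 x a i)
        ≤ Z * Real.sqrt (2 * T * Real.log (Fintype.card X * Fintype.card A / δ))}
      ≤ ENNReal.ofReal δ := by
  have : Nonempty X := ⟨S.init⟩
  have hX : (1 : ℝ) ≤ Fintype.card X := by exact_mod_cast Fintype.card_pos
  have hA : (1 : ℝ) ≤ Fintype.card A := by exact_mod_cast Fintype.card_pos
  have hT0 : (0 : ℝ) < T := by linarith
  have hT' : 0 < T := by exact_mod_cast hT0
  have hδ0 := hδ.1
  have hC : 1 ≤ (Fintype.card X * Fintype.card A : ℝ) / δ := by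
    rw [le_div_iff₀ hδ0]
    nlinarith [hδ.2]
  have hp := fun x₀ a₀ => h.measure_lt_sum_truncLam_le hG hT' hZ one_pos
    (w := fun x a => if x = x₀ then if a = a₀ then 1 else 0 else 0)
    (by
      rw [Finset.sum_eq_single x₀ (fun x _ hx => by simp [hx]) (by simp),
        Finset.sum_eq_single a₀ (fun a _ ha => by simp [ha]) (by simp)]
      simp) le_rfl hC
  simp only [mul_ite, mul_one, mul_zero, Finset.sum_ite_eq', Finset.mem_univ, if_true,
    Finset.sum_ite_irrel, Finset.sum_const_zero] at hp
  rw [mul_assoc 2 (T : ℝ)]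
  set B := Z * Real.sqrt (2 * (T * Real.log (Fintype.card X * Fintype.card A / δ))) with hB
  have hsub : {ω | ¬∀ x a, ∑ t ∈ Finset.range T, ∑ i, S.truncLam T δ (feedback r G τ ω) Z t i *
      ((feedback r G τ ω t).G x a i - meanG 𝒢 x a i) ≤ B}
      ⊆ ⋃ x ∈ (Finset.univ : Finset X), ⋃ a ∈ (Finset.univ : Finset A),
        {ω | B < ∑ t ∈ Finset.range T, ∑ i, S.truncLam T δ (feedback r G τ ω) Z t i *
          (G t ω x a i - meanG 𝒢 x a i)} := by
    intro ω hω
    simp only [Set.mem_ofPred_eq, not_forall, not_le] at hω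
    obtain ⟨x, a, hlt⟩ := hω
    simp only [Set.mem_iUnion]
    exact ⟨x, Finset.mem_univ x, a, Finset.mem_univ a, hlt⟩
  refine (measure_mono hsub).trans ?_
  calc _ ≤ ∑ _x : X, ∑ _a : A, ENNReal.ofReal (1 / (Fintype.card X * Fintype.card A / δ)) :=
        (measure_biUnion_finset_le _ _).trans (Finset.sum_le_sum fun x _ =>
          (measure_biUnion_finset_le _ _).trans (Finset.sum_le_sum fun a _ => hp x a))
    _ = ENNReal.ofReal δ := by
        simp only [Finset.sum_const, Finset.card_univ, nsmul_eq_mul, ← ENNReal.ofReal_natCast]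
        rw [← ENNReal.ofReal_mul (by positivity), ← ENNReal.ofReal_mul (by positivity)]
        congr 1
        field_simp

/-- A one-sided bound at a deterministic q, where no union bound is needed. The entries lie within
1/2 of 1/2. -/
theorem measure_reward_le {ℛ : Measure (X → A → ℝ)} (hr : IsStochastic μ ℱ T ℛ r)
    (hP : S.IsTransition P) (hT : (20 : ℝ) ≤ T) (hδ : δ ∈ Set.Ioo (0 : ℝ) 1) {q : Vec X A}
    (hq : q ∈ S.Delta {P}) :
    μ {ω | ¬T * dot (meanR ℛ) q ≤ errR L T δ + ∑ t ∈ Finset.range T, dot (r t ω) q}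
      ≤ ENNReal.ofReal δ := by
  have hL : (0 : ℝ) < L := by exact_mod_cast S.horizon_pos
  have hT0 : (0 : ℝ) < T := by linarith
  have hT' : 0 < T := by exact_mod_cast hT0
  have hδ0 := hδ.1
  have hw := S.sum_abs_of_mem_Delta (S.isTransition_of_mem_singleton hP) hq
  have key := hr.measure_lt_sum_le h.r_meas (J := X × A)
    (e := fun j g => g j.1 j.2)
    (fun j => (measurable_pi_apply j.2).comp (measurable_pi_apply j.1)) (c := 1 / 2) (w := 1 / 2)
    one_half_pos (fun t ht ω j => by
      have := h.r_mem t ht ω j.1 j.2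
      constructor <;> linarith [this.1, this.2])
    (u := fun _ _ j => -q j) (fun _ _ _ => measurable_const) hL
    (fun t _ ω => by
      simp only [abs_neg]
      rw [Fintype.sum_prod_type]
      exact hw.le) le_rfl hT' (C := 2 / δ) (by
        rw [le_div_iff₀ hδ0]
        linarith [hδ.2])
  refine (measure_mono fun ω hω => ?_).trans (key.trans (ENNReal.ofReal_le_ofReal ?_))
  · simp only [Set.mem_ofPred_eq, not_le] at hω ⊢
    have e1 : ∑ t ∈ Finset.range T, ∑ j : X × A, -q j * (r t ω j.1 j.2 - ∫ y, y j.1 j.2 ∂ℛ)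
        = T * dot (meanR ℛ) q - ∑ t ∈ Finset.range T, dot (r t ω) q := by
      have : ∀ t, ∑ j : X × A, -q j * (r t ω j.1 j.2 - ∫ y, y j.1 j.2 ∂ℛ)
          = dot (meanR ℛ) q - dot (r t ω) q := by
        intro t
        rw [Fintype.sum_prod_type, dot, dot, ← Finset.sum_sub_distrib]
        refine Finset.sum_congr rfl fun x _ => ?_
        rw [← Finset.sum_sub_distrib]
        refine Finset.sum_congr rfl fun a _ => ?_
        simp only [meanR]
        ring
      simp_rw [this]
      rw [Finset.sum_sub_distrib, Finset.sum_const, Finset.card_range, nsmul_eq_mul]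
    have e2 : 2 * (L : ℝ) * (1 / 2) * Real.sqrt (T * Real.log (2 / δ) / 2) = errR L T δ := by
      rw [errR, Real.sqrt_div' _ (by norm_num)]
      ring
    rw [e1, e2]
    linarith
  · rw [one_div_div]
    linarith

end LoopFree.IsInteraction

end Events

end CMDP

namespace CMDP

open scoped ENNReal

/-! ### The good event -/

section Good

variable {X A : Type*} [Fintype X] [DecidableEq X] [Fintype A] [DecidableEq A] [Nonempty A]
  {L m : ℕ} {S : LoopFree X L} {P : X → A → X → ℝ} {T : ℕ} {δ : ℝ}

/-- The outcomes for which the regret and violation bounds hold. -/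
structure LoopFree.Good (S : LoopFree X L) (P : X → A → X → ℝ) (T : ℕ) (δ : ℝ)
    (Gbar : X → A → Fin m → ℝ) (f : ℕ → Feedback X A L m) : Prop where
  regular : S.Regular P T δ f
  lamSum_lt : ∀ t ≤ T, S.lamSum T δ f t < S.zeta P Gbar
  estimation : ∑ t ∈ Finset.range T, ∑ x, ∑ a,
    |(S.run T δ f t).q (x, a) - S.played P T δ f t (x, a)| ≤ errQ X A L T δ
  entries : ∀ x a, ∑ t ∈ Finset.range T, ∑ i, S.truncLam T δ f (S.zeta P Gbar) t i *
    ((f t).G x a i - Gbar x a i)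
      ≤ S.zeta P Gbar * Real.sqrt (2 * T * Real.log (Fintype.card X * Fintype.card A / δ))

/-- The parameter `e` is the gap between T r̄ᵀq and the realized rewards of q, so both reward models
are treated at once. -/
theorem LoopFree.Good.bounds {Gbar : X → A → Fin m → ℝ} {f : ℕ → Feedback X A L m}
    (hg : S.Good P T δ Gbar f) (hm : 0 < m) (hT : (20 : ℝ) ≤ T) (hδ : δ ∈ Set.Ioo (0 : ℝ) 1)
    (hζ1 : 1 ≤ S.zeta P Gbar) (hζT : S.zeta P Gbar ≤ (T : ℝ) ^ ((1 : ℝ) / 4))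
    {rbar : X → A → ℝ} {q : Vec X A} (hq : S.IsOptimal P rbar Gbar q) {e : ℝ}
    (he : e ≤ errR L T δ)
    (hr : T * dot rbar q ≤ e + ∑ t ∈ Finset.range T, dot (f t).r q) :
    S.regret P rbar Gbar T δ f ≤ e + S.zeta P Gbar * errG L T δ
        + S.zeta P Gbar * errQ X A L T δ + S.dualRegret T δ f 0 + S.primalRegret P T δ f q ∧
    S.violation P T δ f ≤ 1 / dualRate X A m T δ * S.zeta P Gbar + errQ X A L T δ ∧
    S.regret P rbar Gbar T δ f
      ≤ finalConst X A L m * (S.zeta P Gbar * Real.sqrt (T * Real.log (T ^ 2 / δ))) ∧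
    S.violation P T δ f
      ≤ finalConst X A L m * (S.zeta P Gbar * Real.sqrt (T * Real.log (T ^ 2 / δ))) := by
  have h1 := hg.regular.sum_dot_sub_played_le hT hδ (by linarith) hg.lamSum_lt hg.entries
    hg.estimation hq.1
  have h2 := hg.regular.violation_le hm hT hδ hζT hg.lamSum_lt hg.estimation
  have h3 := hg.regular.order_le hm hT hδ hζ1 hg.lamSum_lt hg.estimation hq.1.1
  have h4 : S.regret P rbar Gbar T δ f ≤ e + S.zeta P Gbar * errG L T δ
      + S.zeta P Gbar * errQ X A L T δ + S.dualRegret T δ f 0 + S.primalRegret P T δ f q := by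
    rw [LoopFree.regret, LoopFree.IsOptimal.OPT_eq S hq]
    rw [Finset.sum_sub_distrib] at h1
    linarith
  exact ⟨h4, h2, (h4.trans (by linarith)).trans h3.1, h2.trans h3.2⟩

variable {Ω : Type*} {mΩ : MeasurableSpace Ω} {μ : Measure Ω} [IsProbabilityMeasure μ]

/-- The good event is not shown to be measurable; the complement of a measurable hull of the bad
event replaces it. -/
theorem exists_measurableSet_subset {s : Set Ω} {ε : ℝ} (hε : 0 ≤ ε)
    (h : μ sᶜ ≤ ENNReal.ofReal ε) :
    ∃ E : Set Ω, MeasurableSet E ∧ ENNReal.ofReal (1 - ε) ≤ μ E ∧ ∀ ω ∈ E, ω ∈ s := by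
  refine ⟨(toMeasurable μ sᶜ)ᶜ, (measurableSet_toMeasurable μ _).compl, ?_, fun ω hω => ?_⟩
  · rw [prob_compl_eq_one_sub (measurableSet_toMeasurable μ _), measure_toMeasurable]
    rw [ENNReal.ofReal_sub _ hε, ENNReal.ofReal_one]
    exact tsub_le_tsub_left h 1
  · by_contra hc
    exact hω (subset_toMeasurable μ _ hc)

theorem measure_not_le_add {p q s : Ω → Prop} {a b : ℝ} (ha : 0 ≤ a) (hb : 0 ≤ b)
    (hp : μ {ω | ¬p ω} ≤ ENNReal.ofReal a) (hq : μ {ω | ¬q ω} ≤ ENNReal.ofReal b)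
    (h : ∀ ω, p ω → q ω → s ω) : μ {ω | ¬s ω} ≤ ENNReal.ofReal (a + b) := by
  rw [ENNReal.ofReal_add ha hb]
  refine (measure_mono (t := {ω | ¬p ω} ∪ {ω | ¬q ω}) fun ω hω => ?_).trans
    ((measure_union_le _ _).trans (add_le_add hp hq))
  by_contra hc
  simp only [Set.mem_union, Set.mem_ofPred_eq, not_or, not_not] at hc
  exact hω (h ω hc.1 hc.2)

variable {ℱ : Filtration ℕ mΩ}
  {r : ℕ → Ω → X → A → ℝ} {G : ℕ → Ω → X → A → Fin m → ℝ} {τ : ℕ → Ω → Traj X A L}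
  {𝒢 : Measure (X → A → Fin m → ℝ)}

theorem LoopFree.IsInteraction.measure_not_good_le (h : S.IsInteraction μ ℱ P T δ r G τ)
    (hG : IsStochastic μ ℱ T 𝒢 G) (hm : 0 < m) (hP : S.IsTransition P) (hT : (20 : ℝ) ≤ T)
    (hδ : δ ∈ Set.Ioo (0 : ℝ) 1) (hρ0 : 0 < S.rho P (meanG 𝒢)) (hρL : S.rho P (meanG 𝒢) ≤ L) :
    μ {ω | ¬S.Good P T δ (meanG 𝒢) (feedback r G τ ω)} ≤ ENNReal.ofReal (4 * δ) := by
  obtain ⟨q₀, hq₀, hq₀ρ⟩ := S.exists_le_neg_viol (P := P) hm (meanG 𝒢)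
  have hζ : 0 < S.zeta P (meanG 𝒢) := by
    have h1 : (0 : ℝ) < m := by exact_mod_cast hm
    linarith [S.le_zeta hρ0 hρL]
  have hδ0 := hδ.1.le
  have h12 := measure_not_le_add hδ0 hδ0 (h.measure_not_regular_le hP hT hδ)
    (h.measure_visits_le hP hT hδ) fun ω h1 h2 =>
      And.intro h1 (h1.sum_sum_abs_run_q_sub_played_le hT hδ h2)
  have h34 := measure_not_le_add hδ0 hδ0 (h.measure_viol_le hG hP hT hδ hζ hq₀)
    (h.measure_entries_le hG hT hδ hζ) fun ω h1 h2 => And.intro h1 h2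
  rw [show 4 * δ = δ + δ + (δ + δ) by ring]
  refine measure_not_le_add (by linarith) (by linarith) h12 h34 fun ω h1 h2 => ?_
  exact ⟨h1.1, h1.1.lamSum_lt hm hT hδ hq₀ hρ0 hρL hq₀ρ h2.1, h1.2, h2.2⟩

omit [DecidableEq X] [DecidableEq A] [Nonempty A] in
theorem mul_dot_avgR (hT : 0 < T) (r : ℕ → Ω → X → A → ℝ) (ω : Ω) (q : Vec X A) :
    T * dot (avgR T r ω) q = ∑ t ∈ Finset.range T, dot (r t ω) q := by
  have hT' : (T : ℝ) ≠ 0 := by positivity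
  unfold dot avgR
  calc _ = ∑ x, ∑ a, ∑ t ∈ Finset.range T, r t ω x a * q (x, a) := by
        rw [Finset.mul_sum]
        refine Finset.sum_congr rfl fun x _ => ?_
        rw [Finset.mul_sum]
        refine Finset.sum_congr rfl fun a _ => ?_
        rw [← Finset.sum_mul, ← mul_assoc, ← mul_assoc, mul_one_div_cancel hT', one_mul]
    _ = ∑ x, ∑ t ∈ Finset.range T, ∑ a, r t ω x a * q (x, a) :=
        Finset.sum_congr rfl fun x _ => Finset.sum_comm
    _ = _ := Finset.sum_comm

end Good

end CMDP

theorem mainTheorem1 {X A : Type*} [Fintype X] [DecidableEq X] [Fintype A] [DecidableEq A]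
    [Nonempty A] {L m : ℕ} (hm : 0 < m) (S : LoopFree X L) :
    -- the constant hidden in the `Õ` depends only on the state and action spaces and on `m`
    ∃ c : ℝ, 0 < c ∧
    ∀ (T : ℕ) (_ : 0 < T) (δ : ℝ) (_ : δ ∈ Set.Ioo (0 : ℝ) 1)
      (P : X → A → X → ℝ) (_ : S.IsTransition P)
      (𝒢 : MeasureTheory.Measure (X → A → Fin m → ℝ))
      -- the condition on the feasibility parameter
      (_ : (T : ℝ) ^ (-(1 : ℝ) / 8) * L * Real.sqrt (20 * m) ≤ S.rho P (meanG 𝒢))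
      {Ω : Type*} [mΩ : MeasurableSpace Ω] (μ : MeasureTheory.Measure Ω)
      [MeasureTheory.IsProbabilityMeasure μ] (ℱ : MeasureTheory.Filtration ℕ mΩ)
      (r : ℕ → Ω → X → A → ℝ) (G : ℕ → Ω → X → A → Fin m → ℝ) (τ : ℕ → Ω → Traj X A L)
      (_ : S.IsInteraction μ ℱ P T δ r G τ) (_ : IsStochastic μ ℱ T 𝒢 G),
      -- adversarial rewards
      (IsAdversarial ℱ T r →
        (∀ ω, ∃ q, S.IsOptimal P (avgR T r ω) (meanG 𝒢) q) ∧
        ∀ qs : Ω → Vec X A, (∀ ω, S.IsOptimal P (avgR T r ω) (meanG 𝒢) (qs ω)) →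
          ∃ E : Set Ω, MeasurableSet E ∧ ENNReal.ofReal (1 - 4 * δ) ≤ μ E ∧ ∀ ω ∈ E,
            S.regret P (avgR T r ω) (meanG 𝒢) T δ (feedback r G τ ω) ≤
              S.zeta P (meanG 𝒢) * errG L T δ + S.zeta P (meanG 𝒢) * errQ X A L T δ
                + S.dualRegret T δ (feedback r G τ ω) 0
                + S.primalRegret P T δ (feedback r G τ ω) (qs ω) ∧
            S.violation P T δ (feedback r G τ ω) ≤
              1 / dualRate X A m T δ * S.zeta P (meanG 𝒢) + errQ X A L T δ ∧
            S.regret P (avgR T r ω) (meanG 𝒢) T δ (feedback r G τ ω) ≤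
              c * (S.zeta P (meanG 𝒢) * Real.sqrt (T * Real.log (T ^ 2 / δ))) ∧
            S.violation P T δ (feedback r G τ ω) ≤
              c * (S.zeta P (meanG 𝒢) * Real.sqrt (T * Real.log (T ^ 2 / δ)))) ∧
      -- stochastic rewards
      (∀ ℛ : MeasureTheory.Measure (X → A → ℝ), IsStochastic μ ℱ T ℛ r →
        (∃ q, S.IsOptimal P (meanR ℛ) (meanG 𝒢) q) ∧
        ∀ qs : Vec X A, S.IsOptimal P (meanR ℛ) (meanG 𝒢) qs →
          ∃ E : Set Ω, MeasurableSet E ∧ ENNReal.ofReal (1 - 5 * δ) ≤ μ E ∧ ∀ ω ∈ E,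
            S.regret P (meanR ℛ) (meanG 𝒢) T δ (feedback r G τ ω) ≤
              errR L T δ + S.zeta P (meanG 𝒢) * errG L T δ + S.zeta P (meanG 𝒢) * errQ X A L T δ
                + S.dualRegret T δ (feedback r G τ ω) 0
                + S.primalRegret P T δ (feedback r G τ ω) qs ∧
            S.violation P T δ (feedback r G τ ω) ≤
              1 / dualRate X A m T δ * S.zeta P (meanG 𝒢) + errQ X A L T δ ∧
            S.regret P (meanR ℛ) (meanG 𝒢) T δ (feedback r G τ ω) ≤
              c * (S.zeta P (meanG 𝒢) * Real.sqrt (T * Real.log (T ^ 2 / δ))) ∧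
            S.violation P T δ (feedback r G τ ω) ≤
              c * (S.zeta P (meanG 𝒢) * Real.sqrt (T * Real.log (T ^ 2 / δ)))) := by
  refine ⟨finalConst X A L m, finalConst_pos S, ?_⟩
  intro T hT δ hδ P hP 𝒢 hρ Ω mΩ μ _ ℱ r G τ h hG
  have hρ0 := S.rho_pos hm hT hρ
  have hρL := S.rho_le hm hP (h.abs_meanG_le hG hT)
  have hT20 := S.twenty_le hm hT hρ hρL
  have hm1 : (1 : ℝ) ≤ m := by exact_mod_cast hm
  have hζ1 : 1 ≤ S.zeta P (meanG 𝒢) := by linarith [S.le_zeta hρ0 hρL]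
  have hζT := S.zeta_le hm hT hρ
  have hδ0 := hδ.1.le
  have hgood := h.measure_not_good_le hG hm hP hT20 hδ hρ0 hρL
  have hL : (0 : ℝ) < L := by exact_mod_cast S.horizon_pos
  refine ⟨fun _ => ⟨fun ω => S.exists_isOptimal hm hρ0.le _, fun qs hqs => ?_⟩,
    fun ℛ hr => ⟨S.exists_isOptimal hm hρ0.le _, fun qs hqs => ?_⟩⟩
  · obtain ⟨E, hE, hμE, hEg⟩ := exists_measurableSet_subset (by linarith) hgood
    refine ⟨E, hE, hμE, fun ω hω => ?_⟩
    -- For the empirical average the reward gap vanishes identically for every q, so the optimal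
    -- solution may vary with the outcome.
    have hb := (hEg ω hω).bounds hm hT20 hδ hζ1 hζT (hqs ω) (e := 0)
      (by unfold errR; positivity) (by
        rw [zero_add, mul_dot_avgR hT]
        rfl)
    rw [zero_add] at hb
    exact hb
  -- Here the optimal solution is deterministic, so the reward noise at it adds one event of
  -- probability δ.
  · obtain ⟨E, hE, hμE, hEg⟩ := exists_measurableSet_subset (by linarith)
      (measure_not_le_add (by linarith) hδ0 hgood
        (h.measure_reward_le hr hP hT20 hδ hqs.1.1) fun ω h1 h2 => And.intro h1 h2)
    refine ⟨E, hE, by convert hμE using 3; ring, fun ω hω => ?_⟩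
    exact (hEg ω hω).1.bounds hm hT20 hδ hζ1 hζT hqs le_rfl (hEg ω hω).2
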